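/- **Model.** A *tile type* is a unit square whose four sides carry glues; a glue is a pair (label, strength) with strength in $\mathbb{N}$. An *assembly* over a finite set $T$ of tile types is a partial function $\alpha:\mathbb{Z}^2\rightharpoonup T$; its *supertile* is the set of its translates. Two adjacent tiles are bonded, with the strength of the glue, if the glues on their abutting sides are equal and have positive strength. An assembly is *$\tau$-stable* if every cut of its binding graph has weight at least $\tau$. A 2HAM system $(T,\tau)$ (with the default initial state) has infinitely many copies of each single tile of $T$; two supertiles can combine into $\tilde\gamma$ if they have disjoint representatives whose union is $\tau$-stable and represents $\tilde\gamma$. A supertile is *producible* if it is the result of a finite or infinite sequence of such combinations starting from single tiles (so it may be infinite), and *terminal* if it is producible and cannot combine with any producible supertile. Write $\tilde\alpha\to^1\tilde\beta$ if $\tilde\alpha$ becomes $\tilde\beta$ by combining with one producible supertile, $\tilde\alpha\to^{\le1}\tilde\beta$ if $\tilde\alpha=\tilde\beta$ or $\tilde\alpha\to^1\tilde\beta$, and $\tilde\alpha\to\tilde\beta$ if $\tilde\beta$ is the result of a finite or infinite assembly sequence starting with $\tilde\alpha$. **Simulation.** Let $\mathcal U=(U,\tau')$, $\mathcal T=(T,\tau)$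 be 2HAM systems, $m\ge1$, and let $R$ be a partial function from $m\times m$ blocks of (possibly missing) tiles of $U$ to $T$. For an assembly $\alpha$ over $U$ let $R^*(\alpha)$ be the assembly with $R^*(\alpha)(x,y)=R(\alpha^m_{x,y})$, where $\alpha^m_{x,y}$ is the block of $\alpha$ at $\{mx,\dots,mx+m-1\}\times\{my,\dots,my+m-1\}$, and let $\tilde R(\tilde\alpha)$ be the set of all non-empty $R^*(\alpha)$, $\alpha\in\tilde\alpha$ (if it is empty, $\tilde\alpha$ represents nothing yet). $\mathcal U$ *simulates* $\mathcal T$ at scale factor $m$ under $R$ if: 1. (equivalent productions) the non-empty sets among the $\tilde R(\tilde\alpha)$, $\tilde\alpha$ producible in $\mathcal U$, are exactly the producible supertiles of $\mathcal T$; the $\tilde R(\tilde\alpha)$, $\tilde\alpha$ terminal in $\mathcal U$, are exactly the terminal supertiles of $\mathcal T$; and every producible $\tilde\alpha$ of $\mathcal U$ maps cleanly: either $\tilde R(\tilde\alpha)=\emptyset$ and some $\alpha\in\tilde\alpha$ has at most one non-empty block, or $\tilde R(\tilde\alpha)$ is a supertile and, for each $\alpha\in\tilde\alpha$ with $R^*(\alpha)$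 non-empty, either each non-empty block of $\alpha$ is at, or directly north, south, east or west of, a position in the domain of $R^*(\alpha)$, or $\alpha$ has at most one non-empty block; 2. ($\mathcal T$ follows $\mathcal U$) if $\tilde\alpha\to^1_{\mathcal U}\tilde\beta$ for producible $\tilde\alpha,\tilde\beta$ with $\tilde R(\tilde\alpha)\ne\emptyset$, then $\tilde R(\tilde\alpha)\to^{\le1}_{\mathcal T}\tilde R(\tilde\beta)$; and a combination of two producible supertiles that represent nothing represents nothing or a single tile; 3. ($\mathcal U$ weakly models $\mathcal T$) if $\tilde\alpha\to^1_{\mathcal T}\tilde\beta$ for producible $\tilde\alpha,\tilde\beta$ of $\mathcal T$, then for every producible $\tilde\alpha'$ of $\mathcal U$ with $\tilde R(\tilde\alpha')=\tilde\alpha$ there are producible $\tilde\alpha'',\tilde\beta'$ of $\mathcal U$ with $\tilde R(\tilde\alpha'')=\tilde\alpha$, $\tilde\alpha'\to_{\mathcal U}\tilde\alpha''$, $\tilde\alpha''\to^1_{\mathcal U}\tilde\beta'$ and $\tilde R(\tilde\beta')=\tilde\beta$. **Ladder system.** The ladder system at temperature $\tau$ is $(\{A_0,A_1,A_2,A_3,B_0,B_1,B_2,B_3\},\tau)$.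 Glue $0$ has strength $1$ and is on the east side of $A_0$ and the west side of $B_0$. Glues $1,\dots,8$ have strength $\tau$: $1$ joins the west side of $A_0$ to the east side of $A_1$; $2$ joins the west side of $A_1$ to the east side of $A_2$; $3$ joins the south side of $A_2$ to the north side of $A_3$; $4$ joins the south side of $A_3$ to the north side of $A_2$; $5$ joins the east side of $B_0$ to the west side of $B_1$; $6$ joins the east side of $B_1$ to the west side of $B_2$; $7$ joins the south side of $B_2$ to the north side of $B_3$; $8$ joins the south side of $B_3$ to the north side of $B_2$. All other sides have a null glue of strength $0$. **Theorem.** Let $\tau,\tau'\in\mathbb{N}$ with $1<\tau<\tau'$. Then there is a 2HAM system $\mathcal S$ at temperature $\tau'$ (with the default initial state) that simulates the ladder system at temperature $\tau$, at scale factor $2$, for some block representation function $R$. -/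

import Mathlib

/-! The two-handed tile assembly model (2HAM), simulation between 2HAM systems, and the ladder
systems.  All systems have the default initial state: infinitely many copies of each single tile. -/

namespace TwoHAM

/-- The four sides of a tile. -/
inductive Dir : Type
  | north | east | south | west

/-- The unit vector pointing out of a side. -/
def Dir.vec : Dir → ℤ × ℤ
  | .north => (0, 1)
  | .east => (1, 0)
  | .south => (0, -1)
  | .west => (-1, 0)

/-- The opposite side. -/
def Dir.opp : Dir → Dir
  | .north => .south
  | .east => .west
  | .south => .north
  | .west => .east

/-- A glue: a label (finite strings are coded by natural numbers) and a strength. -/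
@[ext]
structure Glue where
  label : ℕ
  strength : ℕ

/-- A 2HAM system `(T, τ)` with default initial state: a finite set of tile types, each of which
is determined by its four glues, and a temperature. -/
structure TAS where
  Tile : Type
  finite : Finite Tile
  glue : Tile → Dir → Glue
  glue_injective : Function.Injective glue
  temp : ℕ

/-- An assembly is a partial function from the lattice to the tile types. -/
abbrev Assembly (ι : Type) : Type := ℤ × ℤ → Option ι

namespace Assembly

variable {ι : Type}

/-- The domain of an assembly. -/
def dom (α : Assembly ι) : Set (ℤ × ℤ) := {p | α p ≠ none}

/-- The translate `α + v`. -/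
def shift (v : ℤ × ℤ) (α : Assembly ι) : Assembly ι := fun p => α (p - v)

/-- The supertile of `α`: the set of all translates of `α`. -/
def supertile (α : Assembly ι) : Set (Assembly ι) := {β | ∃ v, β = shift v α}

/-- The union of two assemblies (only used for disjoint ones). -/
def union (α β : Assembly ι) : Assembly ι := fun p => (α p).or (β p)

open Classical in
/-- The assembly consisting of one tile at the origin. -/
noncomputable def single (t : ι) : Assembly ι := fun p => if p = 0 then some t else none

/-- `α` is the union (limit) of the sequence `f`. -/
def IsResult (f : ℕ → Assembly ι) (α : Assembly ι) : Prop :=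
  ∀ p t, α p = some t ↔ ∃ i, f i p = some t

end Assembly

namespace TAS

open Assembly

variable (S : TAS)

open Classical in
/-- The strength of the bond between position `p` and its neighbour on side `d`: the strength of
the two abutting glues if both tiles are present and these glues are equal, and `0` otherwise. -/
noncomputable def bond (α : Assembly S.Tile) (p : ℤ × ℤ) (d : Dir) : ℕ :=
  match α p, α (p + d.vec) with
  | some s, some t => if S.glue s d = S.glue t d.opp then (S.glue s d).strength else 0
  | _, _ => 0

/-- `τ`-stability: every cut `(X, dom α \ X)` of the binding graph has weight at least `τ`.
The weight may be an infinite sum, hence the finite sets `F` of edges across the cut; each edge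
is listed from its end in `X`, so none is counted twice. -/
def Stable (α : Assembly S.Tile) : Prop :=
  ∀ X : Set (ℤ × ℤ), X ⊆ dom α → X.Nonempty → X ≠ dom α →
    ∃ F : Finset ((ℤ × ℤ) × Dir),
      (∀ e ∈ F, e.1 ∈ X ∧ e.1 + e.2.vec ∈ dom α \ X) ∧
      S.temp ≤ ∑ e ∈ F, S.bond α e.1 e.2

/-- `α` and `β`, as positioned, are disjoint and their union is stable. -/
def Attaches (α β : Assembly S.Tile) : Prop :=
  Disjoint (dom α) (dom β) ∧ S.Stable (α.union β)

/-- The combination set of two supertiles. -/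
def Combine (a b : Set (Assembly S.Tile)) : Set (Set (Assembly S.Tile)) :=
  {c | ∃ α ∈ a, ∃ β ∈ b, S.Attaches α β ∧ c = supertile (α.union β)}

/-- Supertiles that are produced in finitely many steps.  Since the initial state has infinitely
many copies of every tile, these are the supertiles that occur in the states of assembly
sequences starting from it. -/
inductive FinProducible : Set (Assembly S.Tile) → Prop
  | tile (t : S.Tile) : FinProducible (supertile (single t))
  | combine {a b c : Set (Assembly S.Tile)} :
      FinProducible a → FinProducible b → c ∈ S.Combine a b → FinProducible c

/-- A sequence of assemblies in which every step either does nothing or attaches an assembly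
whose supertile belongs to `P`.  (Finite sequences are continued by constant ones.) -/
def IsSequence (P : Set (Set (Assembly S.Tile))) (f : ℕ → Assembly S.Tile) : Prop :=
  ∀ i, f (i + 1) = f i ∨
    ∃ β, supertile β ∈ P ∧ S.Attaches (f i) β ∧ f (i + 1) = (f i).union β

/-- The set of producible supertiles: the results of all finite and infinite assembly sequences
that start from the initial state.  They may be infinite. -/
def Producible : Set (Set (Assembly S.Tile)) :=
  {a | ∃ (f : ℕ → Assembly S.Tile) (α : Assembly S.Tile), S.FinProducible (supertile (f 0)) ∧
    S.IsSequence {b | S.FinProducible b} f ∧ IsResult f α ∧ a = supertile α}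

/-- The set of terminal producible supertiles. -/
def Terminal : Set (Set (Assembly S.Tile)) :=
  {a | a ∈ S.Producible ∧ ∀ b ∈ S.Producible, S.Combine a b = ∅}

/-- `a →¹ b`: `a` becomes `b` by combining with one producible supertile. -/
def Step (a b : Set (Assembly S.Tile)) : Prop :=
  ∃ c ∈ S.Producible, b ∈ S.Combine a c

/-- `a →^{≤1} b`. -/
def StepLE (a b : Set (Assembly S.Tile)) : Prop :=
  a = b ∨ S.Step a b

/-- `a → b`: `b` is the result of a finite or infinite assembly sequence starting with `a`. -/
def Reaches (a b : Set (Assembly S.Tile)) : Prop :=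
  ∃ (f : ℕ → Assembly S.Tile) (α : Assembly S.Tile), supertile (f 0) = a ∧
    S.IsSequence S.Producible f ∧ IsResult f α ∧ b = supertile α

end TAS

section Simulation

open Assembly

variable {ι κ : Type}

/-- `m`-block assemblies (macrotiles). -/
abbrev Block (m : ℕ) (ι : Type) : Type := Fin m → Fin m → Option ι

/-- The block of `α` at block coordinates `(x, y)`. -/
def block (m : ℕ) (α : Assembly ι) (x y : ℤ) : Block m ι :=
  fun i j => α (m * x + (i : ℕ), m * y + (j : ℕ))

/-- The block at `(x, y)` is not empty. -/
def BlockNonempty (m : ℕ) (α : Assembly ι) (x y : ℤ) : Prop :=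
  ∃ i j, block m α x y i j ≠ none

/-- `α` has at most one non-empty block. -/
def AtMostOneBlock (m : ℕ) (α : Assembly ι) : Prop :=
  ∀ x y x' y', BlockNonempty m α x y → BlockNonempty m α x' y' → x = x' ∧ y = y'

/-- The assembly representation function `R*`. -/
def assemblyRepr (m : ℕ) (R : Block m ι → Option κ) (α : Assembly ι) : Assembly κ :=
  fun p => R (block m α p.1 p.2)

/-- The supertile representation function: the assemblies `R*(α)`, `α ∈ a`, with the empty
assembly left out.  So translates of an assembly that are not aligned with the grid of macrotiles
(and on which `R` is nowhere defined) do not count, while all translates that represent something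
do; `superRepr m R a = ∅` means that `a` does not yet represent any tile. -/
def superRepr (m : ℕ) (R : Block m ι → Option κ) (a : Set (Assembly ι)) : Set (Assembly κ) :=
  {β | (dom β).Nonempty ∧ ∃ α ∈ a, β = assemblyRepr m R α}

/-- `α` maps cleanly to `β`: non-empty blocks lie at, or directly north, south, east or west of,
a position of `β`, or there is at most one non-empty block. -/
def CleanTo (m : ℕ) (α : Assembly ι) (β : Assembly κ) : Prop :=
  (∀ x y, BlockNonempty m α x y →
    ∃ u v : ℤ, u ^ 2 + v ^ 2 < 2 ∧ (x + u, y + v) ∈ dom β) ∨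
  AtMostOneBlock m α

/-- The supertile `a` maps cleanly.  If it represents nothing, it has to fit into one block. -/
def MapsCleanly (m : ℕ) (R : Block m ι → Option κ) (a : Set (Assembly ι)) : Prop :=
  (superRepr m R a = ∅ ∧ ∃ α ∈ a, AtMostOneBlock m α) ∨
  ((∃ β, superRepr m R a = supertile β) ∧
    ∀ α ∈ a, (dom (assemblyRepr m R α)).Nonempty → CleanTo m α (assemblyRepr m R α))

variable (U T : TAS) (m : ℕ) (R : Block m U.Tile → Option T.Tile)

/-- `U` and `T` have equivalent productions. -/
def EquivalentProductions : Prop :=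
  (superRepr m R '' U.Producible) \ {∅} = T.Producible ∧
  superRepr m R '' U.Terminal = T.Terminal ∧
  ∀ a ∈ U.Producible, MapsCleanly m R a

/-- `T` follows `U`.  The second clause covers the supertiles of `U` that do not yet represent
anything: two of these can together represent at most one single tile. -/
def Follows : Prop :=
  (∀ a ∈ U.Producible, ∀ b ∈ U.Producible, U.Step a b → superRepr m R a ≠ ∅ →
    T.StepLE (superRepr m R a) (superRepr m R b)) ∧
  (∀ a ∈ U.Producible, ∀ b ∈ U.Producible, superRepr m R a = ∅ → superRepr m R b = ∅ →
    ∀ c ∈ U.Combine a b, superRepr m R c = ∅ ∨ ∃ t, superRepr m R c = supertile (single t))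

/-- `U` weakly models `T`. -/
def WeaklyModels : Prop :=
  ∀ a ∈ T.Producible, ∀ b ∈ T.Producible, T.Step a b →
    ∀ a' ∈ U.Producible, superRepr m R a' = a →
      ∃ a'' ∈ U.Producible, superRepr m R a'' = a ∧ U.Reaches a' a'' ∧
        ∃ b' ∈ U.Producible, U.Step a'' b' ∧ superRepr m R b' = b

/-- `U` (standardly, not necessarily strongly) simulates `T` at scale factor `m` under `R`. -/
def Simulates : Prop :=
  EquivalentProductions U T m R ∧ Follows U T m R ∧ WeaklyModels U T m R

end Simulation

section Ladder

/-- The tile types of the ladder systems: `A0, …, A3` form left half-ladders and `B0, …, B3`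
right half-ladders. -/
inductive LadderTile : Type
  | A0 | A1 | A2 | A3 | B0 | B1 | B2 | B3

theorem LadderTile.finite : Finite LadderTile := by
  refine Set.finite_univ_iff.mp (Set.Finite.subset (s := {A0, A1, A2, A3, B0, B1, B2, B3})
    (Set.toFinite _) ?_)
  intro t _
  cases t <;> simp

/-- The glues.  Label `0` has strength `1`, the labels `1, …, 8` have strength `τ`, and all other
sides carry the null glue of strength `0`.  The backbone of a left half-ladder is a vertical
column in which `A2` and `A3` alternate; a rung is an `A1` to the east of an `A2`, followed by an
`A0`.  Right half-ladders are mirror images, and the ends `A0`, `B0` of facing rungs share the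
glue of strength `1`. -/
def ladderGlue (τ : ℕ) : LadderTile → Dir → Glue
  | .A0, .east => ⟨0, 1⟩
  | .A0, .west => ⟨1, τ⟩
  | .A1, .east => ⟨1, τ⟩
  | .A1, .west => ⟨2, τ⟩
  | .A2, .east => ⟨2, τ⟩
  | .A2, .south => ⟨3, τ⟩
  | .A2, .north => ⟨4, τ⟩
  | .A3, .north => ⟨3, τ⟩
  | .A3, .south => ⟨4, τ⟩
  | .B0, .west => ⟨0, 1⟩
  | .B0, .east => ⟨5, τ⟩
  | .B1, .west => ⟨5, τ⟩
  | .B1, .east => ⟨6, τ⟩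
  | .B2, .west => ⟨6, τ⟩
  | .B2, .south => ⟨7, τ⟩
  | .B2, .north => ⟨8, τ⟩
  | .B3, .north => ⟨7, τ⟩
  | .B3, .south => ⟨8, τ⟩
  | _, _ => ⟨0, 0⟩

theorem ladderGlue_injective (τ : ℕ) : Function.Injective (ladderGlue τ) := by
  intro s t h
  have hn := congrArg Glue.label (congrFun h .north)
  have he := congrArg Glue.label (congrFun h .east)
  have hw := congrArg Glue.label (congrFun h .west)
  have hs := congrArg Glue.label (congrFun h .south)
  cases s <;> cases t <;> simp_all [ladderGlue]

/-- The ladder system at temperature `τ`. -/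
abbrev ladderSystem (τ : ℕ) : TAS where
  Tile := LadderTile
  finite := LadderTile.finite
  glue := ladderGlue τ
  glue_injective := ladderGlue_injective τ
  temp := τ

end Ladder

end TwoHAM

/-!
Write `δ = τ' - τ`.  In the simulating system each tile `t` of the ladder system becomes a macrotile
in a `2 × 2` block: a main tile, whose presence alone decides what the block represents, and a link,
which carries one of the strong bonds of `t`.  The glues between main tiles and links have strength
`τ'`, and a strong bond between two assemblies of the simulating system is one between the assemblies
that they represent.  The weak glue of the ladder system is kept, with strength `1`, between the main
tiles at the ends of facing rungs.  A bond by weak glues alone needs `τ` pairs of rungs, and these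
now have to be supplemented by an additional strength of exactly `δ`.

For this purpose the end of each rung has a plug with a glue of strength `δ`, and the labels of these
glues are such that between two half-ladders the additional strength `δ` is never available twice.
Each half-ladder has a colour and at most one distinguished row, both propagated through its
macrotiles as their `State`.  In the distinguished row a right plug matches the left plugs of rows
that are not distinguished if the colours agree, and in the distinguished row a left plug matches the
right plugs of such rows if the colours differ.  So all matching plugs of two half-ladders lie in one
and the same row (`State.Mono.not_ext`).

* The additional strength is available at most once (`Facing.unique`).  If two disjoint assemblies
  had matching plugs in two rows, then one of them would contain the left backbone and the other one
  the right backbone in all the rows in between: each of them has to cross these rows, which is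
  possible in the backbone columns only (`exists_columns`).  By stability, plugs show the state of
  their backbone, so that `State.Mono.not_ext` applies.  Consequently assemblies that attach to each
  other in the simulating system represent assemblies that do so in the ladder system
  (`repr_attaches`).
* The additional strength is available when it is needed.  Every producible assembly of the ladder
  system has a lift in which the state of one macrotile is prescribed (`exists_prod_lift`).  If `γ`
  can attach to what `α` represents, then for any state of one rung of `α` there is a state of the
  facing rung of `γ` with a matching plug, so that a suitable lift of `γ` attaches to `α`, possibly
  after one missing link or plug has been added to `α` (`exists_attaches`).

Infinite assemblies are reduced to finite ones by compactness: a bond needs finitely many edges only,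
so it is present at some stage of any sequence that yields the assembly (`TAS.Bonded.exists_index`);
in particular two producible assemblies that attach to each other have a producible union
(`TAS.Prod.union`).
-/

namespace TwoHAM

open Assembly

/-! ### Assemblies -/

@[simp] theorem Dir.opp_opp (d : Dir) : d.opp.opp = d := by cases d <;> rfl

@[simp] theorem Dir.vec_opp (d : Dir) : d.opp.vec = -d.vec := by cases d <;> rfl

namespace Assembly

variable {ι : Type}

theorem mem_dom {α : Assembly ι} {p : ℤ × ℤ} : p ∈ dom α ↔ ∃ t, α p = some t :=
  Option.ne_none_iff_exists'

theorem notMem_dom {α : Assembly ι} {p : ℤ × ℤ} : p ∉ dom α ↔ α p = none := by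
  simp [dom]

theorem mem_dom_of_eq {α : Assembly ι} {p : ℤ × ℤ} {t : ι} (h : α p = some t) : p ∈ dom α :=
  mem_dom.2 ⟨t, h⟩

theorem shift_apply (v : ℤ × ℤ) (α : Assembly ι) (p : ℤ × ℤ) : shift v α p = α (p - v) := rfl

@[simp] theorem shift_zero (α : Assembly ι) : shift 0 α = α := by
  funext p; simp [shift]

@[simp] theorem shift_shift (v w : ℤ × ℤ) (α : Assembly ι) :
    shift v (shift w α) = shift (v + w) α := by
  funext p; simp only [shift]; congr 1; abel

theorem mem_supertile_self (α : Assembly ι) : α ∈ supertile α := ⟨0, by simp⟩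

@[simp] theorem supertile_shift (v : ℤ × ℤ) (α : Assembly ι) :
    supertile (shift v α) = supertile α := by
  ext β
  constructor
  · rintro ⟨w, rfl⟩; exact ⟨w + v, by simp⟩
  · rintro ⟨w, rfl⟩; exact ⟨w - v, by simp⟩

theorem exists_shift_of_supertile_eq {α β : Assembly ι} (h : supertile α = supertile β) :
    ∃ v, α = shift v β := by
  have := mem_supertile_self α
  rw [h] at this
  exact this

theorem mem_dom_shift {v : ℤ × ℤ} {α : Assembly ι} {p : ℤ × ℤ} :
    p ∈ dom (shift v α) ↔ p - v ∈ dom α := Iff.rfl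

theorem shift_union (v : ℤ × ℤ) (α β : Assembly ι) :
    shift v (α.union β) = (shift v α).union (shift v β) := rfl

theorem union_apply_of_mem {α β : Assembly ι} {p : ℤ × ℤ} (h : p ∈ dom α) :
    α.union β p = α p := by
  obtain ⟨t, ht⟩ := mem_dom.1 h
  simp [union, ht]

theorem union_apply_of_notMem {α β : Assembly ι} {p : ℤ × ℤ} (h : p ∉ dom α) :
    α.union β p = β p := by
  simp [union, notMem_dom.1 h]

theorem union_eq_some {α β : Assembly ι} {p : ℤ × ℤ} {t : ι} :
    α.union β p = some t ↔ α p = some t ∨ α p = none ∧ β p = some t := by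
  cases h : α p <;> simp [union, h]

@[simp] theorem dom_union (α β : Assembly ι) : dom (α.union β) = dom α ∪ dom β := by
  ext p
  cases h : α p <;> simp [dom, union, h]

theorem union_assoc (α β γ : Assembly ι) : (α.union β).union γ = α.union (β.union γ) := by
  funext p
  cases h : α p <;> simp [union, h]

/-- `α` is a sub-assembly of `β`. -/
def Sub (α β : Assembly ι) : Prop := ∀ p t, α p = some t → β p = some t

theorem Sub.refl (α : Assembly ι) : Sub α α := fun _ _ h => h

theorem Sub.trans {α β γ : Assembly ι} (h : Sub α β) (h' : Sub β γ) : Sub α γ :=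
  fun p t ht => h' p t (h p t ht)

theorem Sub.dom {α β : Assembly ι} (h : Sub α β) : dom α ⊆ dom β := fun p hp => by
  obtain ⟨t, ht⟩ := mem_dom.1 hp
  exact mem_dom_of_eq (h p t ht)

theorem Sub.apply_eq {α β : Assembly ι} (h : Sub α β) {p : ℤ × ℤ} (hp : p ∈ Assembly.dom α) :
    β p = α p := by
  obtain ⟨t, ht⟩ := mem_dom.1 hp
  rw [ht, h p t ht]

theorem sub_union_left (α β : Assembly ι) : Sub α (α.union β) :=
  fun _ _ h => union_eq_some.2 (Or.inl h)

theorem sub_union_right {α β : Assembly ι} (h : Disjoint (Assembly.dom α) (Assembly.dom β)) :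
    Sub β (α.union β) := fun p t ht => by
  refine union_eq_some.2 (Or.inr ⟨?_, ht⟩)
  exact notMem_dom.1 (fun hp => Set.disjoint_left.1 h hp (mem_dom_of_eq ht))

theorem union_comm {α β : Assembly ι} (h : Disjoint (Assembly.dom α) (Assembly.dom β)) :
    α.union β = β.union α := by
  funext p
  by_cases hp : p ∈ Assembly.dom α
  · rw [union_apply_of_mem hp, union_apply_of_notMem (Set.disjoint_left.1 h hp)]
  · rw [union_apply_of_notMem hp]
    by_cases hq : p ∈ Assembly.dom β
    · rw [union_apply_of_mem hq]
    · rw [union_apply_of_notMem hq, notMem_dom.1 hp, notMem_dom.1 hq]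

open Classical in
/-- The part of `ω` inside `D`. -/
noncomputable def restrict (ω : Assembly ι) (D : Set (ℤ × ℤ)) : Assembly ι :=
  fun p => if p ∈ D then ω p else none

theorem restrict_eq_some {ω : Assembly ι} {D : Set (ℤ × ℤ)} {p : ℤ × ℤ} {t : ι} :
    restrict ω D p = some t ↔ p ∈ D ∧ ω p = some t := by
  by_cases h : p ∈ D <;> simp [restrict, h]

theorem dom_restrict (ω : Assembly ι) (D : Set (ℤ × ℤ)) :
    dom (restrict ω D) = D ∩ dom ω := by
  ext p
  by_cases h : p ∈ D <;> simp [restrict, h, dom]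

theorem ext_some {α β : Assembly ι} (h : ∀ p t, α p = some t ↔ β p = some t) : α = β := by
  funext p
  exact Option.ext (fun t => h p t)

theorem restrict_union (ω : Assembly ι) (D E : Set (ℤ × ℤ)) :
    restrict ω (D ∪ E) = (restrict ω D).union (restrict ω E) := by
  funext p
  by_cases h : p ∈ D <;> by_cases h' : p ∈ E <;> cases ho : ω p <;>
    simp [restrict, union, h, h', ho]

/-- The assembly with the single tile `t` at `z`. -/
noncomputable def singleAt (z : ℤ × ℤ) (t : ι) : Assembly ι := shift z (single t)

theorem singleAt_eq_some {z p : ℤ × ℤ} {t u : ι} :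
    singleAt z t p = some u ↔ p = z ∧ t = u := by
  simp only [singleAt, shift, single]
  split_ifs with h
  · simp [sub_eq_zero.1 h]
  · have : p ≠ z := fun h' => h (sub_eq_zero.2 h')
    simp [this]

@[simp] theorem dom_singleAt (z : ℤ × ℤ) (t : ι) : dom (singleAt z t) = {z} := by
  ext p
  simp [mem_dom, singleAt_eq_some]

@[simp] theorem supertile_singleAt (z : ℤ × ℤ) (t : ι) :
    supertile (singleAt z t) = supertile (single t) := supertile_shift _ _

theorem union_singleAt_eq_some {α : Assembly ι} {z p : ℤ × ℤ} {t u : ι} (hz : z ∉ dom α) :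
    α.union (singleAt z t) p = some u ↔ α p = some u ∨ p = z ∧ t = u := by
  rw [union_eq_some, singleAt_eq_some]
  constructor
  · rintro (h | ⟨-, h⟩)
    exacts [Or.inl h, Or.inr h]
  · rintro (h | ⟨rfl, h⟩)
    exacts [Or.inl h, Or.inr ⟨notMem_dom.1 hz, rfl, h⟩]

theorem IsResult.shift {f : ℕ → Assembly ι} {α : Assembly ι} (h : IsResult f α) (v : ℤ × ℤ) :
    IsResult (fun i => Assembly.shift v (f i)) (Assembly.shift v α) :=
  fun p t => h (p - v) t

theorem IsResult.sub {f : ℕ → Assembly ι} {α : Assembly ι} (h : IsResult f α) (i : ℕ) :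
    Sub (f i) α := fun p t ht => (h p t).2 ⟨i, ht⟩

theorem sub_of_le {f : ℕ → Assembly ι} (hf : ∀ i, Sub (f i) (f (i + 1))) {i j : ℕ}
    (hij : i ≤ j) : Sub (f i) (f j) := by
  induction hij with
  | refl => exact Sub.refl _
  | step _ ih => exact ih.trans (hf _)

/-- A finite part of the limit of an increasing sequence is reached in finitely many steps. -/
theorem IsResult.exists_index {f : ℕ → Assembly ι} {α : Assembly ι} (h : IsResult f α)
    (hf : ∀ i, Sub (f i) (f (i + 1))) (s : Finset (ℤ × ℤ)) :
    ∃ i, ∀ p ∈ s, f i p = α p := by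
  classical
  induction s using Finset.induction_on with
  | empty => exact ⟨0, by simp⟩
  | insert a s _ ih =>
    obtain ⟨i, hi⟩ := ih
    by_cases ha : a ∈ dom α
    · obtain ⟨t, ht⟩ := mem_dom.1 ha
      obtain ⟨j, hj⟩ := (h a t).1 ht
      refine ⟨max i j, fun p hp => ?_⟩
      rcases Finset.mem_insert.1 hp with rfl | hp
      · rw [ht]; exact sub_of_le hf (le_max_right _ _) _ _ hj
      · by_cases hpα : p ∈ dom α
        · obtain ⟨u, hu⟩ := mem_dom.1 hpα
          rw [hu]
          exact sub_of_le hf (le_max_left i j) _ _ ((hi p hp).trans hu)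
        · rw [notMem_dom.1 hpα]
          exact notMem_dom.1 (fun hq => hpα ((h.sub _).dom hq))
    · refine ⟨i, fun p hp => ?_⟩
      rcases Finset.mem_insert.1 hp with rfl | hp
      · rw [notMem_dom.1 ha]
        exact notMem_dom.1 (fun hq => ha ((h.sub _).dom hq))
      · exact hi p hp

theorem exists_isResult {f : ℕ → Assembly ι} (hf : ∀ i, Sub (f i) (f (i + 1))) :
    ∃ α, IsResult f α := by
  have : ∀ p, ∃ o : Option ι, ∀ t, o = some t ↔ ∃ i, f i p = some t := by
    intro p
    by_cases h : ∃ t i, f i p = some t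
    · obtain ⟨t, i, hi⟩ := h
      refine ⟨some t, fun u => ⟨fun h => ⟨i, hi.trans h⟩, fun ⟨j, hj⟩ => ?_⟩⟩
      have h1 := sub_of_le hf (le_max_left i j) _ _ hi
      have h2 := sub_of_le hf (le_max_right i j) _ _ hj
      rw [← h1, h2]
    · exact ⟨none, fun t => ⟨by simp, fun ⟨i, hi⟩ => absurd ⟨t, i, hi⟩ h⟩⟩
  choose α hα using this
  exact ⟨α, hα⟩

theorem IsResult.tail {f : ℕ → Assembly ι} {α : Assembly ι} (h : IsResult f α)
    (hf : ∀ i, Sub (f i) (f (i + 1))) (k : ℕ) : IsResult (fun i => f (k + i)) α := by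
  intro p t
  rw [h p t]
  constructor
  · rintro ⟨i, hi⟩
    exact ⟨i, sub_of_le hf (Nat.le_add_left _ _) _ _ hi⟩
  · rintro ⟨i, hi⟩
    exact ⟨_, hi⟩

end Assembly

/-! ### Bonds and stability -/

namespace TAS

variable (S : TAS)

open Classical in
/-- The strength of the bond between two (possibly missing) tiles, the second one being on side `d`
of the first one. -/
noncomputable def pairBond : Option S.Tile → Option S.Tile → Dir → ℕ
  | some s, some t, d => if S.glue s d = S.glue t d.opp then (S.glue s d).strength else 0
  | _, _, _ => 0

theorem bond_eq (α : Assembly S.Tile) (p : ℤ × ℤ) (d : Dir) :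
    S.bond α p d = S.pairBond (α p) (α (p + d.vec)) d := by
  unfold bond pairBond
  cases α p <;> cases α (p + d.vec) <;> rfl

@[simp] theorem pairBond_none_left (b : Option S.Tile) (d : Dir) : S.pairBond none b d = 0 := rfl

@[simp] theorem pairBond_none_right (a : Option S.Tile) (d : Dir) : S.pairBond a none d = 0 := by
  cases a <;> rfl

theorem pairBond_symm (a b : Option S.Tile) (d : Dir) :
    S.pairBond a b d = S.pairBond b a d.opp := by
  cases a <;> cases b <;> try rfl
  rename_i s t
  simp only [pairBond]
  rw [Dir.opp_opp]
  by_cases h : S.glue s d = S.glue t d.opp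
  · rw [if_pos h, if_pos h.symm, h]
  · rw [if_neg h, if_neg (fun h' => h h'.symm)]

variable {S}

theorem pairBond_mono {a a' b b' : Option S.Tile} (ha : ∀ t, a = some t → a' = some t)
    (hb : ∀ t, b = some t → b' = some t) (d : Dir) :
    S.pairBond a b d ≤ S.pairBond a' b' d := by
  cases a with
  | none => simp
  | some s =>
    cases b with
    | none => simp
    | some t => rw [ha s rfl, hb t rfl]

theorem exists_of_pairBond_pos {a b : Option S.Tile} {d : Dir} (h : S.pairBond a b d ≠ 0) :
    ∃ s t, a = some s ∧ b = some t ∧ S.glue s d = S.glue t d.opp ∧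
      (S.glue s d).strength ≠ 0 := by
  cases a with
  | none => simp at h
  | some s =>
    cases b with
    | none => simp at h
    | some t =>
      simp only [pairBond] at h
      split_ifs at h with hg
      exacts [⟨s, t, rfl, rfl, hg, h⟩, absurd rfl h]

variable (S)

/-- The bonds between `α` and `β`, as positioned, have total strength at least the temperature. -/
def Bonded (α β : Assembly S.Tile) : Prop :=
  ∃ F : Finset ((ℤ × ℤ) × Dir),
    S.temp ≤ ∑ e ∈ F, S.pairBond (α e.1) (β (e.1 + e.2.vec)) e.2

variable {S} {α β γ : Assembly S.Tile}

theorem Bonded.mono {α' β' : Assembly S.Tile} (h : S.Bonded α β) (hα : Sub α α')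
    (hβ : Sub β β') : S.Bonded α' β' := by
  obtain ⟨F, hF⟩ := h
  exact ⟨F, hF.trans (Finset.sum_le_sum fun e _ => pairBond_mono (hα _) (hβ _) _)⟩

theorem Bonded.symm (h : S.Bonded α β) : S.Bonded β α := by
  classical
  obtain ⟨F, hF⟩ := h
  have hinj : Function.Injective
      (fun e : (ℤ × ℤ) × Dir => (e.1 + e.2.vec, e.2.opp)) := by
    rintro ⟨p, d⟩ ⟨q, d'⟩ h
    simp only [Prod.mk.injEq] at h
    have hd : d = d' := by simpa using congrArg Dir.opp h.2
    subst hd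
    simpa using h.1
  refine ⟨F.image (fun e => (e.1 + e.2.vec, e.2.opp)), hF.trans (le_of_eq ?_)⟩
  rw [Finset.sum_image (fun a _ b _ hab => hinj hab)]
  refine Finset.sum_congr rfl fun e _ => ?_
  rw [pairBond_symm]
  simp

/-- The edges of a bonded pair may be taken to run between tiles and to be positive. -/
theorem Bonded.exists_finset (h : S.Bonded α β) :
    ∃ F : Finset ((ℤ × ℤ) × Dir),
      (∀ e ∈ F, S.pairBond (α e.1) (β (e.1 + e.2.vec)) e.2 ≠ 0) ∧
      S.temp ≤ ∑ e ∈ F, S.pairBond (α e.1) (β (e.1 + e.2.vec)) e.2 := by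
  classical
  obtain ⟨F, hF⟩ := h
  refine ⟨F.filter (fun e => S.pairBond (α e.1) (β (e.1 + e.2.vec)) e.2 ≠ 0),
    fun e he => (Finset.mem_filter.1 he).2, ?_⟩
  rw [Finset.sum_filter_ne_zero]
  exact hF

theorem mem_dom_of_pairBond {e : (ℤ × ℤ) × Dir}
    (h : S.pairBond (α e.1) (β (e.1 + e.2.vec)) e.2 ≠ 0) :
    e.1 ∈ dom α ∧ e.1 + e.2.vec ∈ dom β := by
  obtain ⟨s, t, hs, ht, -⟩ := exists_of_pairBond_pos h
  exact ⟨mem_dom_of_eq hs, mem_dom_of_eq ht⟩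

theorem bonded_of_edge {e : (ℤ × ℤ) × Dir}
    (h : S.temp ≤ S.pairBond (α e.1) (β (e.1 + e.2.vec)) e.2) : S.Bonded α β :=
  ⟨{e}, by simpa using h⟩

/-- A finite part of a limit suffices for a bond. -/
theorem Bonded.exists_index {f : ℕ → Assembly S.Tile} (h : S.Bonded α β) (hα : IsResult f α)
    (hf : ∀ i, Sub (f i) (f (i + 1))) : ∃ i, S.Bonded (f i) β := by
  classical
  obtain ⟨F, hF⟩ := h
  obtain ⟨i, hi⟩ := hα.exists_index hf (F.image Prod.fst)
  refine ⟨i, F, hF.trans (le_of_eq (Finset.sum_congr rfl fun e he => ?_))⟩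
  rw [hi _ (Finset.mem_image_of_mem _ he)]

theorem Bonded.shift (h : S.Bonded α β) (v : ℤ × ℤ) :
    S.Bonded (Assembly.shift v α) (Assembly.shift v β) := by
  classical
  obtain ⟨F, hF⟩ := h
  refine ⟨F.image (fun e => (e.1 + v, e.2)), hF.trans (le_of_eq ?_)⟩
  rw [Finset.sum_image (fun a _ b _ hab => by
    simp only [Prod.mk.injEq, add_left_inj] at hab; exact Prod.ext hab.1 hab.2)]
  refine Finset.sum_congr rfl fun e _ => ?_
  simp only [shift_apply]
  rw [show e.1 + v - v = e.1 by abel, show e.1 + v + e.2.vec - v = e.1 + e.2.vec by abel]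

theorem Stable.union (hα : S.Stable α) (hβ : S.Stable β) (hd : Disjoint (dom α) (dom β))
    (h : S.Bonded α β) : S.Stable (α.union β) := by
  -- a cut that splits one of the two parts is heavy enough inside that part
  have key : ∀ ω δ : Assembly S.Tile, S.Stable δ → Sub δ ω → ∀ X : Set (ℤ × ℤ),
      (X ∩ dom δ).Nonempty → X ∩ dom δ ≠ dom δ → ∃ F : Finset ((ℤ × ℤ) × Dir),
        (∀ e ∈ F, e.1 ∈ X ∧ e.1 + e.2.vec ∈ dom ω \ X) ∧
        S.temp ≤ ∑ e ∈ F, S.bond ω e.1 e.2 := by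
    intro ω δ hδ hs X hne hX
    obtain ⟨F, hF, hsum⟩ := hδ _ Set.inter_subset_right hne hX
    refine ⟨F, fun e he => ⟨(hF e he).1.1, hs.dom (hF e he).2.1,
      fun hx => (hF e he).2.2 ⟨hx, (hF e he).2.1⟩⟩, hsum.trans (Finset.sum_le_sum fun e _ => ?_)⟩
    rw [bond_eq, bond_eq]
    exact pairBond_mono (hs _) (hs _) _
  have key2 : ∀ ω δ δ' : Assembly S.Tile, Sub δ ω → Sub δ' ω → S.Bonded δ δ' →
      ∀ X : Set (ℤ × ℤ), dom δ ⊆ X → Disjoint X (dom δ') → ∃ F : Finset ((ℤ × ℤ) × Dir),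
        (∀ e ∈ F, e.1 ∈ X ∧ e.1 + e.2.vec ∈ dom ω \ X) ∧
        S.temp ≤ ∑ e ∈ F, S.bond ω e.1 e.2 := by
    intro ω δ δ' hs hs' hb X hX hX'
    obtain ⟨F, hF, hsum⟩ := hb.exists_finset
    refine ⟨F, fun e he => ?_, hsum.trans (Finset.sum_le_sum fun e _ => ?_)⟩
    · obtain ⟨h1, h2⟩ := mem_dom_of_pairBond (hF e he)
      exact ⟨hX h1, hs'.dom h2, fun h3 => Set.disjoint_left.1 hX' h3 h2⟩
    · rw [bond_eq]
      exact pairBond_mono (hs _) (hs' _) _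
  intro X hX hne hne'
  have s1 := sub_union_left α β
  have s2 := sub_union_right hd
  by_cases h1 : (X ∩ dom α).Nonempty
  · by_cases h2 : X ∩ dom α = dom α
    · by_cases h3 : (X ∩ dom β).Nonempty
      · by_cases h4 : X ∩ dom β = dom β
        · exact absurd (Set.Subset.antisymm hX (by
            rw [dom_union]
            exact Set.union_subset (Set.inter_eq_right.1 h2) (Set.inter_eq_right.1 h4))) hne'
        · exact key _ _ hβ s2 X h3 h4
      · exact key2 _ _ _ s1 s2 h X (Set.inter_eq_right.1 h2)
          (Set.disjoint_iff_inter_eq_empty.2 (Set.not_nonempty_iff_eq_empty.1 h3))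
    · exact key _ _ hα s1 X h1 h2
  · have h1' := Set.not_nonempty_iff_eq_empty.1 h1
    by_cases h4 : X ∩ dom β = dom β
    · exact key2 _ _ _ s2 s1 h.symm X (Set.inter_eq_right.1 h4)
        (Set.disjoint_iff_inter_eq_empty.2 h1')
    · refine key _ _ hβ s2 X ?_ h4
      obtain ⟨x, hx⟩ := hne
      have := hX hx
      rw [dom_union] at this
      rcases this with h5 | h5
      · exact absurd ⟨x, hx, h5⟩ h1
      · exact ⟨x, hx, h5⟩

theorem Attaches.bonded (h : S.Attaches α β) (hα : (dom α).Nonempty) (hβ : (dom β).Nonempty) :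
    S.Bonded α β := by
  obtain ⟨b, hb⟩ := hβ
  obtain ⟨F, hF, hsum⟩ := h.2 (dom α) (by simp) hα (by
    intro he
    have : b ∈ dom α := by rw [he]; simp [hb]
    exact Set.disjoint_left.1 h.1 this hb)
  refine ⟨F, hsum.trans (le_of_eq (Finset.sum_congr rfl fun e he => ?_))⟩
  rw [bond_eq, union_apply_of_mem (hF e he).1, union_apply_of_notMem (hF e he).2.2]

theorem attaches_of_bonded (hα : S.Stable α) (hβ : S.Stable β)
    (hd : Disjoint (dom α) (dom β)) (h : S.Bonded α β) : S.Attaches α β :=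
  ⟨hd, hα.union hβ hd h⟩

theorem Stable.shift (h : S.Stable α) (v : ℤ × ℤ) : S.Stable (Assembly.shift v α) := by
  classical
  intro X hX hne hne'
  obtain ⟨F, hF, hsum⟩ := h {p | p + v ∈ X} (fun p hp => by
      have := hX hp
      rwa [mem_dom_shift, add_sub_cancel_right] at this)
    (by obtain ⟨x, hx⟩ := hne; exact ⟨x - v, by simpa using hx⟩)
    (by
      intro he
      apply hne'
      ext p
      rw [mem_dom_shift, ← he]
      simp)
  refine ⟨F.image (fun e => (e.1 + v, e.2)), ?_, hsum.trans (le_of_eq ?_)⟩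
  · intro e he
    obtain ⟨e', he', rfl⟩ := Finset.mem_image.1 he
    obtain ⟨h1, h2, h3⟩ := hF e' he'
    refine ⟨h1, ?_, fun h4 => h3 ?_⟩
    · rw [mem_dom_shift, add_right_comm, add_sub_cancel_right]
      exact h2
    · rw [add_right_comm] at h4
      exact h4
  · rw [Finset.sum_image (fun a _ b _ hab => by
      simp only [Prod.mk.injEq, add_left_inj] at hab; exact Prod.ext hab.1 hab.2)]
    refine Finset.sum_congr rfl fun e _ => ?_
    rw [bond_eq, bond_eq]
    simp only [shift_apply]
    rw [show e.1 + v - v = e.1 by abel, show e.1 + v + e.2.vec - v = e.1 + e.2.vec by abel]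

theorem Attaches.shift (h : S.Attaches α β) (v : ℤ × ℤ) :
    S.Attaches (Assembly.shift v α) (Assembly.shift v β) := by
  refine ⟨Set.disjoint_left.2 fun p hp hq => Set.disjoint_left.1 h.1 hp hq, ?_⟩
  rw [← shift_union]
  exact h.2.shift v

theorem stable_singleAt (z : ℤ × ℤ) (t : S.Tile) : S.Stable (singleAt z t) := by
  intro X hX hne hne'
  rw [dom_singleAt] at hX hne'
  exact absurd (hne.subset_singleton_iff.1 hX) hne'

theorem Stable.of_isResult {f : ℕ → Assembly S.Tile} (h : IsResult f α)
    (hf : ∀ i, Sub (f i) (f (i + 1))) (hs : ∀ i, S.Stable (f i)) : S.Stable α := by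
  classical
  intro X hX hne hne'
  obtain ⟨x, hx⟩ := hne
  obtain ⟨y, hy, hy'⟩ : ∃ y ∈ dom α, y ∉ X := by
    by_contra hc
    push Not at hc
    exact hne' (Set.Subset.antisymm hX hc)
  obtain ⟨i, hi⟩ := h.exists_index hf {x, y}
  have hx' : x ∈ dom (f i) := by
    have := hX hx
    unfold dom at this ⊢
    rw [Set.mem_ofPred_eq, hi x (by simp)]
    exact this
  have hyi : y ∈ dom (f i) := by
    unfold dom at hy ⊢
    rw [Set.mem_ofPred_eq, hi y (by simp)]
    exact hy
  obtain ⟨F, hF, hsum⟩ := hs i (X ∩ dom (f i)) Set.inter_subset_right ⟨x, hx, hx'⟩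
    (fun he => hy' (by rw [← he] at hyi; exact hyi.1))
  refine ⟨F, fun e he => ⟨(hF e he).1.1, (h.sub i).dom (hF e he).2.1,
    fun h3 => (hF e he).2.2 ⟨h3, (hF e he).2.1⟩⟩, hsum.trans (Finset.sum_le_sum fun e _ => ?_)⟩
  rw [bond_eq, bond_eq]
  exact pairBond_mono (h.sub i _) (h.sub i _) _

/-- Across every cut of a stable assembly there is a positive bond (if the temperature is). -/
theorem Stable.exists_bond (h : S.Stable α) (ht : S.temp ≠ 0) {X : Set (ℤ × ℤ)} {x y : ℤ × ℤ}
    (hx : x ∈ dom α) (hxX : x ∈ X) (hy : y ∈ dom α) (hyX : y ∉ X) :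
    ∃ p d, p ∈ X ∧ p + d.vec ∉ X ∧ S.pairBond (α p) (α (p + d.vec)) d ≠ 0 := by
  obtain ⟨F, hF, hsum⟩ := h (X ∩ dom α) Set.inter_subset_right ⟨x, hxX, hx⟩
    (fun he => hyX (by rw [← he] at hy; exact hy.1))
  by_contra hc
  push Not at hc
  have : ∑ e ∈ F, S.bond α e.1 e.2 = 0 := Finset.sum_eq_zero fun e he => by
    rw [bond_eq]
    exact hc _ _ (hF e he).1.1 (fun h3 => (hF e he).2.2 ⟨h3, (hF e he).2.1⟩)
  omega

/-! ### Producible supertiles -/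

theorem FinProducible.stable {a : Set (Assembly S.Tile)} (h : S.FinProducible a) :
    ∀ α ∈ a, S.Stable α ∧ (dom α).Nonempty := by
  induction h with
  | tile t =>
    rintro α ⟨v, rfl⟩
    refine ⟨stable_singleAt v t, ?_⟩
    have := dom_singleAt v t
    unfold singleAt at this
    rw [this]
    exact Set.singleton_nonempty _
  | combine _ _ hc iha ihb =>
    obtain ⟨α, hα, β, hβ, hatt, rfl⟩ := hc
    rintro γ ⟨v, rfl⟩
    refine ⟨hatt.2.shift v, ?_⟩
    obtain ⟨x, hx⟩ := (iha α hα).2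
    exact ⟨x + v, by rw [mem_dom_shift, add_sub_cancel_right, dom_union]; exact Or.inl hx⟩

variable (S) in
/-- `α` is producible in finitely many steps. -/
def FinProd (α : Assembly S.Tile) : Prop := S.FinProducible (supertile α)

variable (S) in
/-- `α` is producible. -/
def Prod (α : Assembly S.Tile) : Prop := supertile α ∈ S.Producible

theorem FinProd.stable (h : S.FinProd α) : S.Stable α :=
  (FinProducible.stable h α (mem_supertile_self α)).1

theorem FinProd.nonempty (h : S.FinProd α) : (dom α).Nonempty :=
  (FinProducible.stable h α (mem_supertile_self α)).2

theorem FinProd.shift (h : S.FinProd α) (v : ℤ × ℤ) : S.FinProd (Assembly.shift v α) := by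
  unfold FinProd
  rwa [supertile_shift]

theorem finProd_singleAt (z : ℤ × ℤ) (t : S.Tile) : S.FinProd (singleAt z t) := by
  unfold FinProd
  rw [supertile_singleAt]
  exact .tile t

theorem FinProd.union (hα : S.FinProd α) (hβ : S.FinProd β) (h : S.Attaches α β) :
    S.FinProd (α.union β) :=
  .combine hα hβ ⟨α, mem_supertile_self α, β, mem_supertile_self β, h, rfl⟩

/-- Induction over the finitely produced assemblies. -/
theorem FinProd.induction {P : Assembly S.Tile → Prop}
    (hshift : ∀ v α, P α → P (Assembly.shift v α))
    (hsingle : ∀ t, P (single t))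
    (hunion : ∀ α β, S.FinProd α → S.FinProd β → S.Attaches α β → P α → P β → P (α.union β))
    (h : S.FinProd α) : P α := by
  have : ∀ a, S.FinProducible a → ∃ α, a = supertile α ∧ P α := by
    intro a ha
    induction ha with
    | tile t => exact ⟨_, rfl, hsingle t⟩
    | @combine a b c ha hb hc iha ihb =>
      obtain ⟨α', rfl, hPα⟩ := iha
      obtain ⟨β', rfl, hPβ⟩ := ihb
      obtain ⟨_, ⟨v, rfl⟩, _, ⟨w, rfl⟩, hatt, rfl⟩ := hc
      refine ⟨_, rfl, hunion _ _ ?_ ?_ hatt (hshift _ _ hPα) (hshift _ _ hPβ)⟩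
      · exact FinProd.shift ha v
      · exact FinProd.shift hb w
  obtain ⟨β, hβ, hP⟩ := this _ h
  obtain ⟨v, rfl⟩ := exists_shift_of_supertile_eq hβ
  exact hshift _ _ hP

theorem IsSequence.sub {P : Set (Set (Assembly S.Tile))} {f : ℕ → Assembly S.Tile}
    (h : S.IsSequence P f) (i : ℕ) : Sub (f i) (f (i + 1)) := by
  rcases h i with h | ⟨β, -, -, h⟩
  · rw [h]; exact Sub.refl _
  · rw [h]; exact sub_union_left _ _

theorem IsSequence.finProd {f : ℕ → Assembly S.Tile}
    (h : S.IsSequence {b | S.FinProducible b} f) (h0 : S.FinProd (f 0)) (i : ℕ) :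
    S.FinProd (f i) := by
  induction i with
  | zero => exact h0
  | succ i ih =>
    rcases h i with h | ⟨β, hβ, hatt, h⟩
    · rwa [h]
    · rw [h]; exact ih.union hβ hatt

theorem IsSequence.stable {P : Set (Set (Assembly S.Tile))} {f : ℕ → Assembly S.Tile}
    (h : S.IsSequence P f) (h0 : S.Stable (f 0)) (i : ℕ) : S.Stable (f i) := by
  induction i with
  | zero => exact h0
  | succ i ih =>
    rcases h i with h | ⟨β, hβ, hatt, h⟩
    · rwa [h]
    · rw [h]; exact hatt.2

theorem IsSequence.shift {P : Set (Set (Assembly S.Tile))} {f : ℕ → Assembly S.Tile}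
    (h : S.IsSequence P f) (v : ℤ × ℤ) : S.IsSequence P (fun i => Assembly.shift v (f i)) := by
  intro i
  rcases h i with h | ⟨β, hβ, hatt, h⟩
  · exact Or.inl (by simp only [h])
  · exact Or.inr ⟨Assembly.shift v β, by simpa using hβ, hatt.shift v, by
      simp only [h, shift_union]⟩

theorem prod_iff : S.Prod α ↔ ∃ f : ℕ → Assembly S.Tile, S.FinProd (f 0) ∧
    S.IsSequence {b | S.FinProducible b} f ∧ IsResult f α := by
  constructor
  · rintro ⟨f, β, h0, hf, hr, he⟩
    obtain ⟨v, rfl⟩ := exists_shift_of_supertile_eq he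
    exact ⟨_, FinProd.shift h0 v, hf.shift v, hr.shift v⟩
  · rintro ⟨f, h0, hf, hr⟩
    exact ⟨f, α, h0, hf, hr, rfl⟩

theorem exists_prod_of_mem {a : Set (Assembly S.Tile)} (h : a ∈ S.Producible) :
    ∃ α, a = supertile α ∧ S.Prod α := by
  obtain ⟨f, α, h0, hf, hr, rfl⟩ := h
  exact ⟨α, rfl, f, α, h0, hf, hr, rfl⟩

theorem Prod.shift (h : S.Prod α) (v : ℤ × ℤ) : S.Prod (Assembly.shift v α) := by
  unfold Prod
  rwa [supertile_shift]

theorem FinProd.prod (h : S.FinProd α) : S.Prod α :=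
  prod_iff.2 ⟨fun _ => α, h, fun _ => Or.inl rfl, fun _ _ => ⟨fun h => ⟨0, h⟩, fun ⟨_, h⟩ => h⟩⟩

theorem Prod.stable (h : S.Prod α) : S.Stable α := by
  obtain ⟨f, h0, hf, hr⟩ := prod_iff.1 h
  exact Stable.of_isResult hr hf.sub (hf.stable h0.stable)

theorem Prod.nonempty (h : S.Prod α) : (dom α).Nonempty := by
  obtain ⟨f, h0, hf, hr⟩ := prod_iff.1 h
  exact h0.nonempty.mono (hr.sub 0).dom

/-- An assembly that is divided into countably many finitely produced pieces is producible if every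
piece but one is bonded to the union of the pieces that precede it in some well-founded order:
keep trying all the pieces, and attach a piece whenever it is possible. -/
theorem prod_of_pieces {κ : Type} [Countable κ] {r : κ → κ → Prop} (hr : WellFounded r)
    (ω : Assembly S.Tile) (D : κ → Set (ℤ × ℤ)) (hD : ∀ i j, i ≠ j → Disjoint (D i) (D j))
    (hω : ∀ p ∈ dom ω, ∃ i, p ∈ D i) (root : κ) (hroot : (D root).Nonempty)
    (hfin : ∀ i, (D i).Nonempty → S.FinProd (restrict ω (D i)))
    (hbond : ∀ i, i ≠ root → (D i).Nonempty →
      S.Bonded (restrict ω (⋃ j ∈ {j | r j i}, D j)) (restrict ω (D i))) : S.Prod ω := by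
  classical
  obtain ⟨e0, he0⟩ := (@exists_surjective_nat κ ⟨root⟩ _)
  -- an enumeration in which every piece occurs infinitely often
  let e : ℕ → κ := fun n => e0 n.unpair.1
  have he : ∀ i n, ∃ m, n ≤ m ∧ e m = i := by
    intro i n
    obtain ⟨k, rfl⟩ := he0 i
    exact ⟨Nat.pair k n, Nat.right_le_pair k n, by simp [e]⟩
  let U : Set κ → Assembly S.Tile := fun A => restrict ω (⋃ i ∈ A, D i)
  -- the pieces that have been attached after `n` trials
  let A : ℕ → Set κ := fun n => Nat.rec {root} (fun n A =>
    if S.Bonded (U A) (restrict ω (D (e n))) then insert (e n) A else A) n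
  have hA0 : A 0 = {root} := rfl
  have hA : ∀ n, A (n + 1) =
    if S.Bonded (U (A n)) (restrict ω (D (e n))) then insert (e n) (A n) else A n := fun _ => rfl
  have hUmono : ∀ A B : Set κ, A ⊆ B → Sub (U A) (U B) := by
    intro A B hAB p t ht
    obtain ⟨h1, h2⟩ := restrict_eq_some.1 ht
    exact restrict_eq_some.2 ⟨Set.biUnion_subset_biUnion_left hAB h1, h2⟩
  have hAmono : ∀ n, A n ⊆ A (n + 1) := by
    intro n
    rw [hA]
    split_ifs
    exacts [Set.subset_insert _ _, subset_rfl]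
  have hAle : ∀ n m, n ≤ m → A n ⊆ A m := fun n m h => monotone_nat_of_le_succ hAmono h
  have h0 : S.FinProd (U (A 0)) := by
    have : U (A 0) = restrict ω (D root) := by simp [U, hA0]
    rw [this]
    exact hfin _ hroot
  have step : ∀ n, S.Stable (U (A n)) → U (A (n + 1)) = U (A n) ∨
      ∃ β, S.FinProd β ∧ S.Attaches (U (A n)) β ∧ U (A (n + 1)) = (U (A n)).union β := by
    intro n hst
    rw [hA]
    split_ifs with hb
    · rcases Classical.em (e n ∈ A n) with hmem | hmem
      · rw [Set.insert_eq_of_mem hmem]; exact Or.inl rfl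
      · have hun : U (insert (e n) (A n)) = (U (A n)).union (restrict ω (D (e n))) := by
          simp only [U]
          rw [← restrict_union, Set.biUnion_insert, Set.union_comm]
        by_cases hne : (D (e n)).Nonempty
        · refine Or.inr ⟨_, hfin _ hne, attaches_of_bonded hst (hfin _ hne).stable ?_ hb, hun⟩
          simp only [U]
          rw [dom_restrict, dom_restrict]
          refine Set.disjoint_left.2 fun p hp hq => ?_
          obtain ⟨i, hi, hpi⟩ := Set.mem_iUnion₂.1 hp.1
          exact Set.disjoint_left.1 (hD i (e n) (fun h => hmem (h ▸ hi))) hpi hq.1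
        · left
          rw [hun, Set.not_nonempty_iff_eq_empty.1 hne]
          funext p
          simp [union, restrict]
    · exact Or.inl rfl
  have hst : ∀ n, S.Stable (U (A n)) := by
    intro n
    induction n with
    | zero => exact h0.stable
    | succ n ih =>
      rcases step n ih with h | ⟨β, -, hatt, h⟩
      · rwa [h]
      · rw [h]; exact hatt.2
  -- the bond of a piece uses only finitely many of the preceding pieces, so it becomes available
  have hall : ∀ i, (D i).Nonempty → ∃ n, i ∈ A n := by
    intro i
    induction i using hr.induction with
    | _ i ih =>
      intro hne
      by_cases hi : i = root
      · exact ⟨0, by rw [hA0, hi]; rfl⟩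
      obtain ⟨F, hF⟩ := hbond i hi hne
      have hn : ∃ n, ∀ x ∈ F, x.1 ∈ ⋃ j ∈ {j | r j i}, D j → x.1 ∈ ⋃ j ∈ A n, D j := by
        clear hF
        induction F using Finset.induction_on with
        | empty => exact ⟨0, by simp⟩
        | insert a F _ ihF =>
          obtain ⟨n, hn⟩ := ihF
          by_cases ha : a.1 ∈ ⋃ j ∈ {j | r j i}, D j
          · obtain ⟨j, hj, haj⟩ := Set.mem_iUnion₂.1 ha
            obtain ⟨m, hm⟩ := ih j hj ⟨_, haj⟩
            refine ⟨max n m, fun x hx hx' => ?_⟩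
            rcases Finset.mem_insert.1 hx with rfl | hx
            · exact Set.mem_iUnion₂.2 ⟨j, hAle _ _ (le_max_right n m) hm, haj⟩
            · exact Set.biUnion_subset_biUnion_left (hAle _ _ (le_max_left n m)) (hn x hx hx')
          · refine ⟨n, fun x hx hx' => ?_⟩
            rcases Finset.mem_insert.1 hx with rfl | hx
            exacts [absurd hx' ha, hn x hx hx']
      obtain ⟨n, hn⟩ := hn
      obtain ⟨m, hnm, hm⟩ := he i n
      refine ⟨m + 1, ?_⟩
      rw [hA, hm, if_pos]
      · exact Set.mem_insert _ _
      · refine Bonded.mono ?_ (hUmono _ _ (hAle n m hnm)) (Sub.refl _)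
        refine ⟨F, hF.trans (Finset.sum_le_sum fun x hx => pairBond_mono ?_ (fun _ h => h) _)⟩
        intro t ht
        obtain ⟨h1, h2⟩ := restrict_eq_some.1 ht
        exact restrict_eq_some.2 ⟨hn x hx h1, h2⟩
  refine prod_iff.2 ⟨fun n => U (A n), h0, fun n => step n (hst n), fun p t => ⟨?_, ?_⟩⟩
  · intro hp
    obtain ⟨i, hi⟩ := hω p (mem_dom_of_eq hp)
    obtain ⟨n, hn⟩ := hall i ⟨p, hi⟩
    exact ⟨n, restrict_eq_some.2 ⟨Set.mem_iUnion₂.2 ⟨i, hn, hi⟩, hp⟩⟩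
  · rintro ⟨n, hn⟩
    exact (restrict_eq_some.1 hn).2

/-- A sequence of finitely produced attachments may start from any producible assembly. -/
theorem Prod.of_isSequence {g : ℕ → Assembly S.Tile} {ω : Assembly S.Tile} (hα : S.Prod (g 0))
    (hg : S.IsSequence {b | S.FinProducible b} g) (hω : IsResult g ω) : S.Prod ω := by
  obtain ⟨f, h0, hf, hr⟩ := prod_iff.1 hα
  -- the pieces: the start of `f`, the increments of `f`, and then the increments of `g`
  let D : ℕ ⊕ ℕ → Set (ℤ × ℤ) := fun x => match x with
    | .inl 0 => dom (f 0)
    | .inl (i + 1) => dom (f (i + 1)) \ dom (f i)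
    | .inr i => dom (g (i + 1)) \ dom (g i)
  have hfle : ∀ i j, i ≤ j → dom (f i) ⊆ dom (f j) := fun i j h => (sub_of_le hf.sub h).dom
  have hgle : ∀ i j, i ≤ j → dom (g i) ⊆ dom (g j) := fun i j h => (sub_of_le hg.sub h).dom
  have hfg : ∀ i, dom (f i) ⊆ dom (g 0) := fun i => (hr.sub i).dom
  have hDf : ∀ i, D (.inl i) ⊆ dom (f i) := by
    rintro (_ | i)
    exacts [subset_rfl, Set.sdiff_subset]
  have hcovf : ∀ i, dom (f i) ⊆ ⋃ j ∈ {j | j ≤ i}, D (.inl j) := by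
    intro i
    induction i with
    | zero => exact fun p hp => Set.mem_iUnion₂.2 ⟨0, by simp, hp⟩
    | succ i ih =>
      intro p hp
      by_cases hq : p ∈ dom (f i)
      · exact Set.biUnion_subset_biUnion_left (fun j (hj : j ≤ i) => Nat.le_succ_of_le hj) (ih hq)
      · exact Set.mem_iUnion₂.2 ⟨i + 1, by simp, hp, hq⟩
  have hcov0 : ∀ p ∈ dom (g 0), ∃ i, p ∈ D (.inl i) := by
    intro p hp
    obtain ⟨t, ht⟩ := mem_dom.1 hp
    obtain ⟨i, hi⟩ := (hr p t).1 ht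
    obtain ⟨j, -, hj⟩ := Set.mem_iUnion₂.1 (hcovf i (mem_dom_of_eq hi))
    exact ⟨j, hj⟩
  have hcovg : ∀ i, ∀ p ∈ dom (g i), (∃ j, p ∈ D (.inl j)) ∨ ∃ j < i, p ∈ D (.inr j) := by
    intro i
    induction i with
    | zero => exact fun p hp => Or.inl (hcov0 p hp)
    | succ i ih =>
      intro p hp
      by_cases hq : p ∈ dom (g i)
      · rcases ih p hq with h | ⟨j, hj, h⟩
        exacts [Or.inl h, Or.inr ⟨j, Nat.lt_succ_of_lt hj, h⟩]
      · exact Or.inr ⟨i, Nat.lt_succ_self i, hp, hq⟩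
  have hdf : ∀ i j, i < j → Disjoint (D (.inl i)) (D (.inl j)) := by
    intro i j hij
    obtain ⟨j, rfl⟩ : ∃ k, j = k + 1 := ⟨j - 1, by omega⟩
    exact Set.disjoint_left.2 fun p hp hq => hq.2 (hfle i j (by omega) (hDf i hp))
  have hdg : ∀ i j, i < j → Disjoint (D (.inr i)) (D (.inr j)) := fun i j hij =>
    Set.disjoint_left.2 fun p hp hq => hq.2 (hgle (i + 1) j hij hp.1)
  have hdfg : ∀ i j, Disjoint (D (.inl i)) (D (.inr j)) := fun i j =>
    Set.disjoint_left.2 fun p hp hq => hq.2 (hgle 0 j (Nat.zero_le _) (hfg i (hDf i hp)))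
  have hfω : ∀ i, Sub (f i) ω := fun i => (hr.sub i).trans (hω.sub 0)
  have hrestr : ∀ (α β : Assembly S.Tile), S.Attaches α β → Sub (α.union β) ω →
      restrict ω (dom (α.union β) \ dom α) = β := by
    intro α β hatt hs
    refine ext_some fun p t => ?_
    rw [restrict_eq_some]
    constructor
    · rintro ⟨⟨h1, h2⟩, h3⟩
      have h4 := hs.apply_eq h1
      rw [union_apply_of_notMem h2] at h4
      rw [← h4, h3]
    · intro h
      have h2 : p ∉ dom α := fun h' => Set.disjoint_left.1 hatt.1 h' (mem_dom_of_eq h)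
      have h1 : α.union β p = some t := by rw [union_apply_of_notMem h2, h]
      exact ⟨⟨mem_dom_of_eq h1, h2⟩, hs _ _ h1⟩
  have hpiece : ∀ (u : ℕ → Assembly S.Tile), S.IsSequence {b | S.FinProducible b} u →
      (∀ i, Sub (u i) ω) → ∀ i, (dom (u (i + 1)) \ dom (u i)).Nonempty → (dom (u i)).Nonempty →
      S.FinProd (restrict ω (dom (u (i + 1)) \ dom (u i))) ∧
      S.Bonded (u i) (restrict ω (dom (u (i + 1)) \ dom (u i))) := by
    intro u hu hsub i hne hne'
    rcases hu i with h | ⟨β, hβ, hatt, h⟩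
    · rw [h] at hne; simp at hne
    · rw [h, hrestr _ _ hatt (h ▸ hsub (i + 1))]
      exact ⟨hβ, hatt.bonded hne' (FinProd.nonempty hβ)⟩
  have hres : ∀ (u : Assembly S.Tile) (E : Set (ℤ × ℤ)), Sub u ω → dom u ⊆ E →
      Sub u (restrict ω E) := fun u E hu hE p t ht =>
    restrict_eq_some.2 ⟨hE (mem_dom_of_eq ht), hu _ _ ht⟩
  -- as `f` may be infinite, the increments of `g` come after infinitely many others
  refine prod_of_pieces (r := Sum.Lex (· < ·) (· < ·))
    (Sum.lex_wf Nat.lt_wfRel.wf Nat.lt_wfRel.wf) ω D ?_ ?_ (.inl 0) h0.nonempty ?_ ?_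
  · rintro (i | i) (j | j) hij
    · rcases lt_or_gt_of_ne (fun h => hij (congrArg Sum.inl h)) with h | h
      exacts [hdf _ _ h, (hdf _ _ h).symm]
    · exact hdfg _ _
    · exact (hdfg _ _).symm
    · rcases lt_or_gt_of_ne (fun h => hij (congrArg Sum.inr h)) with h | h
      exacts [hdg _ _ h, (hdg _ _ h).symm]
  · intro p hp
    obtain ⟨t, ht⟩ := mem_dom.1 hp
    obtain ⟨i, hi⟩ := (hω p t).1 ht
    rcases hcovg i p (mem_dom_of_eq hi) with ⟨j, hj⟩ | ⟨j, -, hj⟩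
    exacts [⟨.inl j, hj⟩, ⟨.inr j, hj⟩]
  · rintro ((_ | i) | i) hne
    · have : restrict ω (D (.inl 0)) = f 0 := by
        refine ext_some fun p t => ?_
        rw [restrict_eq_some]
        constructor
        · rintro ⟨h1, h2⟩
          rw [← (hfω 0).apply_eq h1, h2]
        · exact fun h => ⟨mem_dom_of_eq h, hfω 0 _ _ h⟩
      rw [this]
      exact h0
    · exact (hpiece f hf hfω i hne (h0.nonempty.mono (hfle 0 i (Nat.zero_le _)))).1
    · exact (hpiece g hg hω.sub i hne (hα.nonempty.mono (hgle 0 i (Nat.zero_le _)))).1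
  · rintro ((_ | i) | i) hi hne
    · exact absurd rfl hi
    · refine (hpiece f hf hfω i hne (h0.nonempty.mono (hfle 0 i (Nat.zero_le _)))).2.mono
        (hres _ _ (hfω i) fun p hp => ?_) (Sub.refl _)
      obtain ⟨j, hj, hpj⟩ := Set.mem_iUnion₂.1 (hcovf i hp)
      exact Set.mem_iUnion₂.2 ⟨.inl j, Sum.Lex.inl (Nat.lt_succ_of_le hj), hpj⟩
    · refine (hpiece g hg hω.sub i hne (hα.nonempty.mono (hgle 0 i (Nat.zero_le _)))).2.mono
        (hres _ _ (hω.sub i) fun p hp => ?_) (Sub.refl _)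
      rcases hcovg i p hp with ⟨j, hj⟩ | ⟨j, hji, hj⟩
      · exact Set.mem_iUnion₂.2 ⟨.inl j, Sum.Lex.sep _ _, hj⟩
      · exact Set.mem_iUnion₂.2 ⟨.inr j, Sum.Lex.inr hji, hj⟩

/-- Two producible assemblies, finite or not, combine to a producible one. -/
theorem Prod.union (hα : S.Prod α) (hβ : S.Prod β) (h : S.Attaches α β) :
    S.Prod (α.union β) := by
  obtain ⟨g, h0, hg, hr⟩ := prod_iff.1 hβ
  -- attach to `α` a stage of `β` at which the bond is present, and then the rest of `β`
  obtain ⟨j, hj⟩ := (h.bonded hα.nonempty hβ.nonempty).symm.exists_index hr hg.sub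
  have hdj : ∀ i, Disjoint (dom α) (dom (g i)) := fun i =>
    h.1.mono_right (hr.sub i).dom
  let u : ℕ → Assembly S.Tile := fun n => match n with
    | 0 => α
    | k + 1 => α.union (g (j + k))
  have hu : S.IsSequence {b | S.FinProducible b} u := by
    rintro (_ | k)
    · exact Or.inr ⟨g j, hg.finProd h0 j,
        attaches_of_bonded hα.stable (hg.finProd h0 j).stable (hdj j) hj.symm, rfl⟩
    · rcases hg (j + k) with he | ⟨δ, hδ, hatt, he⟩
      · exact Or.inl (by change α.union (g (j + k + 1)) = _; rw [he])
      · have hsub : Sub δ (g (j + k + 1)) := by rw [he]; exact sub_union_right hatt.1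
        refine Or.inr ⟨δ, hδ, attaches_of_bonded ?_ (FinProd.stable hδ) ?_ ?_, ?_⟩
        · exact hα.stable.union (hg.finProd h0 _).stable (hdj _)
            (hj.symm.mono (Sub.refl _) (sub_of_le hg.sub (Nat.le_add_right _ _)))
        · change Disjoint (dom (α.union (g (j + k)))) _
          rw [dom_union]
          exact Set.disjoint_union_left.2 ⟨(hdj _).mono_right hsub.dom, hatt.1⟩
        · exact (hatt.bonded (hg.finProd h0 _).nonempty (FinProd.nonempty hδ)).mono
            (sub_union_right (hdj _)) (Sub.refl _)
        · change α.union (g (j + k + 1)) = (α.union (g (j + k))).union δ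
          rw [he, union_assoc]
  refine Prod.of_isSequence (g := u) hα hu fun p t => ?_
  have htail := hr.tail hg.sub j
  constructor
  · intro hp
    rcases union_eq_some.1 hp with hp | ⟨hp, hp'⟩
    · exact ⟨0, hp⟩
    · obtain ⟨i, hi⟩ := (htail p t).1 hp'
      exact ⟨i + 1, union_eq_some.2 (Or.inr ⟨hp, hi⟩)⟩
  · rintro ⟨_ | k, hk⟩
    · exact union_eq_some.2 (Or.inl hk)
    · rcases union_eq_some.1 hk with hp | ⟨hp, hp'⟩
      · exact union_eq_some.2 (Or.inl hp)
      · exact union_eq_some.2 (Or.inr ⟨hp, (hr.sub _) _ _ hp'⟩)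

/-- Single tiles of a given kind can be attached until none of them can be attached any more. -/
theorem Prod.exists_saturated [Countable S.Tile] (hα : S.Prod α) (P : S.Tile → Prop) :
    ∃ ω, S.Prod ω ∧ Sub α ω ∧
      (∀ z t, ω z = some t → α z = some t ∨ P t) ∧
      ∀ z t, P t → ¬ S.Attaches ω (singleAt z t) := by
  classical
  obtain ⟨t0⟩ : Nonempty S.Tile := by
    obtain ⟨p, hp⟩ := hα.nonempty
    obtain ⟨t, -⟩ := mem_dom.1 hp
    exact ⟨t⟩
  obtain ⟨e0, he0⟩ := (@exists_surjective_nat ((ℤ × ℤ) × S.Tile) ⟨(0, t0)⟩ _)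
  -- an enumeration in which every positioned tile occurs infinitely often
  let e : ℕ → (ℤ × ℤ) × S.Tile := fun n => e0 n.unpair.1
  have he : ∀ i n, ∃ m, n ≤ m ∧ e m = i := by
    intro i n
    obtain ⟨k, rfl⟩ := he0 i
    exact ⟨Nat.pair k n, Nat.right_le_pair k n, by simp [e]⟩
  let g : ℕ → Assembly S.Tile := fun n => Nat.rec α (fun n δ =>
    if P (e n).2 ∧ S.Attaches δ (singleAt (e n).1 (e n).2) then
      δ.union (singleAt (e n).1 (e n).2) else δ) n
  have hg0 : g 0 = α := rfl
  have hg : ∀ n, g (n + 1) = if P (e n).2 ∧ S.Attaches (g n) (singleAt (e n).1 (e n).2) then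
      (g n).union (singleAt (e n).1 (e n).2) else g n := fun _ => rfl
  have hseq : S.IsSequence {b | S.FinProducible b} g := by
    intro n
    rw [hg]
    split_ifs with h
    · exact Or.inr ⟨_, finProd_singleAt _ _, h.2, rfl⟩
    · exact Or.inl rfl
  have hP : ∀ n z t, g n z = some t → α z = some t ∨ P t := by
    intro n
    induction n with
    | zero => exact fun z t h => Or.inl h
    | succ n ih =>
      intro z t h
      rw [hg] at h
      split_ifs at h with hc
      · rcases union_eq_some.1 h with h | ⟨-, h⟩
        · exact ih z t h
        · rw [← (singleAt_eq_some.1 h).2]; exact Or.inr hc.1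
      · exact ih z t h
  obtain ⟨ω, hω⟩ := exists_isResult hseq.sub
  have hprod : S.Prod ω := Prod.of_isSequence (g := g) hα hseq hω
  refine ⟨ω, hprod, hω.sub 0, ?_, ?_⟩
  · intro z t h
    obtain ⟨i, hi⟩ := (hω z t).1 h
    exact hP i z t hi
  · intro z t hPt hatt
    have hz : z ∉ dom ω := by simpa using hatt.1
    obtain ⟨n, hn⟩ := (hatt.bonded hprod.nonempty (by simp)).exists_index hω hseq.sub
    obtain ⟨m, hnm, hm⟩ := he (z, t) n
    have hstep := hg m
    rw [hm, if_pos ⟨hPt, attaches_of_bonded (hseq.stable hα.stable m) (stable_singleAt _ _)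
      (by simpa using fun h => hz ((hω.sub m).dom h))
      (hn.mono (sub_of_le hseq.sub hnm) (Sub.refl _))⟩] at hstep
    refine hz ((hω.sub (m + 1)).dom ?_)
    rw [hstep, dom_union]
    exact Or.inr (by simp)

end TAS

/-! ### The simulating system -/

/-- The position of a macrotile relative to the distinguished row of its half-ladder. -/
inductive Mode : Type
  | lo | mid | hi

/-- The state of a macrotile: the colour of its half-ladder, and its mode. -/
abbrev State : Type := Bool × Mode

/-- What a backbone macrotile in state `s` shows to the macrotile above it. -/
def State.above : State → Bool × Bool
  | (c, .lo) => (c, false)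
  | (c, .mid) => (c, true)
  | (c, .hi) => (c, true)

/-- What a backbone macrotile in state `s` shows to the macrotile below it.  As `above` and `below`
have to agree, the modes of a backbone are, from bottom to top, `lo, …, lo, mid, hi, …, hi`, where
any part may be missing. -/
def State.below : State → Bool × Bool
  | (c, .lo) => (c, false)
  | (c, .mid) => (c, false)
  | (c, .hi) => (c, true)

/-- The label of the additional glue at the end of a left rung. -/
def State.extLeft : State → Bool × Bool
  | (c, .mid) => (true, !c)
  | (c, _) => (false, c)

/-- The label of the additional glue at the end of a right rung. -/
def State.extRight : State → Bool × Bool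
  | (c, .mid) => (false, c)
  | (c, _) => (true, c)

namespace LadderTile

/-- Whether a ladder tile belongs to left half-ladders. -/
def isLeft : LadderTile → Bool
  | A0 | A1 | A2 | A3 => true
  | B0 | B1 | B2 | B3 => false

/-- The column of a ladder tile, the backbones of left half-ladders being in column `0`. -/
def col : LadderTile → ℤ
  | A2 | A3 => 0
  | A1 => 1
  | A0 => 2
  | B0 => 3
  | B1 => 4
  | B2 | B3 => 5

/-- The horizontal position of the main tile inside the block of a ladder tile. -/
def side : LadderTile → ℤ
  | A0 | A1 | A2 | A3 => 1
  | B0 | B1 | B2 | B3 => 0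

/-- The side on which the macrotile of a ladder tile has its own link.  In this way each of the
eight strong bonds of the ladder system belongs to exactly one ladder tile. -/
def out : LadderTile → Dir
  | A0 | A1 => .west
  | A2 | A3 | B2 | B3 => .north
  | B0 | B1 => .east

/-- The ladder tile at the other end of the link of a ladder tile. -/
def nbr : LadderTile → LadderTile
  | A0 => A1
  | A1 => A2
  | A2 => A3
  | A3 => A2
  | B0 => B1
  | B1 => B2
  | B2 => B3
  | B3 => B2

/-- The ladder tile at the end of a rung on the given side. -/
def rungEnd : Bool → LadderTile
  | true => A0
  | false => B0

end LadderTile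

open LadderTile

/-- The tiles of the simulating system.  The macrotile of `t` in state `s` consists of its main
tile, its link to the neighbour on side `out t`, and at the end of a rung a plug. -/
inductive MacroTile : Type
  | main (t : LadderTile) (s : State)
  | link (t : LadderTile) (s : State)
  | plug (left : Bool) (s : State)

/-- The glues of the simulating system. -/
inductive GlueKind : Type
  /-- no glue -/
  | null
  /-- the weak glue between the ends of facing rungs -/
  | rung
  /-- the glue between a main tile and its own link -/
  | own (t : LadderTile) (s : State)
  /-- the glue between the horizontal link of `t` and the main tile of the neighbour -/
  | hout (t : LadderTile) (s : State)
  /-- the glue between the vertical link of `t` and the main tile of the neighbour -/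
  | vout (t : LadderTile) (l : Bool × Bool)
  /-- the glue between a main tile and its plug -/
  | plug (left : Bool) (s : State)
  /-- the additional glue between facing plugs -/
  | ext (e : Bool × Bool)

open GlueKind in
/-- The glue of each tile on each side. -/
def MacroTile.kind : MacroTile → Dir → GlueKind
  | main A0 s, .west => own A0 s
  | main A0 s, .north => GlueKind.plug true s
  | main A0 _, .east => rung
  | main A1 s, .west => own A1 s
  | main A1 s, .east => hout A0 s
  | main A2 s, .north => own A2 s
  | main A2 s, .east => hout A1 s
  | main A2 s, .south => vout A3 s.below
  | main A3 s, .north => own A3 s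
  | main A3 s, .south => vout A2 s.below
  | main B0 s, .east => own B0 s
  | main B0 s, .north => GlueKind.plug false s
  | main B0 _, .west => rung
  | main B1 s, .east => own B1 s
  | main B1 s, .west => hout B0 s
  | main B2 s, .north => own B2 s
  | main B2 s, .west => hout B1 s
  | main B2 s, .south => vout B3 s.below
  | main B3 s, .north => own B3 s
  | main B3 s, .south => vout B2 s.below
  | link A0 s, .east => own A0 s
  | link A0 s, .west => hout A0 s
  | link A1 s, .east => own A1 s
  | link A1 s, .west => hout A1 s
  | link A2 s, .south => own A2 s
  | link A2 s, .north => vout A2 s.above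
  | link A3 s, .south => own A3 s
  | link A3 s, .north => vout A3 s.above
  | link B0 s, .west => own B0 s
  | link B0 s, .east => hout B0 s
  | link B1 s, .west => own B1 s
  | link B1 s, .east => hout B1 s
  | link B2 s, .south => own B2 s
  | link B2 s, .north => vout B2 s.above
  | link B3 s, .south => own B3 s
  | link B3 s, .north => vout B3 s.above
  | .plug b s, .south => GlueKind.plug b s
  | .plug true s, .east => ext s.extLeft
  | .plug false s, .west => ext s.extRight
  | _, _ => null

namespace MacroTile

theorem kind_eq_own {u : MacroTile} {d : Dir} {t : LadderTile} {s : State}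
    (h : u.kind d = .own t s) :
    u = main t s ∧ d = t.out ∨ u = link t s ∧ d = t.out.opp := by
  rcases u with ⟨t', s'⟩ | ⟨t', s'⟩ | ⟨_ | _, s'⟩
  · cases t' <;> cases d <;> simp only [kind, reduceCtorEq, GlueKind.own.injEq] at h <;>
      obtain ⟨rfl, rfl⟩ := h <;> simp [out]
  · cases t' <;> cases d <;> simp only [kind, reduceCtorEq, GlueKind.own.injEq] at h <;>
      obtain ⟨rfl, rfl⟩ := h <;> simp [out, Dir.opp]
  · cases d <;> simp only [kind, reduceCtorEq] at h
  · cases d <;> simp only [kind, reduceCtorEq] at h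

theorem kind_eq_hout {u : MacroTile} {d : Dir} {t : LadderTile} {s : State}
    (h : u.kind d = .hout t s) :
    t.out ≠ .north ∧ (u = main t.nbr s ∧ d = t.out.opp ∨ u = link t s ∧ d = t.out) := by
  rcases u with ⟨t', s'⟩ | ⟨t', s'⟩ | ⟨_ | _, s'⟩
  · cases t' <;> cases d <;> simp only [kind, reduceCtorEq, GlueKind.hout.injEq] at h <;>
      obtain ⟨rfl, rfl⟩ := h <;> simp [out, Dir.opp, nbr]
  · cases t' <;> cases d <;> simp only [kind, reduceCtorEq, GlueKind.hout.injEq] at h <;>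
      obtain ⟨rfl, rfl⟩ := h <;> simp [out]
  · cases d <;> simp only [kind, reduceCtorEq] at h
  · cases d <;> simp only [kind, reduceCtorEq] at h

theorem kind_eq_vout {u : MacroTile} {d : Dir} {t : LadderTile} {l : Bool × Bool}
    (h : u.kind d = .vout t l) :
    t.out = .north ∧ ((∃ s, u = main t.nbr s ∧ s.below = l ∧ d = .south) ∨
      ∃ s, u = link t s ∧ s.above = l ∧ d = .north) := by
  rcases u with ⟨t', s'⟩ | ⟨t', s'⟩ | ⟨_ | _, s'⟩
  · cases t' <;> cases d <;> simp only [kind, reduceCtorEq, GlueKind.vout.injEq] at h <;>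
      obtain ⟨rfl, rfl⟩ := h <;> simp [out, nbr]
  · cases t' <;> cases d <;> simp only [kind, reduceCtorEq, GlueKind.vout.injEq] at h <;>
      obtain ⟨rfl, rfl⟩ := h <;> simp [out]
  · cases d <;> simp only [kind, reduceCtorEq] at h
  · cases d <;> simp only [kind, reduceCtorEq] at h

theorem kind_eq_plug {u : MacroTile} {d : Dir} {b : Bool} {s : State}
    (h : u.kind d = .plug b s) :
    u = main (rungEnd b) s ∧ d = .north ∨ u = plug b s ∧ d = .south := by
  rcases u with ⟨t', s'⟩ | ⟨t', s'⟩ | ⟨_ | _, s'⟩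
  · cases t' <;> cases d <;> simp only [kind, reduceCtorEq, GlueKind.plug.injEq] at h <;>
      obtain ⟨rfl, rfl⟩ := h <;> simp [rungEnd]
  · cases t' <;> cases d <;> simp only [kind, reduceCtorEq] at h
  · cases d <;> simp only [kind, reduceCtorEq, GlueKind.plug.injEq] at h
    obtain ⟨rfl, rfl⟩ := h
    simp
  · cases d <;> simp only [kind, reduceCtorEq, GlueKind.plug.injEq] at h
    obtain ⟨rfl, rfl⟩ := h
    simp

theorem kind_eq_rung {u : MacroTile} {d : Dir} (h : u.kind d = .rung) :
    (∃ s, u = main A0 s ∧ d = .east) ∨ ∃ s, u = main B0 s ∧ d = .west := by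
  rcases u with ⟨t', s'⟩ | ⟨t', s'⟩ | ⟨_ | _, s'⟩
  · cases t' <;> cases d <;> simp only [kind, reduceCtorEq] at h <;> simp
  · cases t' <;> cases d <;> simp only [kind, reduceCtorEq] at h
  · cases d <;> simp only [kind, reduceCtorEq] at h
  · cases d <;> simp only [kind, reduceCtorEq] at h

theorem kind_eq_ext {u : MacroTile} {d : Dir} {e : Bool × Bool} (h : u.kind d = .ext e) :
    (∃ s, u = plug true s ∧ s.extLeft = e ∧ d = .east) ∨
      ∃ s, u = plug false s ∧ s.extRight = e ∧ d = .west := by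
  rcases u with ⟨t', s'⟩ | ⟨t', s'⟩ | ⟨_ | _, s'⟩
  · cases t' <;> cases d <;> simp only [kind, reduceCtorEq] at h
  · cases t' <;> cases d <;> simp only [kind, reduceCtorEq] at h
  · cases d <;> simp only [kind, reduceCtorEq, GlueKind.ext.injEq] at h
    subst h
    simp
  · cases d <;> simp only [kind, reduceCtorEq, GlueKind.ext.injEq] at h
    subst h
    simp

theorem kind_main_out (t : LadderTile) (s : State) : (main t s).kind t.out = .own t s := by
  cases t <;> rfl

theorem kind_link_opp (t : LadderTile) (s : State) : (link t s).kind t.out.opp = .own t s := by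
  cases t <;> rfl

theorem kind_injective : Function.Injective kind := by
  intro u u' h
  rcases u with ⟨t, s⟩ | ⟨t, s⟩ | ⟨b, s⟩
  · have := congrFun h t.out
    rw [kind_main_out] at this
    rcases kind_eq_own this.symm with ⟨h, -⟩ | ⟨-, h⟩
    · exact h.symm
    · cases t <;> simp [out, Dir.opp] at h
  · have := congrFun h t.out.opp
    rw [kind_link_opp] at this
    rcases kind_eq_own this.symm with ⟨-, h⟩ | ⟨h, -⟩
    · cases t <;> simp [out, Dir.opp] at h
    · exact h.symm
  · have : (plug b s).kind .south = .plug b s := by cases b <;> rfl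
    rw [congrFun h] at this
    rcases kind_eq_plug this with ⟨-, h⟩ | ⟨h, -⟩
    · simp at h
    · exact h.symm

end MacroTile

instance : Finite LadderTile := LadderTile.finite

instance : Finite Mode :=
  Finite.of_surjective (fun b : Option Bool => match b with
    | none => Mode.mid
    | some true => Mode.hi
    | some false => Mode.lo) (by
      rintro (_ | _ | _)
      exacts [⟨some false, rfl⟩, ⟨none, rfl⟩, ⟨some true, rfl⟩])

instance : Finite MacroTile :=
  Finite.of_surjective
    (fun x : (LadderTile × State) ⊕ (LadderTile × State) ⊕ (Bool × State) => match x with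
      | .inl (t, s) => MacroTile.main t s
      | .inr (.inl (t, s)) => MacroTile.link t s
      | .inr (.inr (b, s)) => MacroTile.plug b s) (by
      rintro (⟨t, s⟩ | ⟨t, s⟩ | ⟨b, s⟩)
      exacts [⟨.inl (t, s), rfl⟩, ⟨.inr (.inl (t, s)), rfl⟩, ⟨.inr (.inr (b, s)), rfl⟩])

instance : Finite GlueKind :=
  Finite.of_surjective
    (fun x : Option Bool ⊕ (LadderTile × State) ⊕ (LadderTile × State) ⊕
        (LadderTile × Bool × Bool) ⊕ (Bool × State) ⊕ (Bool × Bool) => match x with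
      | .inl none => GlueKind.null
      | .inl (some _) => GlueKind.rung
      | .inr (.inl (t, s)) => GlueKind.own t s
      | .inr (.inr (.inl (t, s))) => GlueKind.hout t s
      | .inr (.inr (.inr (.inl (t, l)))) => GlueKind.vout t l
      | .inr (.inr (.inr (.inr (.inl (b, s))))) => GlueKind.plug b s
      | .inr (.inr (.inr (.inr (.inr e)))) => GlueKind.ext e) (by
      rintro (_ | _ | ⟨t, s⟩ | ⟨t, s⟩ | ⟨t, l⟩ | ⟨b, s⟩ | e)
      exacts [⟨.inl none, rfl⟩, ⟨.inl (some true), rfl⟩, ⟨.inr (.inl (t, s)), rfl⟩,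
        ⟨.inr (.inr (.inl (t, s))), rfl⟩, ⟨.inr (.inr (.inr (.inl (t, l)))), rfl⟩,
        ⟨.inr (.inr (.inr (.inr (.inl (b, s))))), rfl⟩,
        ⟨.inr (.inr (.inr (.inr (.inr e)))), rfl⟩])

/-- A numbering of the glues. -/
noncomputable def GlueKind.code : GlueKind → ℕ :=
  (Countable.exists_injective_nat GlueKind).choose

theorem GlueKind.code_injective : Function.Injective GlueKind.code :=
  (Countable.exists_injective_nat GlueKind).choose_spec

/-- The strengths of the glues. -/
def GlueKind.strength (τ δ : ℕ) : GlueKind → ℕ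
  | null => 0
  | rung => 1
  | ext _ => δ
  | _ => τ + δ

/-- The simulating system at temperature `τ + δ`. -/
noncomputable abbrev macroSystem (τ δ : ℕ) : TAS where
  Tile := MacroTile
  finite := inferInstance
  glue u d := ⟨(u.kind d).code, (u.kind d).strength τ δ⟩
  glue_injective := by
    intro u u' h
    refine MacroTile.kind_injective (funext fun d => GlueKind.code_injective ?_)
    exact congrArg Glue.label (congrFun h d)
  temp := τ + δ

section MacroBond

variable {τ δ : ℕ}

theorem macro_glue_eq_iff {u u' : MacroTile} {d d' : Dir} :
    (macroSystem τ δ).glue u d = (macroSystem τ δ).glue u' d' ↔ u.kind d = u'.kind d' := by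
  constructor
  · exact fun h => GlueKind.code_injective (congrArg Glue.label h)
  · intro h
    simp only [h]

theorem macro_pairBond_of_kind {u u' : MacroTile} {d : Dir} (h : u.kind d = u'.kind d.opp) :
    (macroSystem τ δ).pairBond (some u) (some u') d = (u.kind d).strength τ δ := by
  simp only [TAS.pairBond]
  rw [if_pos (macro_glue_eq_iff.2 h)]

theorem exists_of_macro_pairBond {a b : Option MacroTile} {d : Dir}
    (h : (macroSystem τ δ).pairBond a b d ≠ 0) :
    ∃ u u', a = some u ∧ b = some u' ∧ u.kind d = u'.kind d.opp ∧ u.kind d ≠ .null ∧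
      (macroSystem τ δ).pairBond a b d = (u.kind d).strength τ δ := by
  obtain ⟨u, u', rfl, rfl, hg, hs⟩ := TAS.exists_of_pairBond_pos h
  have hk := macro_glue_eq_iff.1 hg
  refine ⟨u, u', rfl, rfl, hk, fun h0 => ?_, macro_pairBond_of_kind hk⟩
  simp only [h0, GlueKind.strength] at hs
  exact hs rfl

end MacroBond

/-! ### Alignment -/

namespace MacroTile

/-- The position of a tile, up to even vertical translations, when the left backbone is in
column `1`. -/
def pos : MacroTile → ℤ × ℤ
  | main t _ => (2 * t.col + t.side, 0)
  | link t _ => (2 * t.col + t.side + t.out.vec.1, t.out.vec.2)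
  | plug true _ => (5, 1)
  | plug false _ => (6, 1)

end MacroTile

/-- The midpoint of the edge at which a glue occurs, in doubled coordinates. -/
def GlueKind.edge : GlueKind → ℤ × ℤ
  | null => 0
  | rung => (11, 0)
  | own t _ => (2 * (2 * t.col + t.side) + t.out.vec.1, t.out.vec.2)
  | hout t _ => (2 * (2 * t.col + t.side) + 3 * t.out.vec.1, 3 * t.out.vec.2)
  | vout t _ => (2 * (2 * t.col + t.side) + 3 * t.out.vec.1, 3 * t.out.vec.2)
  | plug true _ => (10, 1)
  | plug false _ => (12, 1)
  | ext _ => (11, 2)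

theorem MacroTile.edge_kind (u : MacroTile) (d : Dir) (h : u.kind d ≠ .null) :
    2 * u.pos.1 + d.vec.1 = (u.kind d).edge.1 ∧
      ∃ k : ℤ, 2 * u.pos.2 + d.vec.2 = (u.kind d).edge.2 + 4 * k := by
  rcases u with ⟨t, s⟩ | ⟨t, s⟩ | ⟨_ | _, s⟩
  · cases t <;> cases d <;> first
      | exact absurd rfl h
      | exact ⟨rfl, 0, rfl⟩
      | exact ⟨rfl, -1, rfl⟩
  · cases t <;> cases d <;> first
      | exact absurd rfl h
      | exact ⟨rfl, 0, rfl⟩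
  · cases d <;> first
      | exact absurd rfl h
      | exact ⟨rfl, 0, rfl⟩
  · cases d <;> first
      | exact absurd rfl h
      | exact ⟨rfl, 0, rfl⟩

/-- All tiles of `α` are at their positions relative to `v`. -/
def AlignedAt (v : ℤ × ℤ) (α : Assembly MacroTile) : Prop :=
  ∀ z u, α z = some u → z.1 = v.1 + u.pos.1 ∧ ∃ r : ℤ, z.2 = v.2 + u.pos.2 + 2 * r

/-- All tiles of `α` are at their positions. -/
abbrev Aligned (α : Assembly MacroTile) : Prop := AlignedAt 0 α

theorem Aligned.eq {α : Assembly MacroTile} (h : Aligned α) {z : ℤ × ℤ} {u : MacroTile}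
    (hz : α z = some u) : z.1 = u.pos.1 ∧ ∃ r : ℤ, z.2 = u.pos.2 + 2 * r := by
  simpa using h z u hz

theorem AlignedAt.shift {v : ℤ × ℤ} {α : Assembly MacroTile} (h : AlignedAt v α) (w : ℤ × ℤ) :
    AlignedAt (v + w) (Assembly.shift w α) := by
  intro z u hz
  obtain ⟨h1, r, h2⟩ := h _ _ hz
  refine ⟨?_, r, ?_⟩
  · simp only [Prod.fst_sub, Prod.fst_add] at *; linarith
  · simp only [Prod.snd_sub, Prod.snd_add] at *; linarith

theorem AlignedAt.mono {v : ℤ × ℤ} {α β : Assembly MacroTile} (h : AlignedAt v β)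
    (hs : Sub α β) : AlignedAt v α := fun z u hz => h z u (hs z u hz)

theorem AlignedAt.union {v : ℤ × ℤ} {α β : Assembly MacroTile} (hα : AlignedAt v α)
    (hβ : AlignedAt v β) : AlignedAt v (α.union β) := by
  intro z u hz
  rcases union_eq_some.1 hz with h | ⟨-, h⟩
  exacts [hα z u h, hβ z u h]

theorem alignedAt_singleAt (z : ℤ × ℤ) (u : MacroTile) : AlignedAt (z - u.pos) (singleAt z u) := by
  intro p u' h
  obtain ⟨rfl, rfl⟩ := singleAt_eq_some.1 h
  exact ⟨by simp, 0, by simp⟩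

/-- A bond transfers the alignment. -/
theorem alignedAt_of_kind_eq {v : ℤ × ℤ} {z : ℤ × ℤ} {u u' : MacroTile} {d : Dir}
    (h1 : z.1 = v.1 + u.pos.1) (h2 : ∃ r : ℤ, z.2 = v.2 + u.pos.2 + 2 * r)
    (hk : u.kind d = u'.kind d.opp) (hn : u.kind d ≠ .null) :
    (z + d.vec).1 = v.1 + u'.pos.1 ∧ ∃ r : ℤ, (z + d.vec).2 = v.2 + u'.pos.2 + 2 * r := by
  obtain ⟨e1, k, e2⟩ := u.edge_kind d hn
  obtain ⟨f1, l, f2⟩ := u'.edge_kind d.opp (hk ▸ hn)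
  obtain ⟨r, h2⟩ := h2
  rw [hk] at e1 e2
  simp only [Dir.vec_opp, Prod.fst_neg, Prod.snd_neg] at f1 f2
  refine ⟨?_, r + k - l, ?_⟩
  · simp only [Prod.fst_add]; linarith
  · simp only [Prod.snd_add]; linarith

theorem AlignedAt.of_pairBond {τ δ : ℕ} {v w : ℤ × ℤ} {α β : Assembly MacroTile} {z : ℤ × ℤ}
    {d : Dir} (hα : AlignedAt v α) (hβ : AlignedAt w β)
    (h : (macroSystem τ δ).pairBond (α z) (β (z + d.vec)) d ≠ 0) : AlignedAt v β := by
  obtain ⟨u, u', hu, hu', hk, hn, -⟩ := exists_of_macro_pairBond h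
  obtain ⟨h1, h2⟩ := hα z u hu
  obtain ⟨e1, r, e2⟩ := alignedAt_of_kind_eq h1 h2 hk hn
  obtain ⟨f1, r', f2⟩ := hβ _ _ hu'
  intro p x hp
  obtain ⟨g1, r'', g2⟩ := hβ p x hp
  exact ⟨by linarith, r'' + r - r', by linarith⟩

theorem AlignedAt.of_bonded {τ δ : ℕ} {v w : ℤ × ℤ} {α β : Assembly MacroTile}
    (hτ : 0 < τ) (hα : AlignedAt v α) (hβ : AlignedAt w β)
    (h : (macroSystem τ δ).Bonded α β) : AlignedAt v β := by
  obtain ⟨F, hF, hsum⟩ := h.exists_finset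
  rcases F.eq_empty_or_nonempty with rfl | ⟨e, he⟩
  · simp at hsum; omega
  · exact hα.of_pairBond hβ (hF e he)

/-- Producible assemblies are aligned relative to some point. -/
theorem exists_alignedAt_of_finProd {τ δ : ℕ} (hτ : 0 < τ) {α : Assembly MacroTile}
    (h : (macroSystem τ δ).FinProd α) : ∃ v, AlignedAt v α := by
  refine h.induction (P := fun α => ∃ v, AlignedAt v α) ?_ ?_ ?_
  · rintro w α ⟨v, hv⟩
    exact ⟨_, hv.shift w⟩
  · intro t
    have := alignedAt_singleAt 0 t
    rw [singleAt, shift_zero] at this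
    exact ⟨_, this⟩
  · rintro α β hα hβ hatt ⟨v, hv⟩ ⟨w, hw⟩
    exact ⟨v, hv.union (hv.of_bonded hτ hw (hatt.bonded hα.nonempty hβ.nonempty))⟩

theorem alignedAt_of_isSequence {τ δ : ℕ} (hτ : 0 < τ) {f : ℕ → Assembly MacroTile}
    (h0 : (macroSystem τ δ).FinProd (f 0))
    (hf : (macroSystem τ δ).IsSequence {b | (macroSystem τ δ).FinProducible b} f)
    {v : ℤ × ℤ} (hv : AlignedAt v (f 0)) (i : ℕ) : AlignedAt v (f i) := by
  induction i with
  | zero => exact hv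
  | succ i ih =>
    rcases hf i with he | ⟨β, hβ, hatt, he⟩
    · rwa [he]
    · rw [he]
      obtain ⟨w, hw⟩ := exists_alignedAt_of_finProd hτ hβ
      exact ih.union (ih.of_bonded hτ hw
        (hatt.bonded (hf.finProd h0 i).nonempty (TAS.FinProd.nonempty hβ)))

theorem exists_alignedAt {τ δ : ℕ} (hτ : 0 < τ) {α : Assembly MacroTile}
    (h : (macroSystem τ δ).Prod α) : ∃ v, AlignedAt v α := by
  obtain ⟨f, h0, hf, hr⟩ := TAS.prod_iff.1 h
  obtain ⟨v, hv⟩ := exists_alignedAt_of_finProd hτ h0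
  refine ⟨v, fun z u hz => ?_⟩
  obtain ⟨i, hi⟩ := (hr z u).1 hz
  exact alignedAt_of_isSequence hτ h0 hf hv i z u hi

/-- Every producible supertile contains an aligned assembly. -/
theorem exists_aligned {τ δ : ℕ} (hτ : 0 < τ) {a : Set (Assembly MacroTile)}
    (h : a ∈ (macroSystem τ δ).Producible) :
    ∃ α, a = supertile α ∧ (macroSystem τ δ).Prod α ∧ Aligned α := by
  obtain ⟨α, rfl, hα⟩ := TAS.exists_prod_of_mem h
  obtain ⟨v, hv⟩ := exists_alignedAt hτ hα
  refine ⟨shift (-v) α, by simp, hα.shift _, ?_⟩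
  have := hv.shift (-v)
  rwa [add_neg_cancel] at this

/-! ### The representation function -/

/-- The ladder tile of a main tile of the given side. -/
def mainOf (left : Bool) : Option MacroTile → Option LadderTile
  | some (.main t _) => if t.isLeft = left then some t else none
  | _ => none

/-- A block represents `t` if the main tile of `t` is at its place. -/
def macroRepr (b : Block 2 MacroTile) : Option LadderTile :=
  (mainOf true (b 1 0)).or (mainOf false (b 0 0))

/-- The assembly represented by an assembly of the simulating system. -/
abbrev repr (α : Assembly MacroTile) : Assembly LadderTile := assemblyRepr 2 macroRepr α

/-- The position of the main tile of `t` in block `p`. -/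
def mainCell (t : LadderTile) (p : ℤ × ℤ) : ℤ × ℤ := (2 * p.1 + t.side, 2 * p.2)

theorem mainOf_eq_some {left : Bool} {o : Option MacroTile} {t : LadderTile} :
    mainOf left o = some t ↔ t.isLeft = left ∧ ∃ s, o = some (.main t s) := by
  rcases o with _ | ⟨t', s'⟩ | _ | _
  · simp [mainOf]
  · by_cases h : t'.isLeft = left
    · simp only [mainOf, h, if_true, Option.some.injEq, MacroTile.main.injEq]
      constructor
      · rintro rfl; exact ⟨h, s', rfl, rfl⟩
      · rintro ⟨-, s, h, -⟩; exact h
    · simp only [mainOf, h, if_false, Option.some.injEq, MacroTile.main.injEq, reduceCtorEq,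
        false_iff]
      rintro ⟨h1, s, rfl, -⟩
      exact h h1
  · simp [mainOf]
  · simp [mainOf]

theorem isLeft_eq_true {t : LadderTile} : t.isLeft = true ↔ t.side = 1 := by
  cases t <;> simp [isLeft, side]

theorem isLeft_eq_false {t : LadderTile} : t.isLeft = false ↔ t.side = 0 := by
  cases t <;> simp [isLeft, side]

theorem exists_main_of_repr {α : Assembly MacroTile} {p : ℤ × ℤ} {t : LadderTile}
    (h : repr α p = some t) : ∃ s, α (mainCell t p) = some (.main t s) := by
  simp only [repr, assemblyRepr, macroRepr, Option.or_eq_some_iff, mainOf_eq_some, block] at h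
  rcases h with ⟨h1, s, h2⟩ | ⟨-, h1, s, h2⟩
  · exact ⟨s, by simpa [mainCell, isLeft_eq_true.1 h1] using h2⟩
  · exact ⟨s, by simpa [mainCell, isLeft_eq_false.1 h1] using h2⟩

theorem col_of_side {t t' : LadderTile} (h : t.side = 1) (h' : t'.side = 0) : t.col < t'.col := by
  cases t <;> simp [side] at h <;> cases t' <;> simp [side] at h' <;> simp [col]

theorem side_cases (t : LadderTile) : t.side = 0 ∨ t.side = 1 := by
  cases t <;> simp [side]

theorem repr_eq_some {α : Assembly MacroTile} (hα : Aligned α) {p : ℤ × ℤ} {t : LadderTile} :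
    repr α p = some t ↔ ∃ s, α (mainCell t p) = some (.main t s) := by
  refine ⟨exists_main_of_repr, ?_⟩
  rintro ⟨s, h⟩
  simp only [repr, assemblyRepr, macroRepr, Option.or_eq_some_iff, mainOf_eq_some, block]
  rcases side_cases t with ht | ht
  · right
    refine ⟨?_, isLeft_eq_false.2 ht, s, by simpa [mainCell, ht] using h⟩
    rw [Option.eq_none_iff_forall_ne_some]
    intro t' h'
    obtain ⟨h1, s', h2⟩ := mainOf_eq_some.1 h'
    have h3 := (hα.eq h2).1
    have h4 := (hα.eq h).1
    have h5 := col_of_side (isLeft_eq_true.1 h1) ht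
    have h6 := isLeft_eq_true.1 h1
    simp [MacroTile.pos, mainCell, ht, h6] at h3 h4
    omega
  · left
    exact ⟨isLeft_eq_true.2 ht, s, by simpa [mainCell, ht] using h⟩

theorem col_of_repr {α : Assembly MacroTile} (hα : Aligned α) {p : ℤ × ℤ} {t : LadderTile}
    (h : repr α p = some t) : p.1 = t.col := by
  obtain ⟨s, hs⟩ := exists_main_of_repr h
  have := (hα.eq hs).1
  simp [MacroTile.pos, mainCell] at this
  exact this

/-- A main tile of an aligned assembly is represented. -/
theorem exists_repr_of_main {α : Assembly MacroTile} (hα : Aligned α) {z : ℤ × ℤ}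
    {t : LadderTile} {s : State} (h : α z = some (.main t s)) :
    ∃ p, z = mainCell t p ∧ p.1 = t.col ∧ repr α p = some t := by
  obtain ⟨h1, r, h2⟩ := hα.eq h
  simp only [MacroTile.pos] at h1 h2
  have hz : z = mainCell t (t.col, r) := by
    ext
    · simp [mainCell, h1]
    · simp [mainCell, h2]
  exact ⟨_, hz, rfl, (repr_eq_some hα).2 ⟨s, hz ▸ h⟩⟩

theorem repr_shift (w : ℤ × ℤ) (α : Assembly MacroTile) :
    repr (shift (2 * w.1, 2 * w.2) α) = shift w (repr α) := by
  funext p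
  simp only [repr, assemblyRepr]
  rw [shift_apply]
  congr 1
  funext i j
  simp only [block]
  rw [shift_apply]
  congr 1
  ext
  · simp only [Prod.fst_sub]; ring
  · simp only [Prod.snd_sub]; ring

theorem repr_mono {α β : Assembly MacroTile} (hβ : Aligned β) (h : Sub α β) :
    Sub (repr α) (repr β) := by
  intro p t ht
  obtain ⟨s, hs⟩ := exists_main_of_repr ht
  exact (repr_eq_some hβ).2 ⟨s, h _ _ hs⟩

theorem mainCell_injective {t t' : LadderTile} {p q : ℤ × ℤ} (hp : p.1 = t.col)
    (hq : q.1 = t'.col) (h : mainCell t p = mainCell t' q) : p = q := by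
  simp only [mainCell, Prod.mk.injEq, hp, hq] at h
  ext
  · rw [hp, hq]
    rcases side_cases t with h1 | h1 <;> rcases side_cases t' with h2 | h2 <;> omega
  · omega

theorem repr_union {α β : Assembly MacroTile} (hα : Aligned α) (hβ : Aligned β)
    (hd : Disjoint (dom α) (dom β)) :
    Disjoint (dom (repr α)) (dom (repr β)) ∧
      repr (α.union β) = (repr α).union (repr β) := by
  have hu := hα.union hβ
  have hdd : Disjoint (dom (repr α)) (dom (repr β)) := by
    refine Set.disjoint_left.2 fun p hp hq => ?_
    obtain ⟨t, ht⟩ := mem_dom.1 hp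
    obtain ⟨t', ht'⟩ := mem_dom.1 hq
    have h1 := repr_mono hu (sub_union_left α β) p t ht
    have h2 := repr_mono hu (sub_union_right hd) p t' ht'
    rw [h1] at h2
    obtain rfl := Option.some_injective _ h2
    obtain ⟨s, hs⟩ := exists_main_of_repr ht
    obtain ⟨s', hs'⟩ := exists_main_of_repr ht'
    exact Set.disjoint_left.1 hd (mem_dom_of_eq hs) (mem_dom_of_eq hs')
  refine ⟨hdd, ext_some fun p t => ⟨fun h => ?_, fun h => ?_⟩⟩
  · obtain ⟨s, hs⟩ := exists_main_of_repr h
    rcases union_eq_some.1 hs with h1 | ⟨-, h1⟩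
    · exact sub_union_left _ _ _ _ ((repr_eq_some hα).2 ⟨s, h1⟩)
    · exact sub_union_right hdd _ _ ((repr_eq_some hβ).2 ⟨s, h1⟩)
  · rcases union_eq_some.1 h with h1 | ⟨-, h1⟩
    · exact repr_mono hu (sub_union_left α β) _ _ h1
    · exact repr_mono hu (sub_union_right hd) _ _ h1

theorem superRepr_aligned {α : Assembly MacroTile} (hα : Aligned α) :
    superRepr 2 macroRepr (supertile α) =
      {β | (dom β).Nonempty ∧ β ∈ supertile (repr α)} := by
  ext β
  constructor
  · rintro ⟨hne, _, ⟨v, rfl⟩, rfl⟩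
    refine ⟨hne, ?_⟩
    obtain ⟨p, hp⟩ := hne
    obtain ⟨t, ht⟩ := mem_dom.1 hp
    obtain ⟨s, hs⟩ := exists_main_of_repr ht
    obtain ⟨h1, r, h2⟩ := hα.eq hs
    simp only [MacroTile.pos, mainCell, Prod.fst_sub, Prod.snd_sub] at h1 h2
    refine ⟨(p.1 - t.col, p.2 - r), ?_⟩
    rw [← repr_shift]
    congr 2
    ext
    · simp; linarith
    · simp; linarith
  · rintro ⟨hne, w, rfl⟩
    exact ⟨hne, shift (2 * w.1, 2 * w.2) α, ⟨_, rfl⟩, (repr_shift w α).symm⟩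

theorem superRepr_of_nonempty {α : Assembly MacroTile} (hα : Aligned α)
    (h : (dom (repr α)).Nonempty) :
    superRepr 2 macroRepr (supertile α) = supertile (repr α) := by
  rw [superRepr_aligned hα]
  ext β
  refine ⟨fun h => h.2, fun hβ => ⟨?_, hβ⟩⟩
  obtain ⟨v, rfl⟩ := hβ
  obtain ⟨p, hp⟩ := h
  exact ⟨p + v, by simpa [mem_dom_shift] using hp⟩

theorem superRepr_eq_empty_iff {α : Assembly MacroTile} (hα : Aligned α) :
    superRepr 2 macroRepr (supertile α) = ∅ ↔ ¬ (dom (repr α)).Nonempty := by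
  constructor
  · intro h hne
    rw [superRepr_of_nonempty hα hne] at h
    exact Set.notMem_empty _ (h ▸ mem_supertile_self (repr α))
  · intro h
    rw [superRepr_aligned hα]
    ext β
    simp only [Set.mem_empty_iff_false, iff_false]
    rintro ⟨hne, v, rfl⟩
    obtain ⟨p, hp⟩ := hne
    exact h ⟨_, hp⟩

open MacroTile

/-! ### Local structure of stable assemblies -/

section Local

variable {τ δ : ℕ} {α X Y : Assembly MacroTile}

theorem sum_le_of_forall_ne {ι : Type*} {F : Finset ι} {f : ι → ℕ} (a : ι)
    (h : ∀ e ∈ F, e ≠ a → f e = 0) : ∑ e ∈ F, f e ≤ f a := by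
  by_cases ha : a ∈ F
  · rw [Finset.sum_eq_single_of_mem a ha h]
  · rw [Finset.sum_eq_zero fun e he => h e he (fun h' => ha (h' ▸ he))]
    exact Nat.zero_le _

/-- A plug in a stable assembly of at least two tiles is on top of the end of its rung: its other
glue alone is too weak. -/
theorem main_of_plug (hτ : 0 < τ) (hs : (macroSystem τ δ).Stable α) {z : ℤ × ℤ} {b : Bool}
    {s : State} (hz : α z = some (plug b s)) (hne : ∃ y ∈ dom α, y ≠ z) :
    α (z + Dir.south.vec) = some (main (rungEnd b) s) := by
  obtain ⟨y, hy, hyz⟩ := hne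
  obtain ⟨F, hF, hsum⟩ := hs {z} (by simpa using mem_dom_of_eq hz) (Set.singleton_nonempty z)
    (fun he => hyz (by rw [← he] at hy; exact hy))
  by_contra hc
  have hsouth : (macroSystem τ δ).bond α z .south = 0 := by
    by_contra hb
    rw [TAS.bond_eq] at hb
    obtain ⟨u, u', h1, h2, hk, -, -⟩ := exists_of_macro_pairBond hb
    rw [hz] at h1
    obtain rfl := Option.some_injective _ h1
    have : u'.kind .north = .plug b s := by
      rw [show Dir.north = Dir.south.opp from rfl, ← hk]; cases b <;> rfl
    rcases kind_eq_plug this with ⟨rfl, -⟩ | ⟨-, h⟩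
    · exact hc h2
    · simp at h
  -- without its main tile, at most one bond of strength `δ` remains
  have hle : ∀ d, (macroSystem τ δ).bond α z d ≤ δ := by
    intro d
    by_cases hb : (macroSystem τ δ).bond α z d = 0
    · omega
    by_cases hd : d = .south
    · subst hd; omega
    rw [TAS.bond_eq] at hb ⊢
    obtain ⟨u, u', h1, h2, hk, hn, he⟩ := exists_of_macro_pairBond hb
    rw [hz] at h1
    obtain rfl := Option.some_injective _ h1
    rw [he]
    cases b <;> cases d <;> simp [kind, GlueKind.strength] at hn hd ⊢
  have hd0 : ∃ d0, ∀ d, d ≠ d0 → (macroSystem τ δ).bond α z d = 0 := by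
    refine ⟨if b then .east else .west, fun d hd => ?_⟩
    by_contra hb
    by_cases hd' : d = .south
    · subst hd'; exact hb hsouth
    rw [TAS.bond_eq] at hb
    obtain ⟨u, u', h1, h2, hk, hn, he⟩ := exists_of_macro_pairBond hb
    rw [hz] at h1
    obtain rfl := Option.some_injective _ h1
    cases b <;> cases d <;> simp [kind] at hn hd hd'
  obtain ⟨d0, hd0⟩ := hd0
  have := sum_le_of_forall_ne (F := F) (f := fun e => (macroSystem τ δ).bond α e.1 e.2) (z, d0)
    (fun e he hne => by
      have h1 : e.1 = z := (hF e he).1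
      rw [h1]
      exact hd0 _ (fun h => hne (Prod.ext h1 h)))
  have h2 := hle d0
  change τ + δ ≤ _ at hsum
  change _ ≤ (macroSystem τ δ).bond α z d0 at this
  omega

/-- A link in a stable assembly of at least two tiles is bonded to one of its ends. -/
theorem main_of_link (hτ : 0 < τ) (hs : (macroSystem τ δ).Stable α) {z : ℤ × ℤ} {t : LadderTile}
    {s : State} (hz : α z = some (link t s)) (hne : ∃ y ∈ dom α, y ≠ z) :
    α (z + t.out.opp.vec) = some (main t s) ∨
      ∃ s', α (z + t.out.vec) = some (main t.nbr s') ∧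
        (main t.nbr s').kind t.out.opp = (link t s).kind t.out := by
  obtain ⟨y, hy, hyz⟩ := hne
  obtain ⟨p, d, hp, -, hb⟩ := hs.exists_bond (by change τ + δ ≠ 0; omega) (X := {z})
    (mem_dom_of_eq hz) rfl hy hyz
  obtain rfl : p = z := hp
  obtain ⟨u, u', h1, h2, hk, hn, -⟩ := exists_of_macro_pairBond hb
  rw [hz] at h1
  obtain rfl := Option.some_injective _ h1
  cases hkind : (link t s).kind d with
  | null => exact absurd hkind hn
  | rung =>
    rcases kind_eq_rung hkind with ⟨_, h, _⟩ | ⟨_, h, _⟩ <;> simp at h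
  | plug b s' =>
    rcases kind_eq_plug hkind with ⟨h, _⟩ | ⟨h, _⟩ <;> simp at h
  | ext e =>
    rcases kind_eq_ext hkind with ⟨_, h, _⟩ | ⟨_, h, _⟩ <;> simp at h
  | own t' s' =>
    rcases kind_eq_own hkind with ⟨h, -⟩ | ⟨h, hd⟩
    · simp at h
    simp only [link.injEq] at h
    obtain ⟨rfl, rfl⟩ := h
    subst hd
    rw [hkind] at hk
    rcases kind_eq_own hk.symm with ⟨h, -⟩ | ⟨-, h⟩
    · left; rw [h2, h]
    · cases t <;> simp [out, Dir.opp] at h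
  | hout t' s' =>
    obtain ⟨-, ⟨h, -⟩ | ⟨h, hd⟩⟩ := kind_eq_hout hkind
    · simp at h
    simp only [link.injEq] at h
    obtain ⟨rfl, rfl⟩ := h
    subst hd
    rw [hkind] at hk
    obtain ⟨-, ⟨h, -⟩ | ⟨-, h⟩⟩ := kind_eq_hout hk.symm
    · right
      subst h
      exact ⟨_, h2, by rw [← hk, hkind]⟩
    · cases t <;> simp [out, Dir.opp] at h
  | vout t' l =>
    obtain ⟨ht, ⟨_, h, _, _⟩ | ⟨s', h, _, hd⟩⟩ := kind_eq_vout hkind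
    · simp at h
    simp only [link.injEq] at h
    obtain ⟨rfl, rfl⟩ := h
    subst hd
    rw [hkind] at hk
    obtain ⟨-, ⟨s', h, -, -⟩ | ⟨_, -, -, h⟩⟩ := kind_eq_vout hk.symm
    · right
      subst h
      rw [ht]
      exact ⟨_, h2, by rw [← hk, hkind]⟩
    · simp [Dir.opp] at h

theorem mainCell_out (t : LadderTile) (p : ℤ × ℤ) :
    mainCell t.nbr (p + t.out.vec) = mainCell t p + t.out.vec + t.out.vec := by
  cases t <;> ext <;> simp [mainCell, nbr, out, Dir.vec, side] <;> ring

theorem ladder_pairBond_out (t : LadderTile) :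
    (ladderSystem τ).pairBond (some t) (some t.nbr) t.out = τ := by
  cases t <;> simp [TAS.pairBond, ladderGlue, out, nbr, Dir.opp]

theorem ladder_bonded_of_out {α β : Assembly LadderTile} {p : ℤ × ℤ} {t : LadderTile}
    (h : α p = some t) (h' : β (p + t.out.vec) = some t.nbr) : (ladderSystem τ).Bonded α β := by
  refine TAS.bonded_of_edge (e := (p, t.out)) ?_
  change τ ≤ (ladderSystem τ).pairBond (α p) (β (p + t.out.vec)) t.out
  rw [h, h', ladder_pairBond_out]

/-- The two ends of a link represent bonded ladder tiles. -/
theorem repr_bonded_of_ends (hX : Aligned X) (hY : Aligned Y) {z : ℤ × ℤ} {t : LadderTile}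
    {s s' : State} (h1 : X (z + t.out.opp.vec) = some (main t s))
    (h2 : Y (z + t.out.vec) = some (main t.nbr s')) :
    (ladderSystem τ).Bonded (repr X) (repr Y) := by
  obtain ⟨p, hp, -, hr⟩ := exists_repr_of_main hX h1
  refine ladder_bonded_of_out hr ((repr_eq_some hY).2 ⟨s', ?_⟩)
  rw [mainCell_out, ← hp, ← h2]
  congr 1
  simp

/-- If a link of `X` is bonded to a main tile of `Y`, its other end is in `X`. -/
theorem repr_bonded_of_link (hτ : 0 < τ) (hX : Aligned X) (hY : Aligned Y)
    (hs : (macroSystem τ δ).Stable X) (hd : Disjoint (dom X) (dom Y)) {z : ℤ × ℤ} {d : Dir}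
    {t t' : LadderTile} {s s' : State} (hz : X z = some (link t s)) (hne : ∃ y ∈ dom X, y ≠ z)
    (hz' : Y (z + d.vec) = some (main t' s')) (hk : (link t s).kind d = (main t' s').kind d.opp)
    (hn : (link t s).kind d ≠ .null) : (ladderSystem τ).Bonded (repr X) (repr Y) := by
  have hdir : (d = t.out.opp ∧ t' = t) ∨ (d = t.out ∧ t' = t.nbr) := by
    cases hkind : (link t s).kind d with
    | null => exact absurd hkind hn
    | rung =>
      rcases kind_eq_rung hkind with ⟨_, h, _⟩ | ⟨_, h, _⟩ <;> simp at h
    | plug b s' =>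
      rcases kind_eq_plug hkind with ⟨h, _⟩ | ⟨h, _⟩ <;> simp at h
    | ext e =>
      rcases kind_eq_ext hkind with ⟨_, h, _⟩ | ⟨_, h, _⟩ <;> simp at h
    | own t'' s'' =>
      rw [hkind] at hk
      rcases kind_eq_own hkind with ⟨h, -⟩ | ⟨h, hd⟩
      · simp at h
      rcases kind_eq_own hk.symm with ⟨h', -⟩ | ⟨h', -⟩
      · simp only [link.injEq, main.injEq] at h h'
        exact Or.inl ⟨by rw [hd, h.1], by rw [h.1, h'.1]⟩
      · simp at h'
    | hout t'' s'' =>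
      rw [hkind] at hk
      obtain ⟨-, ⟨h, -⟩ | ⟨h, hd⟩⟩ := kind_eq_hout hkind
      · simp at h
      obtain ⟨-, ⟨h', -⟩ | ⟨h', -⟩⟩ := kind_eq_hout hk.symm
      · simp only [link.injEq, main.injEq] at h h'
        exact Or.inr ⟨by rw [hd, h.1], by rw [h.1, h'.1]⟩
      · simp at h'
    | vout t'' l =>
      rw [hkind] at hk
      obtain ⟨ht, ⟨_, h, _, _⟩ | ⟨_, h, _, hd⟩⟩ := kind_eq_vout hkind
      · simp at h
      obtain ⟨-, ⟨_, h', -, -⟩ | ⟨_, h', -, -⟩⟩ := kind_eq_vout hk.symm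
      · simp only [link.injEq, main.injEq] at h h'
        exact Or.inr ⟨by rw [hd, h.1, ht], by rw [h.1, h'.1]⟩
      · simp at h'
  rcases main_of_link hτ hs hz hne with h1 | ⟨s1, h1, -⟩
  · rcases hdir with ⟨rfl, -⟩ | ⟨rfl, rfl⟩
    · exact absurd (mem_dom_of_eq hz') (Set.disjoint_left.1 hd (mem_dom_of_eq h1))
    · exact repr_bonded_of_ends hX hY h1 hz'
  · rcases hdir with ⟨rfl, rfl⟩ | ⟨rfl, -⟩
    · exact (repr_bonded_of_ends hY hX hz' h1).symm
    · exact absurd (mem_dom_of_eq hz') (Set.disjoint_left.1 hd (mem_dom_of_eq h1))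

theorem exists_ne_of_repr (hne : (dom (repr X)).Nonempty) {z : ℤ × ℤ} {u : MacroTile}
    (hz : X z = some u) (hu : ∀ t s, u ≠ main t s) : ∃ y ∈ dom X, y ≠ z := by
  obtain ⟨p, hp⟩ := hne
  obtain ⟨t, ht⟩ := mem_dom.1 hp
  obtain ⟨s, hs⟩ := exists_main_of_repr ht
  refine ⟨_, mem_dom_of_eq hs, fun h => ?_⟩
  rw [h, hz] at hs
  exact hu t s (Option.some_injective _ hs)

/-- A strong bond between two assemblies is a strong bond between the represented ones; the other
bonds are those between the ends of rungs and between plugs. -/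
theorem repr_bonded_or_weak (hτ : 0 < τ) (hX : Aligned X) (hY : Aligned Y)
    (hsX : (macroSystem τ δ).Stable X) (hsY : (macroSystem τ δ).Stable Y)
    (hnX : (dom (repr X)).Nonempty) (hnY : (dom (repr Y)).Nonempty)
    (hd : Disjoint (dom X) (dom Y)) {z : ℤ × ℤ} {d : Dir} {u u' : MacroTile}
    (hz : X z = some u) (hz' : Y (z + d.vec) = some u') (hk : u.kind d = u'.kind d.opp)
    (hn : u.kind d ≠ .null) :
    (ladderSystem τ).Bonded (repr X) (repr Y) ∨ u.kind d = .rung ∨ ∃ e, u.kind d = .ext e := by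
  have hback : z + d.vec + d.opp.vec = z := by simp
  have hnull : u'.kind d.opp ≠ .null := hk ▸ hn
  have hk' : u'.kind d.opp = u.kind d.opp.opp := by rw [Dir.opp_opp, hk]
  -- a bond between a link and a main tile, in either order
  have key1 : ∀ t s t' s', u = link t s → u' = main t' s' →
      (ladderSystem τ).Bonded (repr X) (repr Y) := by
    rintro t s t' s' rfl rfl
    exact repr_bonded_of_link hτ hX hY hsX hd hz (exists_ne_of_repr hnX hz (by simp)) hz' hk hn
  have key2 : ∀ t s t' s', u' = link t s → u = main t' s' →
      (ladderSystem τ).Bonded (repr X) (repr Y) := by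
    rintro t s t' s' rfl rfl
    exact (repr_bonded_of_link hτ hY hX hsY hd.symm hz' (exists_ne_of_repr hnY hz' (by simp))
      (by rw [hback]; exact hz) hk' hnull).symm
  cases hkind : u.kind d with
  | null => exact absurd hkind hn
  | rung => exact Or.inr (Or.inl rfl)
  | ext e => exact Or.inr (Or.inr ⟨e, rfl⟩)
  | own t s =>
    left
    have hkind' := hk.symm.trans hkind
    rcases kind_eq_own hkind with ⟨h1, h2⟩ | ⟨h1, h2⟩ <;>
      rcases kind_eq_own hkind' with ⟨h3, h4⟩ | ⟨h3, h4⟩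
    · rw [h2] at h4; cases t <;> simp [out, Dir.opp] at h4
    · exact key2 _ _ _ _ h3 h1
    · exact key1 _ _ _ _ h1 h3
    · rw [h2] at h4; cases t <;> simp [out, Dir.opp] at h4
  | hout t s =>
    left
    have hkind' := hk.symm.trans hkind
    obtain ⟨-, ⟨h1, h2⟩ | ⟨h1, h2⟩⟩ := kind_eq_hout hkind <;>
      obtain ⟨-, ⟨h3, h4⟩ | ⟨h3, h4⟩⟩ := kind_eq_hout hkind'
    · rw [h2] at h4; cases t <;> simp [out, Dir.opp] at h4
    · exact key2 _ _ _ _ h3 h1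
    · exact key1 _ _ _ _ h1 h3
    · rw [h2] at h4; cases t <;> simp [out, Dir.opp] at h4
  | vout t l =>
    left
    have hkind' := hk.symm.trans hkind
    obtain ⟨-, ⟨_, h1, -, h2⟩ | ⟨_, h1, -, h2⟩⟩ := kind_eq_vout hkind <;>
      obtain ⟨-, ⟨_, h3, -, h4⟩ | ⟨_, h3, -, h4⟩⟩ := kind_eq_vout hkind'
    · rw [h2] at h4; simp [Dir.opp] at h4
    · exact key2 _ _ _ _ h3 h1
    · exact key1 _ _ _ _ h1 h3
    · rw [h2] at h4; simp [Dir.opp] at h4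
  | plug b s =>
    exfalso
    have hkind' := hk.symm.trans hkind
    rcases kind_eq_plug hkind with ⟨h1, h2⟩ | ⟨h1, h2⟩ <;>
      rcases kind_eq_plug hkind' with ⟨h3, h4⟩ | ⟨h3, h4⟩
    · rw [h2] at h4; simp [Dir.opp] at h4
    · subst h3
      have := main_of_plug hτ hsY hz' (exists_ne_of_repr hnY hz' (by simp))
      rw [show Dir.south = d.opp by rw [h2]; rfl, hback] at this
      exact Set.disjoint_left.1 hd (mem_dom_of_eq hz) (mem_dom_of_eq this)
    · subst h1
      have := main_of_plug hτ hsX hz (exists_ne_of_repr hnX hz (by simp))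
      rw [← h2] at this
      exact Set.disjoint_left.1 hd (mem_dom_of_eq this) (mem_dom_of_eq hz')
    · rw [h2] at h4; simp [Dir.opp] at h4

end Local

/-! ### Facing half-ladders -/

section Planar

variable {τ δ : ℕ} {α X Y : Assembly MacroTile}

/-- The state of a tile. -/
def MacroTile.state : MacroTile → State
  | main _ s => s
  | link _ s => s
  | plug _ s => s

theorem pos_of_kind_north {u : MacroTile} (h : u.kind .north ≠ .null) :
    u.pos.1 = 1 ∨ u.pos.1 = 10 ∨ u.pos.2 = 0 := by
  rcases u with ⟨t, s⟩ | ⟨t, s⟩ | ⟨_ | _, s⟩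
  · cases t <;> simp [pos, col, side]
  · cases t <;> simp [pos, col, side, out, Dir.vec]
  · simp [kind] at h
  · simp [kind] at h

theorem pos_of_kind_south {u : MacroTile} (h : u.kind .south ≠ .null) :
    u.pos.1 = 1 ∨ u.pos.1 = 10 ∨ u.pos.2 = 1 := by
  rcases u with ⟨t, s⟩ | ⟨t, s⟩ | ⟨_ | _, s⟩
  · cases t <;> simp [kind] at h <;> simp [pos, col, side]
  · cases t <;> simp [kind] at h <;> simp [pos, col, side, out, Dir.vec]
  · simp [pos]
  · simp [pos]

theorem pos_of_odd {u : MacroTile} :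
    u.pos.2 = 0 ∨ u.pos.2 = 1 ∧ (u.pos.1 = 1 ∨ u.pos.1 = 5 ∨ u.pos.1 = 6 ∨ u.pos.1 = 10) := by
  rcases u with ⟨t, s⟩ | ⟨t, s⟩ | ⟨_ | _, s⟩
  · cases t <;> simp [pos]
  · cases t <;> simp [pos, col, side, out, Dir.vec]
  · simp [pos]
  · simp [pos]

theorem state_eq_of_kind_west {u u' : MacroTile} (h : u.kind .west ≠ .null)
    (hk : u.kind .west = u'.kind .east) (hu : u.pos.1 ≤ 5) :
    u.pos.2 = 0 ∧ u.state = u'.state := by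
  rcases u with ⟨t, s⟩ | ⟨t, s⟩ | ⟨_ | _, s⟩
  · cases t <;> simp [pos, col, side] at hu <;> simp [kind] at h <;>
      rcases kind_eq_own hk.symm with ⟨rfl, -⟩ | ⟨rfl, -⟩ <;> exact ⟨rfl, rfl⟩
  · cases t <;> simp [pos, col, side, out, Dir.vec] at hu <;> simp [kind] at h <;>
      rcases kind_eq_hout hk.symm with ⟨-, ⟨rfl, -⟩ | ⟨rfl, -⟩⟩ <;> exact ⟨rfl, rfl⟩
  · simp [pos] at hu
  · simp [kind] at h

theorem state_eq_of_kind_east {u u' : MacroTile} (h : u.kind .east ≠ .null)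
    (hk : u.kind .east = u'.kind .west) (hu : 6 ≤ u.pos.1) :
    u.pos.2 = 0 ∧ u.state = u'.state := by
  rcases u with ⟨t, s⟩ | ⟨t, s⟩ | ⟨_ | _, s⟩
  · cases t <;> simp [pos, col, side] at hu <;> simp [kind] at h <;>
      rcases kind_eq_own hk.symm with ⟨rfl, -⟩ | ⟨rfl, -⟩ <;> exact ⟨rfl, rfl⟩
  · cases t <;> simp [pos, col, side, out, Dir.vec] at hu <;> simp [kind] at h <;>
      rcases kind_eq_hout hk.symm with ⟨-, ⟨rfl, -⟩ | ⟨rfl, -⟩⟩ <;> exact ⟨rfl, rfl⟩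
  · simp [kind] at h
  · simp [pos] at hu

/-- A bond across the line between a row of main tiles and the row of links above it. -/
theorem exists_bond_lower (hτ : 0 < τ) (hα : Aligned α) (hs : (macroSystem τ δ).Stable α) (r : ℤ)
    {x y : ℤ × ℤ} (hx : x ∈ dom α) (hxr : x.2 ≤ 2 * r ∨ x.2 = 2 * r + 1 ∧ x.1 ≠ 1 ∧ x.1 ≠ 10)
    (hy : y ∈ dom α) (hyr : 2 * r + 1 < y.2) :
    ∃ c u u', (c = 1 ∨ c = 10) ∧ α (c, 2 * r) = some u ∧ α (c, 2 * r + 1) = some u' ∧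
      u.kind .north = u'.kind .south ∧ u.kind .north ≠ .null := by
  obtain ⟨p, d, hp, hpd, hb⟩ := hs.exists_bond (by change τ + δ ≠ 0; omega)
    (X := {p | p.2 ≤ 2 * r ∨ p.2 = 2 * r + 1 ∧ p.1 ≠ 1 ∧ p.1 ≠ 10}) hx hxr hy
    (fun h => by rcases h with h | ⟨h, -⟩ <;> omega)
  obtain ⟨u, u', h1, h2, hk, hn, -⟩ := exists_of_macro_pairBond hb
  obtain ⟨e1, k, e2⟩ := hα.eq h1
  have hodd := pos_of_odd (u := u)
  change p.2 ≤ 2 * r ∨ p.2 = 2 * r + 1 ∧ p.1 ≠ 1 ∧ p.1 ≠ 10 at hp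
  change ¬ (p.2 + d.vec.2 ≤ 2 * r ∨ p.2 + d.vec.2 = 2 * r + 1 ∧ p.1 + d.vec.1 ≠ 1 ∧
    p.1 + d.vec.1 ≠ 10) at hpd
  have hd : d = .north := by
    cases d
    · rfl
    all_goals
      simp only [Dir.vec] at hpd
      omega
  subst hd
  have hnorth := pos_of_kind_north hn
  simp only [Dir.vec] at hpd
  have hp2 : p.2 = 2 * r := by omega
  have hp1 : p.1 = 1 ∨ p.1 = 10 := by omega
  refine ⟨p.1, u, u', hp1, ?_, ?_, hk, hn⟩
  · rw [← h1, ← hp2]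
  · rw [← h2, ← hp2]
    congr 1
    ext <;> simp [Dir.vec]

/-- A bond across the line between a row of links and the row of main tiles above it. -/
theorem exists_bond_upper (hτ : 0 < τ) (hα : Aligned α) (hs : (macroSystem τ δ).Stable α) (r : ℤ)
    {x y : ℤ × ℤ} (hx : x ∈ dom α) (hxr : x.2 ≤ 2 * r + 1)
    (hy : y ∈ dom α) (hyr : 2 * r + 1 < y.2) :
    ∃ c u u', (c = 1 ∨ c = 10) ∧ α (c, 2 * r + 1) = some u ∧ α (c, 2 * r + 2) = some u' ∧
      u.kind .north = u'.kind .south ∧ u.kind .north ≠ .null := by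
  obtain ⟨p, d, hp, hpd, hb⟩ := hs.exists_bond (by change τ + δ ≠ 0; omega)
    (X := {p | p.2 ≤ 2 * r + 1}) hx hxr hy (fun h => by
      change y.2 ≤ _ at h
      omega)
  obtain ⟨u, u', h1, h2, hk, hn, -⟩ := exists_of_macro_pairBond hb
  obtain ⟨e1, k, e2⟩ := hα.eq h1
  have hodd := pos_of_odd (u := u)
  change p.2 ≤ 2 * r + 1 at hp
  change ¬ p.2 + d.vec.2 ≤ 2 * r + 1 at hpd
  have hd : d = .north := by
    cases d
    · rfl
    all_goals
      simp only [Dir.vec] at hpd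
      omega
  subst hd
  have hnorth := pos_of_kind_north hn
  simp only [Dir.vec] at hpd
  have hp2 : p.2 = 2 * r + 1 := by omega
  have hp1 : p.1 = 1 ∨ p.1 = 10 := by omega
  refine ⟨p.1, u, u', hp1, ?_, ?_, hk, hn⟩
  · rw [← h1, ← hp2]
  · rw [← h2]
    congr 1
    ext <;> simp [Dir.vec, hp2]
    ring

/-- A bond across the boundary of a part of a rung. -/
theorem exists_bond_rung (hτ : 0 < τ) (hα : Aligned α) (hs : (macroSystem τ δ).Stable α)
    {r lo hi : ℤ} (hlo : 2 ≤ lo) (hhi : hi ≤ 9) {x y : ℤ × ℤ} (hx : x ∈ dom α)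
    (hxr : lo ≤ x.1 ∧ x.1 ≤ hi ∧ (x.2 = 2 * r ∨ x.2 = 2 * r + 1))
    (hy : y ∈ dom α) (hyr : y.1 < lo ∨ hi < y.1) :
    ∃ c u u', (c = 2 * r ∨ c = 2 * r + 1) ∧
      (α (lo, c) = some u ∧ α (lo - 1, c) = some u' ∧ u.kind .west = u'.kind .east ∧
          u.kind .west ≠ .null ∨
        α (hi, c) = some u ∧ α (hi + 1, c) = some u' ∧ u.kind .east = u'.kind .west ∧
          u.kind .east ≠ .null) := by
  obtain ⟨p, d, hp, hpd, hb⟩ := hs.exists_bond (by change τ + δ ≠ 0; omega)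
    (X := {p | lo ≤ p.1 ∧ p.1 ≤ hi ∧ (p.2 = 2 * r ∨ p.2 = 2 * r + 1)}) hx hxr hy
    (fun h => by
      change lo ≤ y.1 ∧ y.1 ≤ hi ∧ _ at h
      omega)
  obtain ⟨u, u', h1, h2, hk, hn, -⟩ := exists_of_macro_pairBond hb
  obtain ⟨e1, k, e2⟩ := hα.eq h1
  change lo ≤ p.1 ∧ p.1 ≤ hi ∧ (p.2 = 2 * r ∨ p.2 = 2 * r + 1) at hp
  change ¬ (lo ≤ p.1 + d.vec.1 ∧ p.1 + d.vec.1 ≤ hi ∧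
    (p.2 + d.vec.2 = 2 * r ∨ p.2 + d.vec.2 = 2 * r + 1)) at hpd
  cases d with
  | north =>
    have := pos_of_kind_north hn
    simp only [Dir.vec] at hpd
    omega
  | south =>
    have := pos_of_kind_south hn
    simp only [Dir.vec] at hpd
    omega
  | east =>
    simp only [Dir.vec] at hpd
    have hp1 : p.1 = hi := by omega
    refine ⟨p.2, u, u', hp.2.2, Or.inr ⟨?_, ?_, hk, hn⟩⟩
    · rw [← h1, ← hp1]
    · rw [← h2, ← hp1]
      congr 1
      ext <;> simp [Dir.vec]
  | west =>
    simp only [Dir.vec] at hpd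
    have hp1 : p.1 = lo := by omega
    refine ⟨p.2, u, u', hp.2.2, Or.inl ⟨?_, ?_, hk, hn⟩⟩
    · rw [← h1, ← hp1]
    · rw [← h2, ← hp1]
      congr 1
      ext <;> simp [Dir.vec]
      ring

/-- If the rest of the row belongs to another assembly, a left rung is bonded to its backbone, and
therefore has the same state. -/
theorem state_left_rung (hτ : 0 < τ) (hα : Aligned α) (hs : (macroSystem τ δ).Stable α) {r : ℤ}
    {s : State} {u : MacroTile} (hplug : α (5, 2 * r + 1) = some (plug true s))
    (hu : α (1, 2 * r) = some u) (h6 : α (6, 2 * r) = none) (h6' : α (6, 2 * r + 1) = none) :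
    s = u.state := by
  have step : ∀ lo : ℤ, 2 ≤ lo → lo ≤ 5 → ∃ v v', α (lo, 2 * r) = some v ∧
      α (lo - 1, 2 * r) = some v' ∧ v.state = v'.state := by
    intro lo h2 h5
    obtain ⟨c, v, v', hc, ⟨h1, h2, h3, h4⟩ | ⟨-, h2, -⟩⟩ := exists_bond_rung (r := r) (lo := lo)
      (hi := 5) hτ hα hs h2 (by norm_num) (mem_dom_of_eq hplug) (by simp; omega)
      (mem_dom_of_eq hu) (Or.inl (by simp; omega))
    · obtain ⟨e1, k, e2⟩ := hα.eq h1
      obtain ⟨f1, f2⟩ := state_eq_of_kind_west h4 h3 (by rw [← e1]; exact h5)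
      simp only [f1] at e2
      obtain rfl : c = 2 * r := by omega
      exact ⟨v, v', h1, h2, f2⟩
    · rcases hc with rfl | rfl
      · rw [show (5 : ℤ) + 1 = 6 by norm_num, h6] at h2; simp at h2
      · rw [show (5 : ℤ) + 1 = 6 by norm_num, h6'] at h2; simp at h2
  have h0 := main_of_plug hτ hs hplug ⟨_, mem_dom_of_eq hu, by simp⟩
  obtain ⟨a5, a4, h5, h4, e5⟩ := step 5 (by norm_num) (by norm_num)
  obtain ⟨b4, b3, h4', h3, e4⟩ := step 4 (by norm_num) (by norm_num)
  obtain ⟨c3, c2, h3', h2, e3⟩ := step 3 (by norm_num) (by norm_num)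
  obtain ⟨d2, d1, h2', h1, e2⟩ := step 2 (by norm_num) (by norm_num)
  norm_num [Dir.vec] at h0 h4 h3 h2 h1
  rw [h0] at h5
  rw [h4] at h4'
  rw [h3] at h3'
  rw [h2] at h2'
  rw [hu] at h1
  simp only [Option.some.injEq] at h5 h4' h3' h2' h1
  rw [h1, ← e2, ← h2', ← e3, ← h3', ← e4, ← h4', ← e5, ← h5]
  rfl

/-- The mirror image of `state_left_rung`. -/
theorem state_right_rung (hτ : 0 < τ) (hα : Aligned α) (hs : (macroSystem τ δ).Stable α) {r : ℤ}
    {s : State} {u : MacroTile} (hplug : α (6, 2 * r + 1) = some (plug false s))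
    (hu : α (10, 2 * r) = some u) (h5 : α (5, 2 * r) = none) (h5' : α (5, 2 * r + 1) = none) :
    s = u.state := by
  have step : ∀ hi : ℤ, 6 ≤ hi → hi ≤ 9 → ∃ v v', α (hi, 2 * r) = some v ∧
      α (hi + 1, 2 * r) = some v' ∧ v.state = v'.state := by
    intro hi h2 h9
    obtain ⟨c, v, v', hc, ⟨-, h2, -⟩ | ⟨h1, h2, h3, h4⟩⟩ := exists_bond_rung (r := r) (lo := 6)
      (hi := hi) hτ hα hs (by norm_num) h9 (mem_dom_of_eq hplug) (by simp; omega)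
      (mem_dom_of_eq hu) (Or.inr (by simp; omega))
    · rcases hc with rfl | rfl
      · rw [show (6 : ℤ) - 1 = 5 by norm_num, h5] at h2; simp at h2
      · rw [show (6 : ℤ) - 1 = 5 by norm_num, h5'] at h2; simp at h2
    · obtain ⟨e1, k, e2⟩ := hα.eq h1
      obtain ⟨f1, f2⟩ := state_eq_of_kind_east h4 h3 (by rw [← e1]; assumption)
      simp only [f1] at e2
      obtain rfl : c = 2 * r := by omega
      exact ⟨v, v', h1, h2, f2⟩
  have h0 := main_of_plug hτ hs hplug ⟨_, mem_dom_of_eq hu, by simp⟩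
  obtain ⟨a5, a4, h5, h4, e5⟩ := step 6 (by norm_num) (by norm_num)
  obtain ⟨b4, b3, h4', h3, e4⟩ := step 7 (by norm_num) (by norm_num)
  obtain ⟨c3, c2, h3', h2, e3⟩ := step 8 (by norm_num) (by norm_num)
  obtain ⟨d2, d1, h2', h1, e2⟩ := step 9 (by norm_num) (by norm_num)
  norm_num [Dir.vec] at h0 h4 h3 h2 h1
  rw [h0] at h5
  rw [h4] at h4'
  rw [h3] at h3'
  rw [h2] at h2'
  rw [hu] at h1
  simp only [Option.some.injEq] at h5 h4' h3' h2' h1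
  rw [h1, ← e2, ← h2', ← e3, ← h3', ← e4, ← h4', ← e5, ← h5]
  rfl

/-- The relation between the states of a backbone macrotile and one above it. -/
def State.Mono (s s' : State) : Prop := s.1 = s'.1 ∧ (s.2 ≠ .lo → s'.2 = .hi)

theorem State.Mono.trans {s s' s'' : State} (h : s.Mono s') (h' : s'.Mono s'') : s.Mono s'' :=
  ⟨h.1.trans h'.1, fun hs => h'.2 (by rw [h.2 hs]; simp)⟩

theorem State.mono_of_above_eq {s s' : State} (h : s.above = s'.below) : s.Mono s' := by
  obtain ⟨c, m⟩ := s
  obtain ⟨c', m'⟩ := s'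
  cases m <;> cases m' <;> simp [above, below] at h <;> simp [Mono, h]

theorem State.ext_cases {s s' : State} (h : s.extLeft = s'.extRight) :
    s.2 = .mid ∧ s'.2 ≠ .mid ∧ s.1 ≠ s'.1 ∨ s.2 ≠ .mid ∧ s'.2 = .mid ∧ s.1 = s'.1 := by
  obtain ⟨c, m⟩ := s
  obtain ⟨c', m'⟩ := s'
  cases m <;> cases m' <;> simp [extLeft, extRight] at h ⊢ <;> cases c <;> simp_all

/-- Two pairs of matching additional glues cannot both join the same two backbones: of the two
distinguished rows only one counts, depending on whether the colours agree. -/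
theorem State.Mono.not_ext {a a' b b' : State} (ha : a.Mono a') (hb : b.Mono b')
    (h : a.extLeft = b.extRight) (h' : a'.extLeft = b'.extRight) : False := by
  rcases ext_cases h with ⟨h1, h2, h3⟩ | ⟨h1, h2, h3⟩ <;>
    rcases ext_cases h' with ⟨h4, h5, h6⟩ | ⟨h4, h5, h6⟩
  · have := ha.2 (by rw [h1]; simp)
    rw [h4] at this; simp at this
  · exact h3 (by rw [ha.1, hb.1, h6])
  · exact h6 (by rw [← ha.1, ← hb.1, h3])
  · have := hb.2 (by rw [h2]; simp)
    rw [h5] at this; simp at this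

/-- Two consecutive vertical bonds in a backbone. -/
theorem mono_of_bonds (hα : Aligned α) {c r : ℤ} {u v v' w : MacroTile}
    (hu : α (c, 2 * r) = some u) (hv : α (c, 2 * r + 1) = some v)
    (hv' : α (c, 2 * r + 1) = some v') (hc : c = 1 ∨ c = 10)
    (h1 : u.kind .north = v.kind .south) (hn : u.kind .north ≠ .null)
    (h2 : v'.kind .north = w.kind .south) (hn2 : v'.kind .north ≠ .null) :
    u.state.Mono w.state := by
  obtain rfl : v = v' := Option.some_injective _ (hv.symm.trans hv')
  obtain ⟨e1, k, e2⟩ := hα.eq hv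
  obtain ⟨f1, l, f2⟩ := hα.eq hu
  simp only at e1 e2 f1 f2
  rcases v with ⟨t, s⟩ | ⟨t, s⟩ | ⟨_ | _, s⟩
  · simp only [pos] at e2; omega
  · have ht : t.out = .north := by cases t <;> simp [kind] at hn2 <;> rfl
    have hu' : u.kind .north = .own t s := by
      rw [h1, show Dir.south = t.out.opp by rw [ht]; rfl, kind_link_opp]
    have hw' : w.kind .south = .vout t s.above := by
      rw [← h2]
      cases t <;> simp [out] at ht <;> rfl
    rcases kind_eq_own hu' with ⟨rfl, -⟩ | ⟨-, h⟩
    · obtain ⟨-, ⟨s', rfl, h3, -⟩ | ⟨s', -, -, h3⟩⟩ := kind_eq_vout hw'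
      · exact State.mono_of_above_eq h3.symm
      · simp at h3
    · rw [ht] at h; simp [Dir.opp] at h
  · simp [pos] at e1; omega
  · simp [pos] at e1; omega

/-- The plugs in row `r` at the ends of two facing rungs, one of `X` and one of `Y`, match. -/
def Facing (X Y : Assembly MacroTile) (r : ℤ) : Prop :=
  ∃ s s' : State, s.extLeft = s'.extRight ∧
    (X (5, 2 * r + 1) = some (plug true s) ∧ Y (6, 2 * r + 1) = some (plug false s') ∨
      Y (5, 2 * r + 1) = some (plug true s) ∧ X (6, 2 * r + 1) = some (plug false s'))

theorem Facing.symm {r : ℤ} (h : Facing X Y r) : Facing Y X r := by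
  obtain ⟨s, s', he, h⟩ := h
  exact ⟨s, s', he, h.symm⟩

theorem Facing.exists_left {r : ℤ} (h : Facing X Y r) :
    ∃ c : ℤ, (c = 5 ∨ c = 6) ∧ (c, 2 * r + 1) ∈ dom X := by
  obtain ⟨s, s', he, ⟨h, -⟩ | ⟨-, h⟩⟩ := h
  · exact ⟨5, Or.inl rfl, mem_dom_of_eq h⟩
  · exact ⟨6, Or.inr rfl, mem_dom_of_eq h⟩

/-- Between two rows with matching plugs both assemblies cross every horizontal line, hence each
of them runs along one of the two backbones. -/
theorem exists_columns (hτ : 0 < τ) (hX : Aligned X) (hY : Aligned Y)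
    (hsX : (macroSystem τ δ).Stable X) (hsY : (macroSystem τ δ).Stable Y)
    (hd : Disjoint (dom X) (dom Y)) {r r' : ℤ} (hr : r < r') (h : Facing X Y r)
    (h' : Facing X Y r') :
    ∃ c c' : ℤ, (c = 1 ∧ c' = 10 ∨ c = 10 ∧ c' = 1) ∧ ∃ a a' b b' : MacroTile,
      X (c, 2 * r) = some a ∧ X (c, 2 * r') = some a' ∧ a.state.Mono a'.state ∧
      Y (c', 2 * r) = some b ∧ Y (c', 2 * r') = some b' ∧ b.state.Mono b'.state := by
  have hdis : ∀ {z u v}, X z = some u → Y z = some v → False := fun hu hv =>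
    Set.disjoint_left.1 hd (mem_dom_of_eq hu) (mem_dom_of_eq hv)
  have lower : ∀ P Q : Assembly MacroTile, Aligned P → (macroSystem τ δ).Stable P →
      Facing P Q r → Facing P Q r' → ∀ k, r ≤ k → k < r' →
      ∃ c u u', (c = 1 ∨ c = 10) ∧ P (c, 2 * k) = some u ∧ P (c, 2 * k + 1) = some u' ∧
        u.kind .north = u'.kind .south ∧ u.kind .north ≠ .null := by
    intro P Q hP hsP hf hf' k hk hk'
    obtain ⟨x, hx, hxP⟩ := hf.exists_left
    obtain ⟨y, hy, hyP⟩ := hf'.exists_left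
    exact exists_bond_lower hτ hP hsP k hxP (by simp; omega) hyP (by simp; omega)
  have upper : ∀ P Q : Assembly MacroTile, Aligned P → (macroSystem τ δ).Stable P →
      Facing P Q r → Facing P Q r' → ∀ k, r ≤ k → k < r' →
      ∃ c u u', (c = 1 ∨ c = 10) ∧ P (c, 2 * k + 1) = some u ∧ P (c, 2 * k + 2) = some u' ∧
        u.kind .north = u'.kind .south ∧ u.kind .north ≠ .null := by
    intro P Q hP hsP hf hf' k hk hk'
    obtain ⟨x, hx, hxP⟩ := hf.exists_left
    obtain ⟨y, hy, hyP⟩ := hf'.exists_left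
    exact exists_bond_upper hτ hP hsP k hxP (by simp; omega) hyP (by simp; omega)
  -- as the two assemblies are disjoint, they run along different backbones
  obtain ⟨c, a, a1, hc, ha, -, -⟩ := lower X Y hX hsX h h' r le_rfl hr
  obtain ⟨c', b, b1, hc', hb, -, -⟩ := lower Y X hY hsY h.symm h'.symm r le_rfl hr
  have hne : c ≠ c' := fun he => hdis ha (he ▸ hb)
  refine ⟨c, c', by omega, a, ?_⟩
  -- induction over the rows from `r` to `r'`
  have key : ∀ n : ℕ, r + n ≤ r' → ∃ a' b' : MacroTile,
      X (c, 2 * (r + n)) = some a' ∧ Y (c', 2 * (r + n)) = some b' ∧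
      (n = 0 ∧ a' = a ∧ b' = b ∨ n ≠ 0 ∧ a.state.Mono a'.state ∧ b.state.Mono b'.state) := by
    intro n
    induction n with
    | zero => exact fun _ => ⟨a, b, by simpa using ha, by simpa using hb, Or.inl ⟨rfl, rfl, rfl⟩⟩
    | succ n ih =>
      intro hn
      push_cast at hn
      obtain ⟨a', b', ha', hb', hab⟩ := ih (by omega)
      obtain ⟨x, u, v, hx, hu, hv, k1, n1⟩ := lower X Y hX hsX h h' (r + n) (by omega) (by omega)
      obtain ⟨y, u', v', hy, hu', hv', k1', n1'⟩ :=
        lower Y X hY hsY h.symm h'.symm (r + n) (by omega) (by omega)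
      have hxc : x = c := by
        by_contra hxc
        obtain rfl : x = c' := by omega
        exact hdis hu hb'
      have hyc : y = c' := by
        by_contra hyc
        obtain rfl : y = c := by omega
        exact hdis ha' hu'
      subst hxc hyc
      obtain ⟨x', p, q, hx', hp, hq, k2, n2⟩ :=
        upper X Y hX hsX h h' (r + n) (by omega) (by omega)
      obtain ⟨y', p', q', hy', hp', hq', k2', n2'⟩ :=
        upper Y X hY hsY h.symm h'.symm (r + n) (by omega) (by omega)
      have hxx : x' = x := by
        by_contra hxc
        obtain rfl : x' = y := by omega
        exact hdis hp hv'
      have hyy : y' = y := by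
        by_contra hyc
        obtain rfl : y' = x := by omega
        exact hdis hv hp'
      subst hxx hyy
      have m1 := mono_of_bonds hX hu hv hp hx k1 n1 k2 n2
      have m2 := mono_of_bonds hY hu' hv' hp' hy k1' n1' k2' n2'
      rw [hu] at ha'
      rw [hu'] at hb'
      obtain rfl := Option.some_injective _ ha'
      obtain rfl := Option.some_injective _ hb'
      refine ⟨q, q', ?_, ?_, Or.inr ⟨by omega, ?_⟩⟩
      · rw [← hq]; congr 2; push_cast; ring
      · rw [← hq']; congr 2; push_cast; ring
      · rcases hab with ⟨-, rfl, rfl⟩ | ⟨-, h1, h2⟩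
        exacts [⟨m1, m2⟩, ⟨h1.trans m1, h2.trans m2⟩]
  obtain ⟨a', b', ha', hb', hab⟩ := key (r' - r).toNat (by omega)
  rw [show r + ((r' - r).toNat : ℤ) = r' by omega] at ha' hb'
  rcases hab with ⟨h0, -⟩ | ⟨-, h1, h2⟩
  · omega
  · exact ⟨a', b, b', ha, ha', h1, hb, hb', h2⟩

/-- A rung whose plug belongs to the assembly that runs along the other backbone would be cut off
from it. -/
theorem left_plug_of_column (hτ : 0 < τ) (hY : Aligned Y)
    (hsX : (macroSystem τ δ).Stable X) (hsY : (macroSystem τ δ).Stable Y)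
    (hd : Disjoint (dom X) (dom Y)) {r : ℤ} (h : Facing X Y r)
    {a b : MacroTile} (ha : X (1, 2 * r) = some a) (hb : Y (10, 2 * r) = some b) :
    ∃ s s' : State, s.extLeft = s'.extRight ∧
      X (5, 2 * r + 1) = some (plug true s) ∧ Y (6, 2 * r + 1) = some (plug false s') := by
  obtain ⟨s, s', he, h | ⟨h5, h6⟩⟩ := h
  · exact ⟨s, s', he, h⟩
  exfalso
  have hdis : ∀ {z u v}, X z = some u → Y z = some v → False := fun hu hv =>
    Set.disjoint_left.1 hd (mem_dom_of_eq hu) (mem_dom_of_eq hv)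
  have h6' := main_of_plug hτ hsX h6 ⟨_, mem_dom_of_eq ha, by simp⟩
  norm_num [Dir.vec] at h6'
  obtain ⟨c, v, v', hc, ⟨h1, h2, h3, h4⟩ | ⟨-, h2, -⟩⟩ := exists_bond_rung (r := r) (lo := 2)
    (hi := 5) hτ hY hsY le_rfl (by norm_num) (mem_dom_of_eq h5) (by simp) (mem_dom_of_eq hb)
    (Or.inr (by simp))
  · obtain ⟨e1, k, e2⟩ := hY.eq h1
    obtain ⟨f1, -⟩ := state_eq_of_kind_west h4 h3 (by rw [← e1]; norm_num)
    simp only [f1] at e2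
    obtain rfl : c = 2 * r := by omega
    exact hdis ha h2
  · rcases hc with rfl | rfl
    · exact hdis h6' h2
    · exact hdis h6 h2

/-- Two assemblies have at most one pair of matching plugs. -/
theorem Facing.unique (hτ : 0 < τ) (hX : Aligned X) (hY : Aligned Y)
    (hsX : (macroSystem τ δ).Stable X) (hsY : (macroSystem τ δ).Stable Y)
    (hd : Disjoint (dom X) (dom Y)) {r r' : ℤ} (h : Facing X Y r) (h' : Facing X Y r') :
    r = r' := by
  -- the case that `P` runs along the left backbone and `Q` along the right one
  have main : ∀ P Q : Assembly MacroTile, Aligned P → Aligned Q → (macroSystem τ δ).Stable P →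
      (macroSystem τ δ).Stable Q → Disjoint (dom P) (dom Q) → ∀ k k' : ℤ, Facing P Q k →
      Facing P Q k' → ∀ a a' b b' : MacroTile,
      P (1, 2 * k) = some a → P (1, 2 * k') = some a' → a.state.Mono a'.state →
      Q (10, 2 * k) = some b → Q (10, 2 * k') = some b' → b.state.Mono b'.state → False := by
    intro P Q hP hQ hsP hsQ hPQ k k' hf hf' a a' b b' ha ha' hm hb hb' hm'
    have hdis : ∀ {z u v}, P z = some u → Q z = some v → False := fun hu hv =>
      Set.disjoint_left.1 hPQ (mem_dom_of_eq hu) (mem_dom_of_eq hv)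
    -- the plugs show the states of the backbones
    have states : ∀ (j : ℤ) (a b : MacroTile), Facing P Q j → P (1, 2 * j) = some a →
        Q (10, 2 * j) = some b → a.state.extLeft = b.state.extRight := by
      intro j a b hj ha hb
      obtain ⟨s, s', he, h5, h6⟩ := left_plug_of_column hτ hQ hsP hsQ hPQ hj ha hb
      have h5' := main_of_plug hτ hsP h5 ⟨_, mem_dom_of_eq ha, by simp⟩
      have h6' := main_of_plug hτ hsQ h6 ⟨_, mem_dom_of_eq hb, by simp⟩
      norm_num [Dir.vec] at h5' h6'
      rw [← state_left_rung hτ hP hsP h5 ha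
          (Option.eq_none_iff_forall_ne_some.2 fun u hu => hdis hu h6')
          (Option.eq_none_iff_forall_ne_some.2 fun u hu => hdis hu h6),
        ← state_right_rung hτ hQ hsQ h6 hb
          (Option.eq_none_iff_forall_ne_some.2 fun u hu => hdis h5' hu)
          (Option.eq_none_iff_forall_ne_some.2 fun u hu => hdis h5 hu)]
      exact he
    exact hm.not_ext hm' (states k a b hf ha hb) (states k' a' b' hf' ha' hb')
  have main' : ∀ k k' : ℤ, k < k' → Facing X Y k → Facing X Y k' → False := by
    intro k k' hk hf hf'
    obtain ⟨c, c', ⟨rfl, rfl⟩ | ⟨rfl, rfl⟩, a, a', b, b', ha, ha', hm, hb, hb', hm'⟩ :=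
      exists_columns hτ hX hY hsX hsY hd hk hf hf'
    · exact main X Y hX hY hsX hsY hd k k' hf hf' a a' b b' ha ha' hm hb hb' hm'
    · exact main Y X hY hX hsY hsX hd.symm k k' hf.symm hf'.symm b b' a a' hb hb' hm' ha ha' hm
  rcases lt_trichotomy r r' with hlt | heq | hlt
  · exact (main' _ _ hlt h h').elim
  · exact heq
  · exact (main' _ _ hlt h' h).elim

end Planar

/-! ### From the simulating system to the ladder system -/

section Follow

variable {τ δ : ℕ} {α X Y : Assembly MacroTile}

/-- A bond between main tiles at the ends of two rungs is a bond between the represented tiles. -/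
theorem rung_edge (hX : Aligned X) (hY : Aligned Y) {z : ℤ × ℤ} {d : Dir} {u u' : MacroTile}
    (hz : X z = some u) (hz' : Y (z + d.vec) = some u') (hk : u.kind d = u'.kind d.opp)
    (hr : u.kind d = .rung) :
    (ladderSystem τ).pairBond (repr X (z.1 / 2, z.2 / 2))
        (repr Y ((z.1 / 2, z.2 / 2) + d.vec)) d = 1 ∧
      2 * z.1 = 4 * (z.1 / 2) + 1 + d.vec.1 ∧ z.2 = 2 * (z.2 / 2) := by
  have hr' := hk.symm.trans hr
  rcases kind_eq_rung hr with ⟨s, rfl, rfl⟩ | ⟨s, rfl, rfl⟩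
  · rcases kind_eq_rung hr' with ⟨s', rfl, h⟩ | ⟨s', rfl, -⟩
    · simp [Dir.opp] at h
    obtain ⟨p, hp, -, hrX⟩ := exists_repr_of_main hX hz
    have hp' : (z.1 / 2, z.2 / 2) = p := by
      rw [hp]; ext <;> simp only [mainCell, side] <;> omega
    have hrY : repr Y (p + Dir.east.vec) = some B0 := (repr_eq_some hY).2 ⟨s', by
      rw [← hz', hp]
      congr 1
      ext <;> simp [mainCell, side, Dir.vec]
      ring⟩
    rw [hp', hrX, hrY]
    refine ⟨by simp [TAS.pairBond, ladderGlue, Dir.opp], ?_, ?_⟩ <;>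
      (rw [hp]; simp only [mainCell, side, Dir.vec]; omega)
  · rcases kind_eq_rung hr' with ⟨s', rfl, -⟩ | ⟨s', rfl, h⟩
    swap
    · simp [Dir.opp] at h
    obtain ⟨p, hp, -, hrX⟩ := exists_repr_of_main hX hz
    have hp' : (z.1 / 2, z.2 / 2) = p := by
      rw [hp]; ext <;> simp only [mainCell, side] <;> omega
    have hrY : repr Y (p + Dir.west.vec) = some A0 := (repr_eq_some hY).2 ⟨s', by
      rw [← hz', hp]
      congr 1
      ext <;> simp [mainCell, side, Dir.vec]
      ring⟩
    rw [hp', hrX, hrY]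
    refine ⟨by simp [TAS.pairBond, ladderGlue, Dir.opp], ?_, ?_⟩ <;>
      (rw [hp]; simp only [mainCell, side, Dir.vec]; omega)

/-- A bond between plugs joins two facing rungs. -/
theorem facing_of_ext (hX : Aligned X) {z : ℤ × ℤ} {d : Dir} {u u' : MacroTile}
    {e : Bool × Bool} (hz : X z = some u) (hz' : Y (z + d.vec) = some u')
    (hk : u.kind d = u'.kind d.opp) (hr : u.kind d = .ext e) :
    ∃ r : ℤ, z.2 = 2 * r + 1 ∧ Facing X Y r ∧ (z.1 = 5 ∧ d = .east ∨ z.1 = 6 ∧ d = .west) := by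
  have hr' := hk.symm.trans hr
  obtain ⟨e1, r, e2⟩ := hX.eq hz
  rcases kind_eq_ext hr with ⟨s, rfl, h1, rfl⟩ | ⟨s, rfl, h1, rfl⟩
  · rcases kind_eq_ext hr' with ⟨s', -, -, h⟩ | ⟨s', rfl, h2, -⟩
    · simp [Dir.opp] at h
    simp only [pos] at e1 e2
    refine ⟨r, by omega, ⟨s, s', h1.trans h2.symm, Or.inl ⟨?_, ?_⟩⟩, Or.inl ⟨e1, rfl⟩⟩
    · rw [← hz]; congr 1; ext <;> simp <;> omega
    · rw [← hz']; congr 1; ext <;> simp [Dir.vec] <;> omega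
  · rcases kind_eq_ext hr' with ⟨s', rfl, h2, -⟩ | ⟨s', -, -, h⟩
    swap
    · simp [Dir.opp] at h
    simp only [pos] at e1 e2
    refine ⟨r, by omega, ⟨s', s, h2.trans h1.symm, Or.inr ⟨?_, ?_⟩⟩, Or.inr ⟨e1, rfl⟩⟩
    · rw [← hz']; congr 1; ext <;> simp [Dir.vec] <;> omega
    · rw [← hz]; congr 1; ext <;> simp <;> omega

/-- If two stable assemblies are bonded at temperature `τ + δ`, then so are the represented
assemblies at temperature `τ`: without a strong bond, the additional strength `δ` is available at
most once, so that at least `τ` pairs of rungs meet. -/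
theorem repr_bonded (hτ : 0 < τ) (hX : Aligned X) (hY : Aligned Y)
    (hsX : (macroSystem τ δ).Stable X) (hsY : (macroSystem τ δ).Stable Y)
    (hnX : (dom (repr X)).Nonempty) (hnY : (dom (repr Y)).Nonempty)
    (hd : Disjoint (dom X) (dom Y)) (h : (macroSystem τ δ).Bonded X Y) :
    (ladderSystem τ).Bonded (repr X) (repr Y) := by
  classical
  by_contra hno
  obtain ⟨F, hF, hsum⟩ := h.exists_finset
  let P : (ℤ × ℤ) × Dir → Prop := fun e => ∃ u, X e.1 = some u ∧ u.kind e.2 = .rung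
  have hrung : ∀ e ∈ F.filter P, ∃ u u', X e.1 = some u ∧ Y (e.1 + e.2.vec) = some u' ∧
      u.kind e.2 = u'.kind e.2.opp ∧ u.kind e.2 = .rung ∧
      (macroSystem τ δ).pairBond (X e.1) (Y (e.1 + e.2.vec)) e.2 = 1 := by
    intro e he
    obtain ⟨he, v, hv, hvr⟩ := Finset.mem_filter.1 he
    obtain ⟨u, u', hu, hu', hk, hn, hb⟩ := exists_of_macro_pairBond (hF e he)
    obtain rfl := Option.some_injective _ (hv.symm.trans hu)
    exact ⟨v, u', hu, hu', hk, hvr, by rw [hb, hvr]; rfl⟩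
  have hext : ∀ e ∈ F.filter (fun e => ¬ P e), ∃ r : ℤ, e.1.2 = 2 * r + 1 ∧ Facing X Y r ∧
      (e.1.1 = 5 ∧ e.2 = .east ∨ e.1.1 = 6 ∧ e.2 = .west) ∧
      (macroSystem τ δ).pairBond (X e.1) (Y (e.1 + e.2.vec)) e.2 = δ := by
    intro e he
    obtain ⟨he, hP⟩ := Finset.mem_filter.1 he
    obtain ⟨u, u', hu, hu', hk, hn, hb⟩ := exists_of_macro_pairBond (hF e he)
    rcases repr_bonded_or_weak hτ hX hY hsX hsY hnX hnY hd hu hu' hk hn with h | h | ⟨x, h⟩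
    · exact absurd h hno
    · exact absurd ⟨u, hu, h⟩ hP
    · obtain ⟨r, h1, h2, h3⟩ := facing_of_ext hX hu hu' hk h
      exact ⟨r, h1, h2, h3, by rw [hb, h]; rfl⟩
  -- by planarity, at most one edge between plugs counts
  have hcard : (F.filter (fun e => ¬ P e)).card ≤ 1 := by
    refine Finset.card_le_one.2 fun e he e' he' => ?_
    obtain ⟨r, h1, h2, h3, -⟩ := hext e he
    obtain ⟨r', h1', h2', h3', -⟩ := hext e' he'
    have hm := TAS.mem_dom_of_pairBond (hF e (Finset.mem_filter.1 he).1)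
    have hm' := TAS.mem_dom_of_pairBond (hF e' (Finset.mem_filter.1 he').1)
    obtain rfl := h2.unique hτ hX hY hsX hsY hd h2'
    obtain ⟨⟨x, y⟩, d⟩ := e
    obtain ⟨⟨x', y'⟩, d'⟩ := e'
    simp only at h1 h3 h1' h3'
    subst h1 h1'
    rcases h3 with ⟨rfl, rfl⟩ | ⟨rfl, rfl⟩ <;> rcases h3' with ⟨rfl, rfl⟩ | ⟨rfl, rfl⟩
    · rfl
    · have := hm'.1
      have h4 := hm.2
      simp only [Dir.vec, Prod.mk_add_mk] at h4
      norm_num at h4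
      exact absurd h4 (Set.disjoint_left.1 hd this)
    · have := hm'.1
      have h4 := hm.2
      simp only [Dir.vec, Prod.mk_add_mk] at h4
      norm_num at h4
      exact absurd h4 (Set.disjoint_left.1 hd this)
    · rfl
  rw [← Finset.sum_filter_add_sum_filter_not F P] at hsum
  have hs1 : ∑ e ∈ F.filter P, (macroSystem τ δ).pairBond (X e.1) (Y (e.1 + e.2.vec)) e.2 =
      (F.filter P).card := by
    rw [Finset.card_eq_sum_ones]
    exact Finset.sum_congr rfl fun e he => (hrung e he).choose_spec.choose_spec.2.2.2.2
  have hs2 : ∑ e ∈ F.filter (fun e => ¬ P e),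
      (macroSystem τ δ).pairBond (X e.1) (Y (e.1 + e.2.vec)) e.2 ≤ δ := by
    rw [Finset.sum_congr rfl fun e he => (hext e he).choose_spec.2.2.2]
    rw [Finset.sum_const, smul_eq_mul]
    exact (Nat.mul_le_mul_right δ hcard).trans (by simp)
  change τ + δ ≤ _ at hsum
  rw [hs1] at hsum
  apply hno
  refine ⟨(F.filter P).image (fun e => ((e.1.1 / 2, e.1.2 / 2), e.2)), ?_⟩
  rw [Finset.sum_image]
  · rw [Finset.sum_congr rfl (g := fun _ => 1)]
    · change τ ≤ _
      rw [← Finset.card_eq_sum_ones]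
      omega
    · intro e he
      obtain ⟨u, u', hu, hu', hk, hr, -⟩ := hrung e he
      exact (rung_edge hX hY hu hu' hk hr).1
  · intro e he e' he' hee
    obtain ⟨u, u', hu, hu', hk, hr, -⟩ := hrung e he
    obtain ⟨v, v', hv, hv', hk', hr', -⟩ := hrung e' he'
    obtain ⟨-, h1, h2⟩ := rung_edge (τ := τ) hX hY hu hu' hk hr
    obtain ⟨-, h3, h4⟩ := rung_edge (τ := τ) hX hY hv hv' hk' hr'
    simp only [Prod.mk.injEq] at hee
    obtain ⟨⟨h5, h6⟩, h7⟩ := hee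
    refine Prod.ext (Prod.ext ?_ ?_) h7
    · rw [h5, h7] at h1; omega
    · rw [h2, h4, h6]

/-- An assembly that represents nothing is a single link or plug. -/
theorem eq_of_repr_empty (hτ : 0 < τ) (hα : Aligned α) (hs : (macroSystem τ δ).Stable α)
    (hne : ¬ (dom (repr α)).Nonempty) {z y : ℤ × ℤ} (hz : z ∈ dom α) (hy : y ∈ dom α) :
    y = z := by
  have hmain : ∀ z t s, α z ≠ some (main t s) := fun z t s h => by
    obtain ⟨p, -, -, hp⟩ := exists_repr_of_main hα h
    exact hne ⟨p, mem_dom_of_eq hp⟩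
  by_contra hyz
  obtain ⟨⟨t, s⟩ | ⟨t, s⟩ | ⟨b, s⟩, hu⟩ := mem_dom.1 hz
  · exact hmain _ _ _ hu
  · rcases main_of_link hτ hs hu ⟨y, hy, hyz⟩ with h | ⟨s', h, -⟩
    · exact hmain _ _ _ h
    · exact hmain _ _ _ h
  · exact hmain _ _ _ (main_of_plug hτ hs hu ⟨y, hy, hyz⟩)

theorem repr_union_of_empty (hX : Aligned X) (hY : Aligned Y) (hd : Disjoint (dom X) (dom Y))
    (h : ¬ (dom (repr Y)).Nonempty) : repr (X.union Y) = repr X := by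
  rw [(repr_union hX hY hd).2]
  funext p
  by_cases hp : p ∈ dom (repr X)
  · exact union_apply_of_mem hp
  · rw [union_apply_of_notMem hp, notMem_dom.1 hp]
    exact notMem_dom.1 fun hq => h ⟨p, hq⟩

theorem repr_union_of_empty_left (hX : Aligned X) (hY : Aligned Y)
    (hd : Disjoint (dom X) (dom Y)) (h : ¬ (dom (repr X)).Nonempty) :
    repr (X.union Y) = repr Y := by
  rw [union_comm hd, repr_union_of_empty hY hX hd.symm h]

theorem repr_attaches (hτ : 0 < τ) (hX : Aligned X) (hY : Aligned Y)
    (hsX : (macroSystem τ δ).Stable X) (hsY : (macroSystem τ δ).Stable Y)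
    (hnX : (dom (repr X)).Nonempty) (hnY : (dom (repr Y)).Nonempty)
    (htX : (ladderSystem τ).Stable (repr X)) (htY : (ladderSystem τ).Stable (repr Y))
    (h : (macroSystem τ δ).Attaches X Y) :
    (ladderSystem τ).Attaches (repr X) (repr Y) := by
  refine TAS.attaches_of_bonded htX htY (repr_union hX hY h.1).1
    (repr_bonded hτ hX hY hsX hsY hnX hnY h.1 (h.bonded ?_ ?_))
  · obtain ⟨p, hp⟩ := hnX
    obtain ⟨t, ht⟩ := mem_dom.1 hp
    obtain ⟨s, hs⟩ := exists_main_of_repr ht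
    exact ⟨_, mem_dom_of_eq hs⟩
  · obtain ⟨p, hp⟩ := hnY
    obtain ⟨t, ht⟩ := mem_dom.1 hp
    obtain ⟨s, hs⟩ := exists_main_of_repr ht
    exact ⟨_, mem_dom_of_eq hs⟩

/-- Two aligned assemblies that differ by a translation represent the same supertile. -/
theorem exists_shift_repr {v : ℤ × ℤ} (hX : Aligned X) (hY : Aligned (shift v X))
    (hne : (dom X).Nonempty) : ∃ w : ℤ × ℤ, repr (shift v X) = shift w (repr X) := by
  obtain ⟨z, hz⟩ := hne
  obtain ⟨u, hu⟩ := mem_dom.1 hz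
  obtain ⟨e1, r, e2⟩ := hX.eq hu
  obtain ⟨f1, r', f2⟩ := hY.eq (z := z + v) (u := u) (by rw [shift_apply, add_sub_cancel_right, hu])
  simp only [Prod.fst_add, Prod.snd_add] at f1 f2
  refine ⟨(0, r' - r), ?_⟩
  rw [← repr_shift]
  congr 2
  ext
  · simp; omega
  · simp; omega

theorem repr_single_main (t : LadderTile) (s : State) :
    (dom (repr (singleAt (mainCell t (t.col, 0)) (main t s)))).Nonempty ∧
      repr (singleAt (mainCell t (t.col, 0)) (main t s)) = singleAt (t.col, 0) t := by
  have hal : Aligned (singleAt (mainCell t (t.col, 0)) (main t s)) := by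
    have := alignedAt_singleAt (mainCell t (t.col, 0)) (main t s)
    rwa [show mainCell t (t.col, 0) - (main t s).pos = 0 by simp [mainCell, pos]] at this
  have heq : repr (singleAt (mainCell t (t.col, 0)) (main t s)) = singleAt (t.col, 0) t := by
    refine ext_some fun p t' => ?_
    rw [repr_eq_some hal, singleAt_eq_some]
    constructor
    · rintro ⟨s', h⟩
      obtain ⟨h1, h2⟩ := singleAt_eq_some.1 h
      simp only [main.injEq] at h2
      obtain ⟨rfl, rfl⟩ := h2
      simp only [mainCell, Prod.mk.injEq] at h1
      exact ⟨Prod.ext (by simp; omega) (by simp; omega), rfl⟩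
    · rintro ⟨rfl, rfl⟩
      exact ⟨s, singleAt_eq_some.2 ⟨rfl, rfl⟩⟩
  exact ⟨by rw [heq, dom_singleAt]; exact Set.singleton_nonempty _, heq⟩

/-- The assemblies represented by finitely produced assemblies are finitely produced. -/
theorem repr_finProd (hτ : 0 < τ) (h : (macroSystem τ δ).FinProd α) (hα : Aligned α)
    (hne : (dom (repr α)).Nonempty) : (ladderSystem τ).FinProd (repr α) := by
  have main : ∃ v, Aligned (shift v α) ∧ ((dom (repr (shift v α))).Nonempty →
      (ladderSystem τ).FinProd (repr (shift v α))) := by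
    refine h.induction (P := fun α => ∃ v, Aligned (shift v α) ∧
      ((dom (repr (shift v α))).Nonempty → (ladderSystem τ).FinProd (repr (shift v α)))) ?_ ?_ ?_
    · rintro w α ⟨v, h⟩
      exact ⟨v - w, by simpa using h⟩
    · rintro (⟨t, s⟩ | ⟨t, s⟩ | ⟨b, s⟩)
      · refine ⟨mainCell t (t.col, 0), ?_, fun _ => ?_⟩
        · have := alignedAt_singleAt (mainCell t (t.col, 0)) (MacroTile.main t s)
          rwa [show mainCell t (t.col, 0) - (MacroTile.main t s).pos = 0 by
            simp [mainCell, pos]] at this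
        · have := (repr_single_main t s).2
          rw [singleAt] at this
          rw [this]
          exact TAS.finProd_singleAt _ _
      · refine ⟨(link t s).pos, ?_, fun h => ?_⟩
        · have := alignedAt_singleAt (link t s).pos (link t s)
          rwa [sub_self] at this
        · exfalso
          obtain ⟨p, hp⟩ := h
          obtain ⟨t', ht'⟩ := mem_dom.1 hp
          obtain ⟨s', hs'⟩ := exists_main_of_repr ht'
          have := (singleAt_eq_some.1 hs').2
          simp at this
      · refine ⟨(plug b s).pos, ?_, fun h => ?_⟩
        · have := alignedAt_singleAt (plug b s).pos (plug b s)
          rwa [sub_self] at this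
        · exfalso
          obtain ⟨p, hp⟩ := h
          obtain ⟨t', ht'⟩ := mem_dom.1 hp
          obtain ⟨s', hs'⟩ := exists_main_of_repr ht'
          have := (singleAt_eq_some.1 hs').2
          simp at this
    · rintro α β hα hβ hatt ⟨v, hv, hfα⟩ ⟨w, hw, hfβ⟩
      have hbd := (hatt.bonded hα.nonempty hβ.nonempty).shift v
      have hβv : Aligned (shift v β) := hv.of_bonded hτ (w := v - w) (by
        have := hw.shift (v - w)
        rw [shift_shift, zero_add, sub_add_cancel] at this
        exact this) hbd
      have hatt' := hatt.shift v
      refine ⟨v, by rw [shift_union]; exact hv.union hβv, fun hne => ?_⟩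
      have hfβ' : (dom (repr (shift v β))).Nonempty →
          (ladderSystem τ).FinProd (repr (shift v β)) := by
        intro hne'
        have hsh : shift v β = shift (v - w) (shift w β) := by simp
        obtain ⟨x, hx⟩ := exists_shift_repr (v := v - w) hw (by rwa [← hsh])
          (hβ.shift w).nonempty
        rw [hsh, hx]
        refine TAS.FinProd.shift (hfβ ?_) x
        rw [hsh, hx] at hne'
        obtain ⟨p, hp⟩ := hne'
        exact ⟨_, hp⟩
      rw [shift_union] at hne ⊢
      by_cases h1 : (dom (repr (shift v α))).Nonempty
      · by_cases h2 : (dom (repr (shift v β))).Nonempty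
        · rw [(repr_union hv hβv hatt'.1).2]
          exact (hfα h1).union (hfβ' h2) (repr_attaches hτ hv hβv (hα.shift v).stable
            (hβ.shift v).stable h1 h2 (hfα h1).stable (hfβ' h2).stable hatt')
        · rw [repr_union_of_empty hv hβv hatt'.1 h2]
          exact hfα h1
      · rw [repr_union_of_empty_left hv hβv hatt'.1 h1] at hne ⊢
        exact hfβ' hne
  obtain ⟨v, hv, hf⟩ := main
  have hsh : α = shift (-v) (shift v α) := by simp
  obtain ⟨w, hw⟩ := exists_shift_repr (v := -v) hv (by rwa [← hsh]) (h.shift v).nonempty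
  rw [← hsh] at hw
  rw [hw] at hne ⊢
  refine TAS.FinProd.shift (hf ?_) w
  obtain ⟨p, hp⟩ := hne
  exact ⟨_, hp⟩

theorem repr_isResult {f : ℕ → Assembly MacroTile} (hα : Aligned α) (h : IsResult f α) :
    IsResult (fun i => repr (f i)) (repr α) := by
  have hf : ∀ i, Aligned (f i) := fun i => hα.mono (h.sub i)
  intro p t
  rw [repr_eq_some hα]
  constructor
  · rintro ⟨s, hs⟩
    obtain ⟨i, hi⟩ := (h _ _).1 hs
    exact ⟨i, (repr_eq_some (hf i)).2 ⟨s, hi⟩⟩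
  · rintro ⟨i, hi⟩
    obtain ⟨s, hs⟩ := exists_main_of_repr hi
    exact ⟨s, h.sub i _ _ hs⟩

/-- The assemblies represented by producible assemblies are producible. -/
theorem repr_prod (hτ : 0 < τ) (h : (macroSystem τ δ).Prod α) (hα : Aligned α)
    (hne : (dom (repr α)).Nonempty) : (ladderSystem τ).Prod (repr α) := by
  obtain ⟨f, h0, hf, hr⟩ := TAS.prod_iff.1 h
  have hfa : ∀ i, Aligned (f i) := fun i => hα.mono (hr.sub i)
  have hfp := hf.finProd h0
  have hres := repr_isResult hα hr
  have hsub : ∀ i, Sub (repr (f i)) (repr (f (i + 1))) := fun i => repr_mono (hfa _) (hf.sub i)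
  -- start at a stage at which something is represented
  obtain ⟨p, hp⟩ := hne
  obtain ⟨t, ht⟩ := mem_dom.1 hp
  obtain ⟨k, hk⟩ := (hres p t).1 ht
  have hnek : ∀ i, (dom (repr (f (k + i)))).Nonempty := fun i =>
    ⟨p, mem_dom_of_eq (sub_of_le hsub (Nat.le_add_right k i) _ _ hk)⟩
  refine TAS.prod_iff.2 ⟨fun i => repr (f (k + i)), repr_finProd hτ (hfp k) (hfa k) (hnek 0),
    fun i => ?_, hres.tail hsub k⟩
  change repr (f (k + i + 1)) = repr (f (k + i)) ∨ _
  rcases hf (k + i) with he | ⟨β, hβ, hatt, he⟩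
  · left; rw [he]
  · have hβa : Aligned β := (hfa (k + i + 1)).mono (by rw [he]; exact sub_union_right hatt.1)
    by_cases h2 : (dom (repr β)).Nonempty
    · have hβT := repr_finProd hτ hβ hβa h2
      refine Or.inr ⟨repr β, hβT, repr_attaches hτ (hfa _) hβa (hfp _).stable
        (TAS.FinProd.stable hβ) (hnek i) h2 (repr_finProd hτ (hfp _) (hfa _) (hnek i)).stable
        hβT.stable hatt, ?_⟩
      change repr (f (k + i + 1)) = _
      rw [he, (repr_union (hfa _) hβa hatt.1).2]
    · left
      rw [he, repr_union_of_empty (hfa _) hβa hatt.1 h2]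

theorem superRepr_union_empty {a b c : Set (Assembly MacroTile)} (hτ : 0 < τ)
    (ha : a ∈ (macroSystem τ δ).Producible) (hb : b ∈ (macroSystem τ δ).Producible)
    (hea : superRepr 2 macroRepr a = ∅) (heb : superRepr 2 macroRepr b = ∅)
    (hc : c ∈ (macroSystem τ δ).Combine a b) : superRepr 2 macroRepr c = ∅ := by
  obtain ⟨α, rfl, hα, haα⟩ := exists_aligned hτ ha
  obtain ⟨β, rfl, hβ, haβ⟩ := exists_aligned hτ hb
  rw [superRepr_eq_empty_iff haα] at hea
  rw [superRepr_eq_empty_iff haβ] at heb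
  obtain ⟨_, ⟨v, rfl⟩, _, ⟨w, rfl⟩, hatt, rfl⟩ := hc
  ext γ
  simp only [Set.mem_empty_iff_false, iff_false]
  rintro ⟨⟨p, hp⟩, _, ⟨x, rfl⟩, rfl⟩
  obtain ⟨t, ht⟩ := mem_dom.1 hp
  obtain ⟨s, hs⟩ := exists_main_of_repr ht
  rw [shift_apply] at hs
  rcases union_eq_some.1 hs with h | ⟨-, h⟩
  · obtain ⟨q, -, -, hq⟩ := exists_repr_of_main haα h
    exact hea ⟨q, mem_dom_of_eq hq⟩
  · obtain ⟨q, -, -, hq⟩ := exists_repr_of_main haβ h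
    exact heb ⟨q, mem_dom_of_eq hq⟩

/-- Representatives of a combination may be taken to be aligned. -/
theorem exists_aligned_of_mem_combine {a b c : Set (Assembly MacroTile)} (hτ : 0 < τ)
    (ha : a ∈ (macroSystem τ δ).Producible) (hb : b ∈ (macroSystem τ δ).Producible)
    (hc : c ∈ (macroSystem τ δ).Combine a b) :
    ∃ α β, a = supertile α ∧ b = supertile β ∧ c = supertile (α.union β) ∧
      (macroSystem τ δ).Attaches α β ∧ Aligned α ∧ Aligned β ∧
      (macroSystem τ δ).Prod α ∧ (macroSystem τ δ).Prod β := by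
  obtain ⟨α, rfl, hα, haα⟩ := exists_aligned hτ ha
  obtain ⟨β, rfl, hβ, haβ⟩ := exists_aligned hτ hb
  obtain ⟨_, ⟨v, rfl⟩, _, ⟨w, rfl⟩, hatt, rfl⟩ := hc
  have hatt' := hatt.shift (-v)
  simp only [shift_shift, neg_add_cancel, shift_zero] at hatt'
  have hβ' := hβ.shift (-v + w)
  refine ⟨α, shift (-v + w) β, rfl, by simp, ?_, hatt', haα, ?_, hα, hβ'⟩
  · rw [← supertile_shift (-v), shift_union]
    simp
  · exact haα.of_bonded hτ (haβ.shift _) (hatt'.bonded hα.nonempty hβ'.nonempty)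

theorem macro_follows (hτ : 0 < τ) : Follows (macroSystem τ δ) (ladderSystem τ) 2 macroRepr := by
  refine ⟨fun a ha b hb hab hne => ?_, fun a ha b hb hea heb c hc =>
    Or.inl (superRepr_union_empty hτ ha hb hea heb hc)⟩
  obtain ⟨c, hc, hbc⟩ := hab
  obtain ⟨α, γ, rfl, rfl, rfl, hatt, haα, haγ, hα, hγ⟩ := exists_aligned_of_mem_combine hτ ha hc hbc
  have hnα : (dom (repr α)).Nonempty := by
    by_contra h
    exact hne ((superRepr_eq_empty_iff haα).2 h)
  have hnu : (dom (repr (α.union γ))).Nonempty :=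
    hnα.mono (repr_mono (haα.union haγ) (sub_union_left α γ)).dom
  rw [superRepr_of_nonempty haα hnα, superRepr_of_nonempty (haα.union haγ) hnu]
  by_cases hnγ : (dom (repr γ)).Nonempty
  · right
    have hpα := repr_prod hτ hα haα hnα
    have hpγ := repr_prod hτ hγ haγ hnγ
    refine ⟨_, hpγ, repr α, mem_supertile_self _, repr γ, mem_supertile_self _,
      repr_attaches hτ haα haγ hα.stable hγ.stable hnα hnγ hpα.stable hpγ.stable hatt, ?_⟩
    rw [(repr_union haα haγ hatt.1).2]
  · left
    rw [repr_union_of_empty haα haγ hatt.1 hnγ]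

/-- The tiles that do not represent anything are next to a main tile. -/
theorem exists_repr_near (hτ : 0 < τ) (hα : Aligned α) (hs : (macroSystem τ δ).Stable α)
    (hne : (dom (repr α)).Nonempty) {z : ℤ × ℤ} (hz : z ∈ dom α) :
    ∃ u v : ℤ, u ^ 2 + v ^ 2 < 2 ∧ (z.1 / 2 + u, z.2 / 2 + v) ∈ dom (repr α) := by
  obtain ⟨⟨t, s⟩ | ⟨t, s⟩ | ⟨b, s⟩, hu⟩ := mem_dom.1 hz
  · obtain ⟨p, rfl, -, hp⟩ := exists_repr_of_main hα hu
    refine ⟨0, 0, by norm_num, ?_⟩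
    convert mem_dom_of_eq hp using 1
    ext
    · rcases side_cases t with h | h <;> simp only [mainCell, h] <;> omega
    · simp only [mainCell]; omega
  · have key : ∀ t' s', α (z + t.out.opp.vec) = some (main t' s') ∨
        α (z + t.out.vec) = some (main t' s') → t'.side = t.side →
        ∃ u v : ℤ, u ^ 2 + v ^ 2 < 2 ∧ (z.1 / 2 + u, z.2 / 2 + v) ∈ dom (repr α) := by
      rintro t' s' h hside
      obtain ⟨d, hd, h⟩ : ∃ d : Dir, (d = t.out.opp ∨ d = t.out) ∧
          α (z + d.vec) = some (main t' s') := by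
        rcases h with h | h
        exacts [⟨_, Or.inl rfl, h⟩, ⟨_, Or.inr rfl, h⟩]
      obtain ⟨p, hp, -, hpr⟩ := exists_repr_of_main hα h
      have h1 : z.1 + d.vec.1 = 2 * p.1 + t'.side := congrArg Prod.fst hp
      have h2 : z.2 + d.vec.2 = 2 * p.2 := congrArg Prod.snd hp
      have hb : (p.1 - z.1 / 2 = 0 ∧ (p.2 - z.2 / 2 = 0 ∨ p.2 - z.2 / 2 = 1)) ∨
          (p.2 - z.2 / 2 = 0 ∧ (p.1 - z.1 / 2 = 0 ∨ p.1 - z.1 / 2 = 1 ∨ p.1 - z.1 / 2 = -1)) := by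
        rcases side_cases t' with h | h <;> rw [h] at h1 <;> cases d <;>
          simp only [Dir.vec] at h1 h2 <;> omega
      refine ⟨p.1 - z.1 / 2, p.2 - z.2 / 2, ?_, ?_⟩
      · rcases hb with ⟨h, h' | h'⟩ | ⟨h, h' | h' | h'⟩ <;> rw [h, h'] <;> norm_num
      · simpa using mem_dom_of_eq hpr
    rcases main_of_link hτ hs hu (exists_ne_of_repr hne hu (by simp)) with h | ⟨s', h, -⟩
    · exact key _ _ (Or.inl h) rfl
    · exact key _ _ (Or.inr h) (by cases t <;> rfl)
  · obtain ⟨p, hp, -, hpr⟩ := exists_repr_of_main hα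
      (main_of_plug hτ hs hu (exists_ne_of_repr hne hu (by simp)))
    have h1 : z.1 + Dir.south.vec.1 = 2 * p.1 + (rungEnd b).side := congrArg Prod.fst hp
    have h2 : z.2 + Dir.south.vec.2 = 2 * p.2 := congrArg Prod.snd hp
    simp only [Dir.vec] at h1 h2
    refine ⟨0, 0, by norm_num, ?_⟩
    convert mem_dom_of_eq hpr using 1
    ext
    · rcases side_cases (rungEnd b) with h | h <;> rw [h] at h1 <;> simp only <;> omega
    · simp only; omega

theorem mapsCleanly (hτ : 0 < τ) {a : Set (Assembly MacroTile)}
    (ha : a ∈ (macroSystem τ δ).Producible) : MapsCleanly 2 macroRepr a := by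
  obtain ⟨α, rfl, hα, haα⟩ := exists_aligned hτ ha
  by_cases hne : (dom (repr α)).Nonempty
  · refine Or.inr ⟨⟨_, superRepr_of_nonempty haα hne⟩, ?_⟩
    rintro _ ⟨v, rfl⟩ ⟨p, hp⟩
    left
    -- as a main tile is at its place, the translation is even
    obtain ⟨t, ht⟩ := mem_dom.1 hp
    obtain ⟨s, hs⟩ := exists_main_of_repr ht
    obtain ⟨h1, r, h2⟩ := haα.eq hs
    simp only [pos, mainCell, Prod.fst_sub, Prod.snd_sub] at h1 h2
    have hv : v = (2 * (p.1 - t.col, p.2 - r).1, 2 * (p.1 - t.col, p.2 - r).2) := by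
      ext
      · simp; linarith
      · simp; linarith
    generalize (p.1 - t.col, p.2 - r) = w at hv
    subst hv
    change ∀ x y, _ → ∃ u v : ℤ, _ ∧ (x + u, y + v) ∈ dom (repr _)
    rw [repr_shift]
    rintro x y ⟨i, j, hij⟩
    obtain ⟨a, b, hab, hmem⟩ := exists_repr_near hτ haα hα.stable hne (z := _) hij
    refine ⟨a, b, hab, ?_⟩
    rw [mem_dom_shift]
    convert hmem using 1
    ext
    · simp; omega
    · simp; omega
  · refine Or.inl ⟨(superRepr_eq_empty_iff haα).2 hne, α, mem_supertile_self α, ?_⟩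
    rintro x y x' y' ⟨i, j, hij⟩ ⟨i', j', hij'⟩
    have := eq_of_repr_empty hτ haα hα.stable hne (z := _) hij hij'
    simp only [Prod.mk.injEq] at this
    push_cast at this
    omega

end Follow

/-! ### Lifting assemblies of the ladder system -/

/-- In block `p`, the macrotile of `t` in state `s` has the tile `u` at `z`. -/
def IsCell (t : LadderTile) (s : State) (p z : ℤ × ℤ) (u : MacroTile) : Prop :=
  z = mainCell t p ∧ u = main t s ∨ z = mainCell t p + t.out.vec ∧ u = link t s ∨
    ∃ b, t = rungEnd b ∧ z = mainCell t p + Dir.north.vec ∧ u = plug b s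

theorem IsCell.block {t : LadderTile} {s : State} {p z : ℤ × ℤ} {u : MacroTile}
    (h : IsCell t s p z u) : p = (z.1 / 2, z.2 / 2) := by
  rcases h with ⟨rfl, -⟩ | ⟨rfl, -⟩ | ⟨b, rfl, rfl, -⟩
  · ext <;> cases t <;> simp only [mainCell, side] <;> omega
  · ext <;> cases t <;>
      simp only [mainCell, side, out, Dir.vec, Prod.fst_add, Prod.snd_add] <;> omega
  · ext <;> cases b <;>
      simp only [mainCell, side, rungEnd, Dir.vec, Prod.fst_add, Prod.snd_add] <;> omega

theorem IsCell.unique {t : LadderTile} {s : State} {p z : ℤ × ℤ} {u u' : MacroTile}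
    (h : IsCell t s p z u) (h' : IsCell t s p z u') : u = u' := by
  have h0 : ∀ t : LadderTile, t.out.vec ≠ 0 := by
    intro t; cases t <;> simp [out, Dir.vec]
  have h1 : Dir.north.vec ≠ 0 := by simp [Dir.vec]
  have h2 : ∀ b, (rungEnd b).out.vec ≠ Dir.north.vec := by
    intro b; cases b <;> simp [rungEnd, out, Dir.vec]
  rcases h with ⟨rfl, rfl⟩ | ⟨rfl, rfl⟩ | ⟨b, rfl, rfl, rfl⟩ <;>
    rcases h' with ⟨hz, rfl⟩ | ⟨hz, rfl⟩ | ⟨b', hb, hz, rfl⟩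
  · rfl
  · exact absurd (left_eq_add.1 hz) (h0 _)
  · exact absurd (left_eq_add.1 hz) h1
  · exact absurd (add_eq_left.1 hz) (h0 _)
  · rfl
  · subst hb; exact absurd (add_left_cancel hz) (h2 _)
  · exact absurd (add_eq_left.1 hz) h1
  · exact absurd (add_left_cancel hz).symm (h2 _)
  · cases b <;> cases b' <;> simp_all [rungEnd]

open Classical in
/-- The assembly of the simulating system in which every tile of `γ` is replaced by its macrotile,
in the state given by `σ`, except that the cells in `K` are left empty. -/
noncomputable def lift (K : Set (ℤ × ℤ)) (γ : Assembly LadderTile) (σ : ℤ × ℤ → State) :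
    Assembly MacroTile := fun z =>
  if h : ∃ u, z ∉ K ∧ ∃ p t, γ p = some t ∧ IsCell t (σ p) p z u then some h.choose else none

section Lift

variable {τ δ : ℕ} {K : Set (ℤ × ℤ)} {γ X Y : Assembly LadderTile} {σ σ' : ℤ × ℤ → State}

theorem lift_eq_some {z : ℤ × ℤ} {u : MacroTile} :
    lift K γ σ z = some u ↔ z ∉ K ∧ ∃ p t, γ p = some t ∧ IsCell t (σ p) p z u := by
  unfold lift
  constructor
  · intro h
    split_ifs at h with hc
    rw [← Option.some_injective _ h]
    exact hc.choose_spec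
  · intro h
    have hc : ∃ u, z ∉ K ∧ ∃ p t, γ p = some t ∧ IsCell t (σ p) p z u := ⟨u, h⟩
    rw [dif_pos hc]
    obtain ⟨-, p, t, h1, h2⟩ := hc.choose_spec
    obtain ⟨-, p', t', h1', h2'⟩ := h
    obtain rfl := h2.block.trans h2'.block.symm
    obtain rfl := Option.some_injective _ (h1.symm.trans h1')
    rw [h2.unique h2']

theorem lift_main {p : ℤ × ℤ} {t : LadderTile} (h : γ p = some t) (hK : mainCell t p ∉ K) :
    lift K γ σ (mainCell t p) = some (main t (σ p)) :=
  lift_eq_some.2 ⟨hK, p, t, h, Or.inl ⟨rfl, rfl⟩⟩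

theorem lift_link {p : ℤ × ℤ} {t : LadderTile} (h : γ p = some t)
    (hK : mainCell t p + t.out.vec ∉ K) :
    lift K γ σ (mainCell t p + t.out.vec) = some (link t (σ p)) :=
  lift_eq_some.2 ⟨hK, p, t, h, Or.inr (Or.inl ⟨rfl, rfl⟩)⟩

theorem lift_plug {p : ℤ × ℤ} {b : Bool} (h : γ p = some (rungEnd b))
    (hK : mainCell (rungEnd b) p + Dir.north.vec ∉ K) :
    lift K γ σ (mainCell (rungEnd b) p + Dir.north.vec) = some (plug b (σ p)) :=
  lift_eq_some.2 ⟨hK, p, _, h, Or.inr (Or.inr ⟨b, rfl, rfl, rfl⟩)⟩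

theorem lift_congr (h : ∀ p ∈ dom γ, σ p = σ' p) : lift K γ σ = lift K γ σ' := by
  have : ∀ (σ σ' : ℤ × ℤ → State), (∀ p ∈ dom γ, σ p = σ' p) → Sub (lift K γ σ) (lift K γ σ') := by
    intro σ σ' h z u hz
    obtain ⟨h1, p, t, h2, h3⟩ := lift_eq_some.1 hz
    rw [h p (mem_dom_of_eq h2)] at h3
    exact lift_eq_some.2 ⟨h1, p, t, h2, h3⟩
  exact ext_some fun z u => ⟨this σ σ' h z u, this σ' σ (fun p hp => (h p hp).symm) z u⟩

theorem lift_mono (h : Sub X Y) : Sub (lift K X σ) (lift K Y σ) := by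
  intro z u hz
  obtain ⟨h1, p, t, h2, h3⟩ := lift_eq_some.1 hz
  exact lift_eq_some.2 ⟨h1, p, t, h p t h2, h3⟩

theorem block_mem_of_lift {z : ℤ × ℤ} (h : z ∈ dom (lift K γ σ)) :
    (z.1 / 2, z.2 / 2) ∈ dom γ := by
  obtain ⟨u, hu⟩ := mem_dom.1 h
  obtain ⟨-, p, t, h2, h3⟩ := lift_eq_some.1 hu
  rw [← h3.block]
  exact mem_dom_of_eq h2

theorem lift_disjoint (h : Disjoint (dom X) (dom Y)) :
    Disjoint (dom (lift K X σ)) (dom (lift K Y σ')) :=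
  Set.disjoint_left.2 fun _ hp hq =>
    Set.disjoint_left.1 h (block_mem_of_lift hp) (block_mem_of_lift hq)

theorem lift_union (h : Disjoint (dom X) (dom Y)) :
    lift K (X.union Y) σ = (lift K X σ).union (lift K Y σ) := by
  refine ext_some fun z u => ⟨fun hz => ?_, fun hz => ?_⟩
  · obtain ⟨h1, p, t, h2, h3⟩ := lift_eq_some.1 hz
    rcases union_eq_some.1 h2 with h4 | ⟨-, h4⟩
    · exact sub_union_left _ _ _ _ (lift_eq_some.2 ⟨h1, p, t, h4, h3⟩)
    · exact sub_union_right (lift_disjoint h) _ _ (lift_eq_some.2 ⟨h1, p, t, h4, h3⟩)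
  · rcases union_eq_some.1 hz with h4 | ⟨-, h4⟩
    · exact lift_mono (sub_union_left X Y) _ _ h4
    · exact lift_mono (sub_union_right h) _ _ h4

theorem lift_isResult {f : ℕ → Assembly LadderTile} (h : IsResult f γ) :
    IsResult (fun i => lift K (f i) σ) (lift K γ σ) := by
  intro z u
  rw [lift_eq_some]
  constructor
  · rintro ⟨h1, p, t, h2, h3⟩
    obtain ⟨i, hi⟩ := (h p t).1 h2
    exact ⟨i, lift_eq_some.2 ⟨h1, p, t, hi, h3⟩⟩
  · rintro ⟨i, hi⟩
    exact lift_eq_some.1 (lift_mono (h.sub i) _ _ hi)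

theorem mainCell_add (t : LadderTile) (p v : ℤ × ℤ) :
    mainCell t (p + v) = mainCell t p + (2 * v.1, 2 * v.2) := by
  ext <;> simp [mainCell] <;> ring

theorem lift_shift (v : ℤ × ℤ) :
    lift K (shift v γ) (fun p => σ (p - v)) =
      shift (2 * v.1, 2 * v.2) (lift {z | z + (2 * v.1, 2 * v.2) ∈ K} γ σ) := by
  refine ext_some fun z u => ?_
  have hcell : ∀ t s p, IsCell t s p z u ↔
      IsCell t s (p - v) (z - (2 * v.1, 2 * v.2)) u := by
    intro t s p
    have hm : mainCell t (p - v) = mainCell t p - (2 * v.1, 2 * v.2) := by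
      rw [eq_sub_iff_add_eq, ← mainCell_add, sub_add_cancel]
    have h1 : ∀ w : ℤ × ℤ, z - (2 * v.1, 2 * v.2) = mainCell t (p - v) + w ↔
        z = mainCell t p + w := by
      intro w
      rw [hm, sub_add_eq_add_sub, sub_left_inj]
    have h2 : z - (2 * v.1, 2 * v.2) = mainCell t (p - v) ↔ z = mainCell t p := by
      rw [hm, sub_left_inj]
    simp only [IsCell, h1, h2]
  rw [shift_apply, lift_eq_some, lift_eq_some]
  change _ ↔ ¬ (z - (2 * v.1, 2 * v.2) + (2 * v.1, 2 * v.2) ∈ K) ∧ _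
  rw [sub_add_cancel]
  refine and_congr_right fun _ => ⟨?_, ?_⟩
  · rintro ⟨p, t, h1, h2⟩
    exact ⟨p - v, t, h1, (hcell _ _ _).1 h2⟩
  · rintro ⟨p, t, h1, h2⟩
    refine ⟨p + v, t, by rw [shift_apply, add_sub_cancel_right, h1], (hcell _ _ _).2 ?_⟩
    rw [add_sub_cancel_right]
    exact h2

theorem repr_lift (hK : ∀ p t, γ p = some t → mainCell t p ∉ K) : repr (lift K γ σ) = γ := by
  refine ext_some fun p t => ⟨fun h => ?_, fun h => ?_⟩
  · obtain ⟨s, hs⟩ := exists_main_of_repr h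
    obtain ⟨-, q, t', h2, h3⟩ := lift_eq_some.1 hs
    have hq := h3.block
    have hp : ((mainCell t p).1 / 2, (mainCell t p).2 / 2) = p :=
      (IsCell.block (s := s) (t := t) (Or.inl ⟨rfl, rfl⟩)).symm
    rcases h3 with ⟨-, h⟩ | ⟨-, h⟩ | ⟨b, -, -, h⟩
    · simp only [main.injEq] at h
      rw [h.1, ← hp, ← hq, h2]
    · simp at h
    · simp at h
  · have hγp := h
    have hm := lift_main (σ := σ) h (hK p t h)
    simp only [repr, assemblyRepr, macroRepr, Option.or_eq_some_iff, mainOf_eq_some, block]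
    rcases side_cases t with ht | ht
    · right
      refine ⟨?_, isLeft_eq_false.2 ht, σ p, by simpa [mainCell, ht] using hm⟩
      rw [Option.eq_none_iff_forall_ne_some]
      intro t' h'
      obtain ⟨h1, s', h2⟩ := mainOf_eq_some.1 h'
      obtain ⟨-, q, t'', h3, h4⟩ := lift_eq_some.1 h2
      have hq := h4.block
      have hqp : q = p := by
        rw [hq]
        ext
        · simp; omega
        · simp
      rcases h4 with ⟨-, h⟩ | ⟨-, h⟩ | ⟨b, -, -, h⟩
      · simp only [main.injEq] at h
        rw [hqp, hγp, Option.some.injEq, ← h.1] at h3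
        subst h3
        rw [isLeft_eq_true] at h1
        omega
      · simp at h
      · simp at h
    · left
      exact ⟨isLeft_eq_true.2 ht, σ p, by simpa [mainCell, ht] using hm⟩

theorem lift_aligned (hγ : ∀ p t, γ p = some t → p.1 = t.col) : Aligned (lift K γ σ) := by
  intro z u hz
  obtain ⟨-, p, t, h2, h3⟩ := lift_eq_some.1 hz
  have hp := hγ p t h2
  rcases h3 with ⟨rfl, rfl⟩ | ⟨rfl, rfl⟩ | ⟨b, rfl, rfl, rfl⟩
  · exact ⟨by simp [mainCell, pos, hp], p.2, by simp [mainCell, pos]⟩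
  · exact ⟨by simp [mainCell, pos, hp], p.2, by simp [mainCell, pos]; ring⟩
  · cases b
    · exact ⟨by simp [mainCell, pos, hp, rungEnd, col, side, Dir.vec], p.2, by
        simp [mainCell, pos, Dir.vec]; ring⟩
    · exact ⟨by simp [mainCell, pos, hp, rungEnd, col, side, Dir.vec], p.2, by
        simp [mainCell, pos, Dir.vec]; ring⟩

/-- The cells in `K` may be left empty in the macrotiles of `γ`: they are links to neighbours that
are not there. -/
def Admissible (K : Set (ℤ × ℤ)) (γ : Assembly LadderTile) : Prop :=
  ∀ p t, γ p = some t → mainCell t p ∉ K ∧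
    (∀ b, t = rungEnd b → mainCell t p + Dir.north.vec ∉ K) ∧
    (mainCell t p + t.out.vec ∈ K → γ (p + t.out.vec) = none)

theorem Admissible.mono (h : Admissible K Y) (hs : Sub X Y) : Admissible K X := by
  intro p t ht
  obtain ⟨h1, h2, h3⟩ := h p t (hs _ _ ht)
  exact ⟨h1, h2, fun hK => notMem_dom.1 fun hd => notMem_dom.2 (h3 hK) (hs.dom hd)⟩

theorem admissible_empty (γ : Assembly LadderTile) : Admissible ∅ γ := fun _ _ _ =>
  ⟨Set.notMem_empty _, fun _ _ => Set.notMem_empty _, fun h => absurd h (Set.notMem_empty _)⟩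

/-! ### Bonds in the simulating system -/

/-- The states that two neighbouring macrotiles need in order to be bonded. -/
def Compatible (t : LadderTile) (s s' : State) : Prop :=
  (link t s).kind t.out = (main t.nbr s').kind t.out.opp

theorem exists_compatible_right (t : LadderTile) (s : State) : ∃ s', Compatible t s s' := by
  obtain ⟨c, m⟩ := s
  cases t <;> first
    | exact ⟨(c, m), rfl⟩
    | (cases m
       exacts [⟨(c, .lo), rfl⟩, ⟨(c, .hi), rfl⟩, ⟨(c, .hi), rfl⟩])

theorem exists_compatible_left (t : LadderTile) (s' : State) : ∃ s, Compatible t s s' := by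
  obtain ⟨c, m⟩ := s'
  cases t <;> first
    | exact ⟨(c, m), rfl⟩
    | (cases m
       exacts [⟨(c, .lo), rfl⟩, ⟨(c, .lo), rfl⟩, ⟨(c, .hi), rfl⟩])

theorem exists_extRight (s : State) : ∃ s' : State, s.extLeft = s'.extRight := by
  obtain ⟨c, m⟩ := s
  cases m
  exacts [⟨(c, .mid), rfl⟩, ⟨(!c, .lo), rfl⟩, ⟨(c, .mid), rfl⟩]

theorem exists_extLeft (s' : State) : ∃ s : State, s.extLeft = s'.extRight := by
  obtain ⟨c, m⟩ := s'
  cases m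
  exacts [⟨(!c, .mid), by simp [State.extLeft, State.extRight]⟩, ⟨(c, .lo), rfl⟩,
    ⟨(!c, .mid), by simp [State.extLeft, State.extRight]⟩]

theorem bonded_of_link {X Y : Assembly MacroTile} {p : ℤ × ℤ} {t : LadderTile} {s s' : State}
    (h : X (mainCell t p + t.out.vec) = some (link t s))
    (h' : Y (mainCell t.nbr (p + t.out.vec)) = some (main t.nbr s')) (hc : Compatible t s s') :
    (macroSystem τ δ).Bonded X Y := by
  refine TAS.bonded_of_edge (e := (mainCell t p + t.out.vec, t.out)) ?_
  change τ + δ ≤ (macroSystem τ δ).pairBond (X (mainCell t p + t.out.vec))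
    (Y (mainCell t p + t.out.vec + t.out.vec)) t.out
  rw [← mainCell_out, h, h', macro_pairBond_of_kind hc]
  cases t <;> exact le_rfl

theorem bonded_own_link {X Y : Assembly MacroTile} {p : ℤ × ℤ} {t : LadderTile} {s : State}
    (h : X (mainCell t p + t.out.vec) = some (link t s))
    (h' : Y (mainCell t p) = some (main t s)) : (macroSystem τ δ).Bonded X Y := by
  refine TAS.bonded_of_edge (e := (mainCell t p + t.out.vec, t.out.opp)) ?_
  change τ + δ ≤ (macroSystem τ δ).pairBond (X (mainCell t p + t.out.vec))
    (Y (mainCell t p + t.out.vec + t.out.opp.vec)) t.out.opp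
  rw [Dir.vec_opp, add_neg_cancel_right, h, h', macro_pairBond_of_kind, kind_link_opp]
  · exact le_rfl
  · rw [kind_link_opp, Dir.opp_opp, kind_main_out]

theorem bonded_own_plug {X Y : Assembly MacroTile} {p : ℤ × ℤ} {b : Bool} {s : State}
    (h : X (mainCell (rungEnd b) p + Dir.north.vec) = some (plug b s))
    (h' : Y (mainCell (rungEnd b) p) = some (main (rungEnd b) s)) :
    (macroSystem τ δ).Bonded X Y := by
  refine TAS.bonded_of_edge (e := (mainCell (rungEnd b) p + Dir.north.vec, Dir.south)) ?_
  change τ + δ ≤ (macroSystem τ δ).pairBond (X (mainCell (rungEnd b) p + Dir.north.vec))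
    (Y (mainCell (rungEnd b) p + Dir.north.vec + Dir.north.opp.vec)) Dir.south
  rw [Dir.vec_opp, add_neg_cancel_right, h, h', macro_pairBond_of_kind]
  · cases b <;> exact le_rfl
  · cases b <;> rfl

/-- The edge `e` joins the ends of two facing rungs of `X` and `Y`. -/
def IsRung (X Y : Assembly LadderTile) (e : (ℤ × ℤ) × Dir) : Prop :=
  X e.1 = some A0 ∧ Y (e.1 + e.2.vec) = some B0 ∧ e.2 = .east ∨
    X e.1 = some B0 ∧ Y (e.1 + e.2.vec) = some A0 ∧ e.2 = .west

/-- `τ` facing rungs and one pair of matching plugs are enough for a bond. -/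
theorem bonded_of_rungs {X' Y' : Assembly MacroTile}
    (hX : ∀ p t, X p = some t → ∃ s, X' (mainCell t p) = some (main t s))
    (hY : ∀ p t, Y p = some t → ∃ s, Y' (mainCell t p) = some (main t s))
    {F : Finset ((ℤ × ℤ) × Dir)} (hF : ∀ e ∈ F, IsRung X Y e) (hcard : τ ≤ F.card)
    {p q : ℤ × ℤ} {d : Dir} {b : Bool} {s s' : State}
    (hp : X' p = some (plug b s)) (hq : Y' q = some (plug (!b) s')) (hpq : q = p + d.vec)
    (hodd : p.2 % 2 = 1) (hk : (plug b s).kind d = (plug (!b) s').kind d.opp)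
    (he : ∃ e, (plug b s).kind d = .ext e) : (macroSystem τ δ).Bonded X' Y' := by
  classical
  let g : (ℤ × ℤ) × Dir → (ℤ × ℤ) × Dir := fun e =>
    ((2 * e.1.1 + (1 + e.2.vec.1) / 2, 2 * e.1.2), e.2)
  have hone : ∀ e ∈ F,
      (macroSystem τ δ).pairBond (X' (g e).1) (Y' ((g e).1 + (g e).2.vec)) (g e).2 = 1 := by
    rintro ⟨p, d⟩ he
    rcases hF _ he with ⟨h1, h2, h3⟩ | ⟨h1, h2, h3⟩
    · simp only at h1 h2 h3
      subst h3
      obtain ⟨s, hs⟩ := hX _ _ h1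
      obtain ⟨s', hs'⟩ := hY _ _ h2
      have e1 : (g (p, Dir.east)).1 = mainCell A0 p := by
        simp [g, mainCell, side, Dir.vec]
      have e2 : (g (p, Dir.east)).1 + Dir.east.vec = mainCell B0 (p + Dir.east.vec) := by
        rw [e1]
        ext <;> simp [mainCell, side, Dir.vec]
        ring
      change (macroSystem τ δ).pairBond (X' (g (p, Dir.east)).1)
        (Y' ((g (p, Dir.east)).1 + Dir.east.vec)) Dir.east = 1
      rw [e2, e1, hs, hs', macro_pairBond_of_kind rfl]
      rfl
    · simp only at h1 h2 h3
      subst h3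
      obtain ⟨s, hs⟩ := hX _ _ h1
      obtain ⟨s', hs'⟩ := hY _ _ h2
      have e1 : (g (p, Dir.west)).1 = mainCell B0 p := by
        simp [g, mainCell, side, Dir.vec]
      have e2 : (g (p, Dir.west)).1 + Dir.west.vec = mainCell A0 (p + Dir.west.vec) := by
        rw [e1]
        ext <;> simp [mainCell, side, Dir.vec]
        ring
      change (macroSystem τ δ).pairBond (X' (g (p, Dir.west)).1)
        (Y' ((g (p, Dir.west)).1 + Dir.west.vec)) Dir.west = 1
      rw [e2, e1, hs, hs', macro_pairBond_of_kind rfl]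
      rfl
  have hinj : Set.InjOn g F := by
    rintro ⟨⟨x, y⟩, d⟩ - ⟨⟨x', y'⟩, d'⟩ - h
    simp only [g, Prod.mk.injEq] at h
    obtain ⟨⟨h1, h2⟩, rfl⟩ := h
    simp only [Prod.mk.injEq, and_true]
    omega
  have hnot : (p, d) ∉ F.image g := by
    intro hmem
    obtain ⟨e, -, h⟩ := Finset.mem_image.1 hmem
    have : 2 * e.1.2 = p.2 := congrArg (fun x => x.1.2) h
    omega
  refine ⟨insert (p, d) (F.image g), ?_⟩
  rw [Finset.sum_insert hnot, Finset.sum_image hinj, Finset.sum_congr rfl hone]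
  obtain ⟨e, he⟩ := he
  have : (macroSystem τ δ).pairBond (X' p) (Y' (p + d.vec)) d = δ := by
    rw [← hpq, hp, hq, macro_pairBond_of_kind hk, he]
    rfl
  rw [this, ← Finset.card_eq_sum_ones]
  change τ + δ ≤ _
  omega

theorem ladder_match {t t' : LadderTile} {d : Dir}
    (h : ladderGlue τ t d = ladderGlue τ t' d.opp) (hs : (ladderGlue τ t d).strength ≠ 0) :
    d = t.out ∧ t' = t.nbr ∨ d.opp = t'.out ∧ t = t'.nbr ∨
      t = A0 ∧ t' = B0 ∧ d = .east ∨ t = B0 ∧ t' = A0 ∧ d = .west := by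
  have hl := congrArg Glue.label h
  cases t <;> cases d <;> simp only [ladderGlue, ne_eq, not_true_eq_false] at hs <;> cases t' <;>
    simp [ladderGlue, Dir.opp] at hl h <;> simp [out, nbr, Dir.opp]

/-- The possible reasons for a bond in the ladder system. -/
theorem ladder_bonded_cases (h : (ladderSystem τ).Bonded X Y) :
    (∃ p t, X p = some t ∧ Y (p + t.out.vec) = some t.nbr) ∨
      (∃ p t, Y p = some t ∧ X (p + t.out.vec) = some t.nbr) ∨
      ∃ F : Finset ((ℤ × ℤ) × Dir), (∀ e ∈ F, IsRung X Y e) ∧ τ ≤ F.card := by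
  obtain ⟨F, hF, hsum⟩ := h.exists_finset
  by_cases h1 : ∃ p t, X p = some t ∧ Y (p + t.out.vec) = some t.nbr
  · exact Or.inl h1
  by_cases h2 : ∃ p t, Y p = some t ∧ X (p + t.out.vec) = some t.nbr
  · exact Or.inr (Or.inl h2)
  have hr : ∀ e ∈ F, IsRung X Y e := by
    intro e he
    obtain ⟨t, t', ht, ht', hg, hs⟩ := TAS.exists_of_pairBond_pos (hF e he)
    rcases ladder_match hg hs with ⟨h3, rfl⟩ | ⟨h3, rfl⟩ | ⟨rfl, rfl, h3⟩ | ⟨rfl, rfl, h3⟩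
    · exact absurd ⟨_, _, ht, h3 ▸ ht'⟩ h1
    · exact absurd ⟨_, _, ht', by rw [← h3]; simpa using ht⟩ h2
    · exact Or.inl ⟨ht, ht', h3⟩
    · exact Or.inr ⟨ht, ht', h3⟩
  refine Or.inr (Or.inr ⟨F, hr, ?_⟩)
  rw [Finset.card_eq_sum_ones]
  refine le_trans (b := _) hsum (Finset.sum_le_sum fun e he => ?_)
  rcases hr e he with ⟨h3, h4, h5⟩ | ⟨h3, h4, h5⟩ <;> rw [h3, h4, h5] <;>
    simp [TAS.pairBond, ladderGlue, Dir.opp]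

/-! ### Producing lifts -/

/-- The state of any one macrotile of a lift can be prescribed. -/
def Liftable (τ δ : ℕ) (γ : Assembly LadderTile) : Prop :=
  ∀ K q s, Admissible K γ → q ∈ dom γ →
    ∃ σ : ℤ × ℤ → State, σ q = s ∧ (macroSystem τ δ).FinProd (lift K γ σ)

/-- Whatever the states in `X` are, the states in `γ` can be chosen such that the lifts of `X` and
`γ` are bonded if `X` and `γ` are. -/
theorem Liftable.exists_bonded (hτ : 0 < τ) (hγ : Liftable τ δ γ)
    (hd : Disjoint (dom X) (dom γ)) (hb : (ladderSystem τ).Bonded X γ)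
    (hK : Admissible K (X.union γ)) (σ : ℤ × ℤ → State) :
    ∃ σ' : ℤ × ℤ → State, (∀ p ∈ dom X, σ' p = σ p) ∧
      (macroSystem τ δ).FinProd (lift K γ σ') ∧
      (macroSystem τ δ).Bonded (lift K X σ') (lift K γ σ') := by
  classical
  have sX := sub_union_left X γ
  have sγ := sub_union_right hd
  have hKγ := hK.mono sγ
  -- extend the choice of a state at one point `q` of `γ`
  have extend : ∀ q ∈ dom γ, ∀ s, ∃ σ' : ℤ × ℤ → State, (∀ p ∈ dom X, σ' p = σ p) ∧ σ' q = s ∧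
      (macroSystem τ δ).FinProd (lift K γ σ') := by
    intro q hq s
    obtain ⟨ρ, hρ, hf⟩ := hγ K q s hKγ hq
    refine ⟨fun p => if p ∈ dom X then σ p else ρ p, fun p hp => if_pos hp, ?_, ?_⟩
    · change (if q ∈ dom X then σ q else ρ q) = s
      rw [if_neg (fun h => Set.disjoint_left.1 hd h hq), hρ]
    · rw [lift_congr (σ' := ρ)]
      · exact hf
      · exact fun p hp => if_neg (fun h => Set.disjoint_left.1 hd h hp)
  rcases ladder_bonded_cases hb with ⟨p, t, h1, h2⟩ | ⟨p, t, h1, h2⟩ | ⟨F, hF, hcard⟩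
  · obtain ⟨s', hs'⟩ := exists_compatible_right t (σ p)
    obtain ⟨σ', e1, e2, hf⟩ := extend _ (mem_dom_of_eq h2) s'
    refine ⟨σ', e1, hf, bonded_of_link (lift_link h1 fun hmem => ?_)
      (lift_main h2 (hK _ _ (sγ _ _ h2)).1) ?_⟩
    · have := (hK _ _ (sX _ _ h1)).2.2 hmem
      rw [sγ _ _ h2] at this
      simp at this
    · rw [e1 p (mem_dom_of_eq h1), e2]
      exact hs'
  · obtain ⟨s, hs⟩ := exists_compatible_left t (σ (p + t.out.vec))
    obtain ⟨σ', e1, e2, hf⟩ := extend _ (mem_dom_of_eq h1) s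
    refine ⟨σ', e1, hf, (bonded_of_link (lift_link h1 fun hmem => ?_)
      (lift_main h2 (hK _ _ (sX _ _ h2)).1) ?_).symm⟩
    · have := (hK _ _ (sγ _ _ h1)).2.2 hmem
      rw [sX _ _ h2] at this
      simp at this
    · rw [e1 _ (mem_dom_of_eq h2), e2]
      exact hs
  · obtain ⟨⟨p, d⟩, he⟩ := Finset.card_pos.1 (hτ.trans_le hcard)
    have mX : ∀ (ρ : ℤ × ℤ → State) p t, X p = some t →
        ∃ s, lift K X ρ (mainCell t p) = some (main t s) := fun ρ p t h =>
      ⟨_, lift_main h (hK _ _ (sX _ _ h)).1⟩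
    have mγ : ∀ (ρ : ℤ × ℤ → State) p t, γ p = some t →
        ∃ s, lift K γ ρ (mainCell t p) = some (main t s) := fun ρ p t h =>
      ⟨_, lift_main h (hK _ _ (sγ _ _ h)).1⟩
    rcases hF _ he with ⟨h1, h2, h3⟩ | ⟨h1, h2, h3⟩
    · simp only at h1 h2 h3
      subst h3
      obtain ⟨s', hs'⟩ := exists_extRight (σ p)
      obtain ⟨σ', e1, e2, hf⟩ := extend _ (mem_dom_of_eq h2) s'
      refine ⟨σ', e1, hf, bonded_of_rungs (d := .east) (b := true) (mX σ') (mγ σ') hF hcard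
        (lift_plug (b := true) h1 ((hK _ _ (sX _ _ h1)).2.1 true rfl))
        (lift_plug (b := false) h2 ((hK _ _ (sγ _ _ h2)).2.1 false rfl)) ?_ ?_ ?_ ⟨_, rfl⟩⟩
      · ext <;> simp [mainCell, rungEnd, side, Dir.vec]
        ring
      · simp [mainCell, Dir.vec]
      · rw [e1 p (mem_dom_of_eq h1), e2]
        exact congrArg GlueKind.ext hs'
    · simp only at h1 h2 h3
      subst h3
      obtain ⟨s', hs'⟩ := exists_extLeft (σ p)
      obtain ⟨σ', e1, e2, hf⟩ := extend _ (mem_dom_of_eq h2) s'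
      refine ⟨σ', e1, hf, bonded_of_rungs (d := .west) (b := false) (mX σ') (mγ σ') hF hcard
        (lift_plug (b := false) h1 ((hK _ _ (sX _ _ h1)).2.1 false rfl))
        (lift_plug (b := true) h2 ((hK _ _ (sγ _ _ h2)).2.1 true rfl)) ?_ ?_ ?_ ⟨_, rfl⟩⟩
      · ext <;> simp [mainCell, rungEnd, side, Dir.vec]
        ring
      · simp [mainCell, Dir.vec]
      · rw [e1 p (mem_dom_of_eq h1), e2]
        exact congrArg GlueKind.ext hs'.symm

theorem Liftable.shift (h : Liftable τ δ γ) (v : ℤ × ℤ) :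
    Liftable τ δ (Assembly.shift v γ) := by
  intro K q s hK hq
  obtain ⟨σ, h1, h2⟩ := h {z | z + (2 * v.1, 2 * v.2) ∈ K} (q - v) s (by
    intro p t ht
    obtain ⟨k1, k2, k3⟩ := hK (p + v) t (by rw [shift_apply, add_sub_cancel_right, ht])
    rw [mainCell_add] at k1 k2 k3
    refine ⟨k1, fun b hb => ?_, fun hmem => ?_⟩
    · have := k2 b hb
      rw [add_right_comm] at this
      exact this
    · rw [add_right_comm] at k3
      have := k3 hmem
      rwa [shift_apply, add_right_comm, add_sub_cancel_right] at this) hq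
  exact ⟨fun p => σ (p - v), h1, by rw [lift_shift]; exact h2.shift _⟩

theorem liftable_single (t : LadderTile) : Liftable τ δ (single t) := by
  intro K q s hK hq
  refine ⟨fun _ => s, rfl, ?_⟩
  have hsingle : ∀ p t', single t p = some t' ↔ p = 0 ∧ t = t' := by
    intro p t'
    have := singleAt_eq_some (z := 0) (p := p) (t := t) (u := t')
    rwa [singleAt, shift_zero] at this
  obtain ⟨hK1, hK2, -⟩ := hK 0 t ((hsingle 0 t).2 ⟨rfl, rfl⟩)
  have hlift : ∀ z u, lift K (single t) (fun _ => s) z = some u ↔ z ∉ K ∧ IsCell t s 0 z u := by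
    intro z u
    rw [lift_eq_some]
    refine and_congr_right fun _ => ⟨?_, fun h => ⟨0, t, (hsingle 0 t).2 ⟨rfl, rfl⟩, h⟩⟩
    rintro ⟨p, t', h1, h2⟩
    obtain ⟨rfl, rfl⟩ := (hsingle _ _).1 h1
    exact h2
  have hne : ∀ d : Dir, mainCell t 0 + d.vec ≠ mainCell t 0 := fun d h => by
    have := add_eq_left.1 h
    cases d <;> simp [Dir.vec] at this
  -- the main tile, then the link unless its cell is in `K`
  have step1 : ∃ α, (macroSystem τ δ).FinProd α ∧ ∀ z u, α z = some u ↔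
      z ∉ K ∧ (z = mainCell t 0 ∧ u = main t s ∨ z = mainCell t 0 + t.out.vec ∧ u = link t s) := by
    have h0 := TAS.finProd_singleAt (S := macroSystem τ δ) (mainCell t 0) (main t s)
    by_cases hmem : mainCell t 0 + t.out.vec ∈ K
    · refine ⟨_, h0, fun z u => ?_⟩
      rw [singleAt_eq_some]
      constructor
      · rintro ⟨rfl, rfl⟩; exact ⟨hK1, Or.inl ⟨rfl, rfl⟩⟩
      · rintro ⟨hz, ⟨rfl, rfl⟩ | ⟨rfl, rfl⟩⟩
        exacts [⟨rfl, rfl⟩, absurd hmem hz]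
    · have hcell : mainCell t 0 + t.out.vec ∉ dom (singleAt (mainCell t 0) (main t s)) := by
        rw [dom_singleAt]; exact hne _
      refine ⟨_, h0.union (TAS.finProd_singleAt (mainCell t 0 + t.out.vec) (link t s))
        (TAS.attaches_of_bonded h0.stable (TAS.stable_singleAt _ _)
          (by rw [dom_singleAt, dom_singleAt]; exact Set.disjoint_singleton.2 (hne _).symm)
          (bonded_own_link (singleAt_eq_some.2 ⟨rfl, rfl⟩)
            (singleAt_eq_some.2 ⟨rfl, rfl⟩)).symm), fun z u => ?_⟩
      rw [union_singleAt_eq_some hcell, singleAt_eq_some]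
      constructor
      · rintro (⟨rfl, rfl⟩ | ⟨rfl, rfl⟩)
        exacts [⟨hK1, Or.inl ⟨rfl, rfl⟩⟩, ⟨hmem, Or.inr ⟨rfl, rfl⟩⟩]
      · rintro ⟨hz, ⟨rfl, rfl⟩ | ⟨rfl, rfl⟩⟩
        exacts [Or.inl ⟨rfl, rfl⟩, Or.inr ⟨rfl, rfl⟩]
  obtain ⟨α, hα, hα'⟩ := step1
  by_cases hb : ∃ b, t = rungEnd b
  · obtain ⟨b, rfl⟩ := hb
    have hcell : mainCell (rungEnd b) 0 + Dir.north.vec ∉ dom α := by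
      intro h
      obtain ⟨u, hu⟩ := mem_dom.1 h
      rcases ((hα' _ _).1 hu).2 with ⟨h, -⟩ | ⟨h, -⟩
      · exact hne _ h
      · cases b <;> simp [rungEnd, out, Dir.vec] at h
    have := hα.union (TAS.finProd_singleAt (mainCell (rungEnd b) 0 + Dir.north.vec) (plug b s))
      (TAS.attaches_of_bonded hα.stable (TAS.stable_singleAt _ _)
        (by rw [dom_singleAt]; exact Set.disjoint_singleton_right.2 hcell)
        (bonded_own_plug (singleAt_eq_some.2 ⟨rfl, rfl⟩)
          ((hα' _ _).2 ⟨hK1, Or.inl ⟨rfl, rfl⟩⟩)).symm)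
    convert this using 1
    refine ext_some fun z u => ?_
    rw [union_singleAt_eq_some hcell, hα', hlift]
    constructor
    · rintro ⟨hz, h | h | ⟨b', hb', rfl, rfl⟩⟩
      · exact Or.inl ⟨hz, Or.inl h⟩
      · exact Or.inl ⟨hz, Or.inr h⟩
      · obtain rfl : b = b' := by
          cases b <;> cases b' <;> first | rfl | exact absurd hb' (by simp [rungEnd])
        exact Or.inr ⟨rfl, rfl⟩
    · rintro (⟨hz, h | h⟩ | ⟨rfl, rfl⟩)
      · exact ⟨hz, Or.inl h⟩
      · exact ⟨hz, Or.inr (Or.inl h)⟩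
      · exact ⟨hK2 b rfl, Or.inr (Or.inr ⟨b, rfl, rfl, rfl⟩)⟩
  · convert hα using 1
    refine ext_some fun z u => ?_
    rw [hα', hlift]
    refine and_congr_right fun _ => ⟨?_, ?_⟩
    · rintro (h | h | ⟨b, h, -⟩)
      exacts [Or.inl h, Or.inr h, absurd ⟨b, h⟩ hb]
    · rintro (h | h)
      exacts [Or.inl h, Or.inr (Or.inl h)]

/-- Finitely produced assemblies of the ladder system can be lifted. -/
theorem liftable_of_finProd (hτ : 0 < τ) (h : (ladderSystem τ).FinProd γ) : Liftable τ δ γ := by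
  refine h.induction (P := Liftable τ δ) (fun v α hα => hα.shift v) liftable_single ?_
  -- it suffices to prescribe the state of a tile of the first part
  have key : ∀ α β : Assembly LadderTile, (ladderSystem τ).FinProd α → (ladderSystem τ).FinProd β →
      (ladderSystem τ).Attaches α β → Liftable τ δ α → Liftable τ δ β →
      ∀ K q s, Admissible K (α.union β) → q ∈ dom α →
      ∃ σ : ℤ × ℤ → State, σ q = s ∧ (macroSystem τ δ).FinProd (lift K (α.union β) σ) := by
    intro α β hα hβ hatt hlα hlβ K q s hK hq
    obtain ⟨σ, hσ, hf⟩ := hlα K q s (hK.mono (sub_union_left α β)) hq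
    obtain ⟨σ', h1, h2, h3⟩ :=
      hlβ.exists_bonded hτ hatt.1 (hatt.bonded hα.nonempty hβ.nonempty) hK σ
    refine ⟨σ', (h1 q hq).trans hσ, ?_⟩
    rw [← lift_congr (σ := σ') h1] at hf
    rw [lift_union hatt.1]
    exact hf.union h2 (TAS.attaches_of_bonded hf.stable h2.stable (lift_disjoint hatt.1) h3)
  intro α β hα hβ hatt hlα hlβ K q s hK hq
  by_cases hqα : q ∈ dom α
  · exact key α β hα hβ hatt hlα hlβ K q s hK hqα
  · have hc := union_comm hatt.1
    have hqβ : q ∈ dom β := by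
      rw [dom_union] at hq
      exact hq.resolve_left hqα
    rw [hc] at hK ⊢
    refine key β α hβ hα ⟨hatt.1.symm, ?_⟩ hlβ hlα K q s hK hqβ
    rw [← hc]
    exact hatt.2

/-- Producible assemblies of the ladder system can be lifted, and the state of any one macrotile
can be prescribed. -/
theorem exists_prod_lift (hτ : 0 < τ) (h : (ladderSystem τ).Prod γ) {q : ℤ × ℤ} (s : State)
    (hK : Admissible K γ) (hq : q ∈ dom γ) :
    ∃ σ : ℤ × ℤ → State, σ q = s ∧ (macroSystem τ δ).Prod (lift K γ σ) := by
  classical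
  obtain ⟨f, h0, hf, hr⟩ := TAS.prod_iff.1 h
  -- start at a stage at which `q` is present, and choose the states of each new part such that it is
  -- bonded to the lift of the previous stage, whose states are kept
  obtain ⟨t, ht⟩ := mem_dom.1 hq
  obtain ⟨k, hk⟩ := (hr q t).1 ht
  let g : ℕ → Assembly LadderTile := fun i => f (k + i)
  have hg : ∀ i, Sub (g i) (g (i + 1)) := fun i => hf.sub (k + i)
  have hgr : IsResult g γ := hr.tail hf.sub k
  have hgK : ∀ i, Admissible K (g i) := fun i => hK.mono (hgr.sub i)
  have hgf : ∀ i, (ladderSystem τ).FinProd (g i) := fun i => hf.finProd h0 _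
  obtain ⟨σ0, hσ0, hf0⟩ := liftable_of_finProd (δ := δ) hτ (hgf 0) K q s (hgK 0) (mem_dom_of_eq hk)
  have step : ∀ i (σ : ℤ × ℤ → State), ∃ σ' : ℤ × ℤ → State, (∀ p ∈ dom (g i), σ' p = σ p) ∧
      (g (i + 1) = g i ∨ ∃ β, (macroSystem τ δ).FinProd (lift K β σ') ∧
        (macroSystem τ δ).Bonded (lift K (g i) σ') (lift K β σ') ∧
        Disjoint (dom (g i)) (dom β) ∧ g (i + 1) = (g i).union β) := by
    intro i σ
    rcases hf (k + i) with he | ⟨β, hβ, hatt, he⟩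
    · exact ⟨σ, fun _ _ => rfl, Or.inl he⟩
    · obtain ⟨σ', h1, h2, h3⟩ := (liftable_of_finProd (δ := δ) hτ hβ).exists_bonded hτ hatt.1
        (hatt.bonded (hgf i).nonempty (TAS.FinProd.nonempty hβ))
        (by have := hgK (i + 1); rwa [show g (i + 1) = (f (k + i)).union β from he] at this) σ
      exact ⟨σ', h1, Or.inr ⟨β, h2, h3, hatt.1, he⟩⟩
  choose next hnext1 hnext2 using step
  let seq : ℕ → ℤ × ℤ → State := fun n => Nat.rec σ0 next n
  have hseq : ∀ i, seq (i + 1) = next i (seq i) := fun _ => rfl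
  have hagree : ∀ i j, i ≤ j → ∀ p ∈ dom (g i), seq j p = seq i p := by
    intro i j hij
    induction hij with
    | refl => exact fun _ _ => rfl
    | @step m hm ih =>
      intro p hp
      rw [hseq, hnext1 m (seq m) p ((sub_of_le hg hm).dom hp), ih p hp]
  let σ : ℤ × ℤ → State := fun p =>
    if h : ∃ i, p ∈ dom (g i) then seq (Nat.find h) p else s
  have hσ : ∀ i, ∀ p ∈ dom (g i), σ p = seq i p := by
    intro i p hp
    have hex : ∃ i, p ∈ dom (g i) := ⟨i, hp⟩
    have : σ p = seq (Nat.find hex) p := dif_pos hex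
    rw [this]
    exact (hagree _ _ (Nat.find_min' hex hp) p (Nat.find_spec hex)).symm
  have hfin : ∀ i, (macroSystem τ δ).FinProd (lift K (g i) σ) ∧
      (lift K (g (i + 1)) σ = lift K (g i) σ ∨ ∃ β, (macroSystem τ δ).FinProd β ∧
        (macroSystem τ δ).Bonded (lift K (g i) σ) β ∧
        Disjoint (dom (lift K (g i) σ)) (dom β) ∧
        lift K (g (i + 1)) σ = (lift K (g i) σ).union β) := by
    have hstep : ∀ i, lift K (g (i + 1)) σ = lift K (g i) σ ∨
        ∃ β, (macroSystem τ δ).FinProd β ∧ (macroSystem τ δ).Bonded (lift K (g i) σ) β ∧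
        Disjoint (dom (lift K (g i) σ)) (dom β) ∧
        lift K (g (i + 1)) σ = (lift K (g i) σ).union β := by
      intro i
      rcases hnext2 i (seq i) with he | ⟨β, h1, h2, h3, h4⟩
      · left; rw [he]
      · have e1 : lift K β (next i (seq i)) = lift K β σ := lift_congr fun p hp => by
          rw [← hseq, hσ (i + 1) p]
          rw [h4, dom_union]
          exact Or.inr hp
        have e2 : lift K (g i) (next i (seq i)) = lift K (g i) σ := lift_congr fun p hp => by
          rw [← hseq, hσ (i + 1) p ((hg i).dom hp)]
        rw [e1] at h1 h2
        rw [e2] at h2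
        exact Or.inr ⟨_, h1, h2, lift_disjoint h3, by rw [h4, lift_union h3]⟩
    intro i
    refine ⟨?_, hstep i⟩
    induction i with
    | zero =>
      rw [lift_congr (σ' := σ0) (hσ 0)]
      exact hf0
    | succ i ih =>
      rcases hstep i with he | ⟨β, h1, h2, h3, h4⟩
      · rwa [he]
      · rw [h4]
        exact ih.union h1 (TAS.attaches_of_bonded ih.stable h1.stable h3 h2)
  refine ⟨σ, ?_, TAS.prod_iff.2 ⟨_, (hfin 0).1, fun i => ?_, lift_isResult hgr⟩⟩
  · rw [hσ 0 q (mem_dom_of_eq hk)]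
    exact hσ0
  · rcases (hfin i).2 with he | ⟨β, h1, h2, h3, h4⟩
    · exact Or.inl he
    · exact Or.inr ⟨β, h1, TAS.attaches_of_bonded (hfin i).1.stable h1.stable h3 h2, h4⟩

end Lift

/-! ### From the ladder system to the simulating system -/

/-- Representatives of a combination may be chosen such that the first one is any given one. -/
theorem TAS.exists_of_mem_combine {S : TAS} {α : Assembly S.Tile} {b c : Set (Assembly S.Tile)}
    (hb : b ∈ S.Producible) (hc : c ∈ S.Combine (supertile α) b) :
    ∃ β, S.Prod β ∧ b = supertile β ∧ S.Attaches α β ∧ c = supertile (α.union β) := by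
  obtain ⟨β, rfl, hβ⟩ := TAS.exists_prod_of_mem hb
  obtain ⟨_, ⟨v, rfl⟩, _, ⟨w, rfl⟩, hatt, rfl⟩ := hc
  have hatt' := hatt.shift (-v)
  simp only [shift_shift, neg_add_cancel, shift_zero] at hatt'
  refine ⟨Assembly.shift (-v + w) β, hβ.shift _, by simp, hatt', ?_⟩
  rw [← supertile_shift (-v), shift_union]
  simp

theorem TAS.not_terminal_of_attaches {S : TAS} {α β : Assembly S.Tile}
    (h : supertile α ∈ S.Terminal) (hβ : S.Prod β) (hatt : S.Attaches α β) : False :=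
  Set.eq_empty_iff_forall_notMem.1 (h.2 _ hβ) _
    ⟨α, mem_supertile_self α, β, mem_supertile_self β, hatt, rfl⟩

section Cells

variable {α : Assembly MacroTile} {t : LadderTile} {p : ℤ × ℤ} {u : MacroTile}

theorem col_nbr (t : LadderTile) : t.nbr.col = t.col + t.out.vec.1 := by
  cases t <;> simp [nbr, col, out, Dir.vec]

/-- Only main tiles occur in the cells of main tiles. -/
theorem eq_main_of_mainCell (hα : Aligned α) (hp : p.1 = t.col)
    (h : α (mainCell t p) = some u) : ∃ t' s, u = main t' s := by
  obtain ⟨h1, r, h2⟩ := hα.eq h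
  rcases u with ⟨t', s⟩ | ⟨t', s⟩ | ⟨b, s⟩
  · exact ⟨t', s, rfl⟩
  · exfalso
    simp only [pos, mainCell, hp] at h1 h2
    cases t <;> cases t' <;> simp only [col, side, out, Dir.vec] at h1 h2 <;> omega
  · exfalso
    cases b <;> simp only [pos, mainCell] at h1 h2 <;> omega

/-- Only links in the same direction occur in the cells of links. -/
theorem eq_link_of_linkCell (hα : Aligned α) (hp : p.1 = t.col)
    (h : α (mainCell t p + t.out.vec) = some u) :
    ∃ t' s, u = link t' s ∧ t'.out = t.out ∧ t'.col = t.col ∧ t'.side = t.side := by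
  obtain ⟨h1, r, h2⟩ := hα.eq h
  rcases u with ⟨t', s⟩ | ⟨t', s⟩ | ⟨b, s⟩
  · exfalso
    simp only [pos, mainCell, hp, Prod.fst_add, Prod.snd_add] at h1 h2
    cases t <;> cases t' <;> simp only [col, side, out, Dir.vec] at h1 h2 <;> omega
  · refine ⟨t', s, rfl, ?_⟩
    simp only [pos, mainCell, hp, Prod.fst_add, Prod.snd_add] at h1 h2
    cases t <;> cases t' <;> first
      | exact ⟨rfl, rfl, rfl⟩
      | (exfalso; simp only [col, side, out, Dir.vec] at h1 h2; omega)
  · exfalso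
    cases b <;> simp only [pos, mainCell, hp, Prod.fst_add, Prod.snd_add] at h1 h2 <;>
      cases t <;> simp only [col, side, out, Dir.vec] at h1 h2 <;> omega

/-- Only plugs occur in the cells of plugs. -/
theorem eq_plug_of_plugCell {b : Bool} (hα : Aligned α) (hp : p.1 = (rungEnd b).col)
    (h : α (mainCell (rungEnd b) p + Dir.north.vec) = some u) : ∃ s, u = plug b s := by
  obtain ⟨h1, r, h2⟩ := hα.eq h
  rcases u with ⟨t', s⟩ | ⟨t', s⟩ | ⟨b', s⟩
  · exfalso
    simp only [pos, mainCell, Dir.vec, Prod.snd_add] at h2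
    omega
  · exfalso
    simp only [pos, mainCell, hp, Prod.fst_add, Prod.snd_add] at h1 h2
    cases b <;> cases t' <;> simp only [rungEnd, col, side, out, Dir.vec] at h1 h2 <;> omega
  · cases b <;> cases b' <;> first
      | exact ⟨s, rfl⟩
      | (exfalso; simp [pos, mainCell, hp, rungEnd, col, side, Dir.vec] at h1)

end Cells

section Model

variable {τ δ : ℕ} {α : Assembly MacroTile} {γ X Y : Assembly LadderTile}

/-- Producible assemblies of the ladder system occupy the columns of a ladder. -/
theorem exists_col (hτ : 0 < τ) (h : (ladderSystem τ).Prod γ) :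
    ∃ c : ℤ, ∀ p t, γ p = some t → p.1 = c + t.col := by
  obtain ⟨q, hq⟩ := h.nonempty
  obtain ⟨σ, -, hσ⟩ := exists_prod_lift (δ := 0) hτ h (true, .lo) (admissible_empty γ) hq
  obtain ⟨v, hv⟩ := exists_alignedAt hτ hσ
  have key : ∀ p t, γ p = some t → 2 * p.1 = v.1 + 2 * t.col := by
    intro p t ht
    have := (hv _ _ (lift_main (σ := σ) ht (Set.notMem_empty _))).1
    simp only [mainCell, pos] at this
    omega
  refine ⟨v.1 / 2, fun p t ht => ?_⟩
  have := key p t ht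
  omega

/-- A bond transfers the columns. -/
theorem col_of_bonded (hτ : 0 < τ) (hX : ∀ p t, X p = some t → p.1 = t.col)
    (hγ : (ladderSystem τ).Prod γ) (h : (ladderSystem τ).Bonded X γ) :
    ∀ p t, γ p = some t → p.1 = t.col := by
  obtain ⟨c, hc⟩ := exists_col hτ hγ
  obtain ⟨F, hF, hsum⟩ := h.exists_finset
  obtain ⟨e, he⟩ : F.Nonempty := by
    rw [Finset.nonempty_iff_ne_empty]
    rintro rfl
    rw [Finset.sum_empty] at hsum
    exact hτ.not_ge hsum
  obtain ⟨t, t', ht, ht', hg, hs⟩ := TAS.exists_of_pairBond_pos (hF e he)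
  have h1 := hX _ _ ht
  have h2 := hc _ _ ht'
  have h3 : t'.col = t.col + e.2.vec.1 := by
    rcases ladder_match hg hs with ⟨h3, rfl⟩ | ⟨h3, rfl⟩ | ⟨rfl, rfl, h3⟩ | ⟨rfl, rfl, h3⟩
    · rw [h3, col_nbr]
    · rw [col_nbr, ← h3, Dir.vec_opp, Prod.fst_neg, neg_add_cancel_right]
    · rw [h3]; rfl
    · rw [h3]; rfl
  simp only [Prod.fst_add] at h2
  intro p t ht
  rw [hc p t ht]
  omega

/-- Every producible supertile of the ladder system is represented. -/
theorem exists_prod_of_mem_ladder (hτ : 0 < τ) {a : Set (Assembly LadderTile)}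
    (h : a ∈ (ladderSystem τ).Producible) : ∃ α, (macroSystem τ δ).Prod α ∧ Aligned α ∧
      (dom (repr α)).Nonempty ∧ a = supertile (repr α) := by
  obtain ⟨γ, rfl, hγ⟩ := TAS.exists_prod_of_mem h
  obtain ⟨c, hc⟩ := exists_col hτ hγ
  have hγ' := hγ.shift (-c, 0)
  have hc' : ∀ p t, shift (-c, 0) γ p = some t → p.1 = t.col := by
    intro p t ht
    have := hc _ _ ht
    simp only [Prod.fst_sub] at this
    omega
  obtain ⟨q, hq⟩ := hγ'.nonempty
  obtain ⟨σ, -, hσ⟩ := exists_prod_lift (δ := δ) hτ hγ' (true, .lo) (admissible_empty _) hq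
  have hr : repr (lift ∅ (shift (-c, 0) γ) σ) = shift (-c, 0) γ :=
    repr_lift fun _ _ _ => Set.notMem_empty _
  refine ⟨_, hσ, lift_aligned hc', ?_, ?_⟩
  · rw [hr]; exact ⟨q, hq⟩
  · rw [hr, supertile_shift]

/-- Next to a producible assembly, the lift of an assembly can be completed except for links that
are already there. -/
theorem admissible_dom (hτ : 0 < τ) (hα : Aligned α) (hs : (macroSystem τ δ).Stable α)
    (hne : (dom (repr α)).Nonempty) (hγ : ∀ p t, γ p = some t → p.1 = t.col)
    (hd : Disjoint (dom (repr α)) (dom γ)) : Admissible (dom α) γ := by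
  -- a main tile of `α` represents a tile outside of `γ`
  have hmain : ∀ p t t' s, p.1 = t'.col → γ p = some t → α (mainCell t' p) ≠ some (main t' s) := by
    intro p t t' s hp hγp h
    exact Set.disjoint_left.1 hd (mem_dom_of_eq ((repr_eq_some hα).2 ⟨s, h⟩)) (mem_dom_of_eq hγp)
  have hcell : ∀ p t, γ p = some t → mainCell t p ∉ dom α := by
    intro p t ht hmem
    obtain ⟨u, hu⟩ := mem_dom.1 hmem
    obtain ⟨t', s, rfl⟩ := eq_main_of_mainCell hα (hγ p t ht) hu
    obtain ⟨q, hq, hq', hr⟩ := exists_repr_of_main hα hu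
    obtain rfl := mainCell_injective (hγ p t ht) hq' hq
    exact Set.disjoint_left.1 hd (mem_dom_of_eq hr) (mem_dom_of_eq ht)
  intro p t ht
  have hp := hγ p t ht
  refine ⟨hcell p t ht, fun b hb hmem => ?_, fun hmem => ?_⟩
  · subst hb
    obtain ⟨u, hu⟩ := mem_dom.1 hmem
    obtain ⟨s, rfl⟩ := eq_plug_of_plugCell hα hp hu
    have h := main_of_plug hτ hs hu (exists_ne_of_repr hne hu (by simp))
    rw [add_assoc, show Dir.north.vec + Dir.south.vec = 0 from rfl, add_zero] at h
    exact hmain p _ _ s hp ht h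
  · obtain ⟨u, hu⟩ := mem_dom.1 hmem
    obtain ⟨t', s, rfl, ho, hc, hsd⟩ := eq_link_of_linkCell hα hp hu
    rcases main_of_link hτ hs hu (exists_ne_of_repr hne hu (by simp)) with h | ⟨s', h, -⟩
    · rw [ho, Dir.vec_opp, add_neg_cancel_right] at h
      exact absurd (mem_dom_of_eq h) (hcell p t ht)
    · obtain ⟨q, hq, hq', hr⟩ := exists_repr_of_main hα h
      rw [ho, ← mainCell_out] at hq
      have hnb : (p + t.out.vec).1 = t.nbr.col := by rw [col_nbr, Prod.fst_add, hp]
      obtain rfl := mainCell_injective hnb hq' hq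
      exact notMem_dom.1 fun h => Set.disjoint_left.1 hd (mem_dom_of_eq hr) h

theorem repr_singleAt_empty {z : ℤ × ℤ} {u : MacroTile} (hu : ∀ t s, u ≠ main t s) :
    ¬ (dom (repr (singleAt z u))).Nonempty := by
  rintro ⟨p, hp⟩
  obtain ⟨t, ht⟩ := mem_dom.1 hp
  obtain ⟨s, hs⟩ := exists_main_of_repr ht
  exact hu t s (singleAt_eq_some.1 hs).2

/-- `β` is `α`, or `α` with one more tile. -/
def GrowsTo (τ δ : ℕ) (α β : Assembly MacroTile) : Prop :=
  β = α ∨ ∃ z u, (macroSystem τ δ).Attaches α (singleAt z u) ∧ β = α.union (singleAt z u)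

/-- A missing link or plug can be added. -/
theorem exists_growsTo (hτ : 0 < τ) (hα : (macroSystem τ δ).Prod α) (haα : Aligned α)
    {z : ℤ × ℤ} {u : MacroTile} (hu : ∀ t s, u ≠ main t s)
    (hb : (macroSystem τ δ).Bonded α (singleAt z u)) :
    ∃ β, GrowsTo τ δ α β ∧ (macroSystem τ δ).Prod β ∧ Aligned β ∧ repr β = repr α ∧
      Sub α β ∧ z ∈ dom β := by
  by_cases hz : z ∈ dom α
  · exact ⟨α, Or.inl rfl, hα, haα, rfl, Sub.refl α, hz⟩
  · have hd : Disjoint (dom α) (dom (singleAt z u)) := by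
      rw [dom_singleAt]; exact Set.disjoint_singleton_right.2 hz
    have hatt := TAS.attaches_of_bonded hα.stable (TAS.stable_singleAt z u) hd hb
    have hal : Aligned (singleAt z u) := haα.of_bonded hτ (alignedAt_singleAt z u) hb
    refine ⟨α.union (singleAt z u), Or.inr ⟨z, u, hatt, rfl⟩,
      hα.union (TAS.finProd_singleAt (S := macroSystem τ δ) z u).prod hatt, haα.union hal,
      repr_union_of_empty haα hal hd (repr_singleAt_empty hu), sub_union_left _ _, ?_⟩
    rw [dom_union, dom_singleAt]
    exact Or.inr rfl

/-- The step of the ladder system that attaches `γ` can be made by the simulating system, after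
one more tile has been added if necessary. -/
theorem exists_attaches (hτ : 0 < τ) (hα : (macroSystem τ δ).Prod α) (haα : Aligned α)
    (hne : (dom (repr α)).Nonempty) (hγ : (ladderSystem τ).Prod γ)
    (h : (ladderSystem τ).Attaches (repr α) γ) :
    ∃ β γ', GrowsTo τ δ α β ∧ (macroSystem τ δ).Prod β ∧ Aligned β ∧ repr β = repr α ∧
      Sub α β ∧ (macroSystem τ δ).Prod γ' ∧ Aligned γ' ∧ repr γ' = γ ∧
      (macroSystem τ δ).Attaches β γ' := by
  have hb := h.bonded hne hγ.nonempty
  have hcα : ∀ p t, repr α p = some t → p.1 = t.col := fun p t => col_of_repr haα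
  have hcγ := col_of_bonded hτ hcα hγ hb
  have adm : ∀ β, (macroSystem τ δ).Prod β → Aligned β → repr β = repr α →
      Admissible (dom β) γ := fun β hβ haβ hr =>
    admissible_dom hτ haβ hβ.stable (hr ▸ hne) hcγ (hr ▸ h.1)
  -- it remains to find `β` and the state of one macrotile of `γ` for which there is a bond
  suffices ∃ β q s, GrowsTo τ δ α β ∧ (macroSystem τ δ).Prod β ∧ Aligned β ∧ repr β = repr α ∧
      Sub α β ∧ q ∈ dom γ ∧ ∀ σ : ℤ × ℤ → State, σ q = s →
        (macroSystem τ δ).Bonded β (lift (dom β) γ σ) by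
    obtain ⟨β, q, s, hg, hβ, haβ, hr, hsub, hq, hbond⟩ := this
    obtain ⟨σ, hσ, hprod⟩ := exists_prod_lift (δ := δ) hτ hγ s (adm β hβ haβ hr) hq
    refine ⟨β, _, hg, hβ, haβ, hr, hsub, hprod, lift_aligned hcγ,
      repr_lift fun p t ht => (adm β hβ haβ hr p t ht).1,
      TAS.attaches_of_bonded hβ.stable hprod.stable ?_ (hbond σ hσ)⟩
    refine Set.disjoint_left.2 fun z hz hz' => ?_
    obtain ⟨u, hu⟩ := mem_dom.1 hz'
    exact (lift_eq_some.1 hu).1 hz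
  rcases ladder_bonded_cases hb with ⟨p, t, h1, h2⟩ | ⟨p, t, h1, h2⟩ | ⟨F, hF, hcard⟩
  · -- the link between `α` and `γ` belongs to a macrotile of `α`
    obtain ⟨s, hs⟩ := exists_main_of_repr h1
    obtain ⟨β, hg, hβ, haβ, hr, hsub, hz⟩ := exists_growsTo hτ hα haα
      (z := mainCell t p + t.out.vec) (u := link t s) (by simp)
      (bonded_own_link (singleAt_eq_some.2 ⟨rfl, rfl⟩) hs).symm
    obtain ⟨u, hu⟩ := mem_dom.1 hz
    obtain ⟨t', s', rfl, ho, -⟩ := eq_link_of_linkCell haβ (hcα p t h1) hu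
    have hmain : β (mainCell t p) = some (main t' s') := by
      rcases main_of_link hτ hβ.stable hu (exists_ne_of_repr (hr ▸ hne) hu (by simp)) with
        h3 | ⟨s'', h3, -⟩
      · rwa [ho, Dir.vec_opp, add_neg_cancel_right] at h3
      · rw [ho, ← mainCell_out] at h3
        exact absurd (mem_dom_of_eq h3) (adm β hβ haβ hr _ _ h2).1
    have heq := (hsub _ _ hs).symm.trans hmain
    simp only [Option.some.injEq, main.injEq] at heq
    obtain ⟨rfl, rfl⟩ := heq
    obtain ⟨s'', hs''⟩ := exists_compatible_right t s
    refine ⟨β, _, s'', hg, hβ, haβ, hr, hsub, mem_dom_of_eq h2, fun σ hσ => ?_⟩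
    refine bonded_of_link hu (lift_main h2 (adm β hβ haβ hr _ _ h2).1) ?_
    rw [hσ]
    exact hs''
  · -- the link between `α` and `γ` belongs to a macrotile of `γ`
    obtain ⟨s', hs'⟩ := exists_main_of_repr h2
    obtain ⟨s, hs⟩ := exists_compatible_left t s'
    obtain ⟨β, hg, hβ, haβ, hr, hsub, hz⟩ := exists_growsTo hτ hα haα
      (z := mainCell t p + t.out.vec) (u := link t s) (by simp)
      (bonded_of_link (singleAt_eq_some.2 ⟨rfl, rfl⟩) hs' hs).symm
    obtain ⟨u, hu⟩ := mem_dom.1 hz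
    obtain ⟨t', s'', rfl, ho, -⟩ := eq_link_of_linkCell haβ (hcγ p t h1) hu
    have hmain : ∃ x, β (mainCell t.nbr (p + t.out.vec)) = some (main t'.nbr x) := by
      rcases main_of_link hτ hβ.stable hu (exists_ne_of_repr (hr ▸ hne) hu (by simp)) with
        h3 | ⟨x, h3, -⟩
      · rw [ho, Dir.vec_opp, add_neg_cancel_right] at h3
        exact absurd (mem_dom_of_eq h3) (adm β hβ haβ hr _ _ h1).1
      · rw [ho, ← mainCell_out] at h3
        exact ⟨x, h3⟩
    obtain ⟨x, hx⟩ := hmain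
    have heq := (hsub _ _ hs').symm.trans hx
    simp only [Option.some.injEq, main.injEq] at heq
    have hn := heq.1
    obtain rfl : t = t' := by
      cases t <;> cases t' <;> first
        | rfl
        | (simp [out] at ho; done)
        | (simp [nbr] at hn)
    refine ⟨β, p, s'', hg, hβ, haβ, hr, hsub, mem_dom_of_eq h1, fun σ hσ => ?_⟩
    refine bonded_own_link hu ?_
    rw [← hσ]
    exact lift_main h1 (adm β hβ haβ hr _ _ h1).1
  · -- all bonds between `α` and `γ` are between facing rungs
    obtain ⟨⟨p, d⟩, he⟩ := Finset.card_pos.1 (hτ.trans_le hcard)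
    obtain ⟨b, hb1, hb2, hbd⟩ : ∃ b, repr α p = some (rungEnd b) ∧
        γ (p + d.vec) = some (rungEnd !b) ∧ d = cond b .east .west := by
      rcases hF _ he with ⟨h1, h2, h3⟩ | ⟨h1, h2, h3⟩
      exacts [⟨true, h1, h2, h3⟩, ⟨false, h1, h2, h3⟩]
    obtain ⟨s, hs⟩ := exists_main_of_repr hb1
    obtain ⟨β, hg, hβ, haβ, hr, hsub, hz⟩ := exists_growsTo hτ hα haα
      (z := mainCell (rungEnd b) p + Dir.north.vec) (u := plug b s) (by simp)
      (bonded_own_plug (singleAt_eq_some.2 ⟨rfl, rfl⟩) hs).symm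
    obtain ⟨u, hu⟩ := mem_dom.1 hz
    obtain ⟨s', rfl⟩ := eq_plug_of_plugCell haβ (hcα p _ hb1) hu
    have mβ : ∀ p t, repr α p = some t → ∃ s, β (mainCell t p) = some (main t s) := fun p t ht =>
      exists_main_of_repr (hr ▸ ht)
    have mγ : ∀ (σ : ℤ × ℤ → State) p t, γ p = some t →
        ∃ s, lift (dom β) γ σ (mainCell t p) = some (main t s) := fun σ p t ht =>
      ⟨_, lift_main ht (adm β hβ haβ hr p t ht).1⟩
    obtain ⟨s'', hs''⟩ : ∃ s'', (plug b s').kind d = (plug (!b) s'').kind d.opp ∧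
        ∃ e, (plug b s').kind d = .ext e := by
      subst hbd
      cases b
      · obtain ⟨s'', h⟩ := exists_extLeft s'
        exact ⟨s'', congrArg GlueKind.ext h.symm, _, rfl⟩
      · obtain ⟨s'', h⟩ := exists_extRight s'
        exact ⟨s'', congrArg GlueKind.ext h, _, rfl⟩
    refine ⟨β, _, s'', hg, hβ, haβ, hr, hsub, mem_dom_of_eq hb2, fun σ hσ => ?_⟩
    refine bonded_of_rungs mβ (mγ σ) hF hcard hu
      (lift_plug hb2 ((adm β hβ haβ hr _ _ hb2).2.1 _ rfl)) ?_ ?_ (by rw [hσ]; exact hs''.1) hs''.2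
    · subst hbd
      cases b <;> ext <;> simp [mainCell, rungEnd, side, Dir.vec] <;> ring
    · simp [mainCell, Dir.vec]

/-- A producible assembly that represents nothing is a link or a plug. -/
theorem eq_singleAt_of_repr_empty (hτ : 0 < τ) (hα : (macroSystem τ δ).Prod α) (haα : Aligned α)
    (hne : ¬ (dom (repr α)).Nonempty) :
    ∃ z u, α = singleAt z u ∧ ∀ t s, u ≠ main t s := by
  obtain ⟨z, hz⟩ := hα.nonempty
  obtain ⟨u, hu⟩ := mem_dom.1 hz
  refine ⟨z, u, ext_some fun p t => ?_, ?_⟩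
  · rw [singleAt_eq_some]
    constructor
    · intro h
      obtain rfl := eq_of_repr_empty hτ haα hα.stable hne hz (mem_dom_of_eq h)
      exact ⟨rfl, Option.some_injective _ (hu.symm.trans h)⟩
    · rintro ⟨rfl, rfl⟩
      exact hu
  · rintro t s rfl
    obtain ⟨p, -, -, hp⟩ := exists_repr_of_main haα hu
    exact hne ⟨p, mem_dom_of_eq hp⟩

/-- A terminal assembly represents something, as links and plugs can attach to their main
tiles. -/
theorem repr_nonempty_of_terminal (hτ : 0 < τ) (hα : (macroSystem τ δ).Prod α) (haα : Aligned α)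
    (h : supertile α ∈ (macroSystem τ δ).Terminal) : (dom (repr α)).Nonempty := by
  by_contra hne
  obtain ⟨z, u, rfl, hu⟩ := eq_singleAt_of_repr_empty hτ hα haα hne
  have hzu : singleAt z u z = some u := singleAt_eq_some.2 ⟨rfl, rfl⟩
  have key : ∀ z' u', z' ≠ z → (macroSystem τ δ).Bonded (singleAt z u) (singleAt z' u') →
      False := by
    intro z' u' hz' hb
    refine TAS.not_terminal_of_attaches h (TAS.finProd_singleAt z' u').prod
      (TAS.attaches_of_bonded (TAS.stable_singleAt _ _) (TAS.stable_singleAt _ _) ?_ hb)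
    rw [dom_singleAt, dom_singleAt]
    exact Set.disjoint_singleton.2 hz'.symm
  obtain ⟨h1, r, h2⟩ := haα.eq hzu
  rcases u with ⟨t, s⟩ | ⟨t, s⟩ | ⟨b, s⟩
  · exact hu t s rfl
  · have hz : z = mainCell t (t.col, r) + t.out.vec := by
      ext
      · simp only [pos, mainCell, Prod.fst_add] at h1 ⊢; omega
      · simp only [pos, mainCell, Prod.snd_add] at h2 ⊢; omega
    refine key (mainCell t (t.col, r)) (main t s) (fun h0 => ?_)
      (bonded_own_link (hz ▸ hzu) (singleAt_eq_some.2 ⟨rfl, rfl⟩))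
    have h3 := left_eq_add.1 (h0.trans hz)
    cases t <;> simp [out, Dir.vec] at h3
  · have hz : z = mainCell (rungEnd b) ((rungEnd b).col, r) + Dir.north.vec := by
      cases b
      · ext
        · simp only [pos, mainCell, rungEnd, side, col, Dir.vec, Prod.fst_add] at h1 ⊢; omega
        · simp only [pos, mainCell, Dir.vec, Prod.snd_add] at h2 ⊢; omega
      · ext
        · simp only [pos, mainCell, rungEnd, side, col, Dir.vec, Prod.fst_add] at h1 ⊢; omega
        · simp only [pos, mainCell, Dir.vec, Prod.snd_add] at h2 ⊢; omega
    refine key (mainCell (rungEnd b) ((rungEnd b).col, r)) (main (rungEnd b) s) (fun h0 => ?_)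
      (bonded_own_plug (hz ▸ hzu) (singleAt_eq_some.2 ⟨rfl, rfl⟩))
    have h3 := left_eq_add.1 (h0.trans hz)
    simp [Dir.vec] at h3

theorem macro_weaklyModels (hτ : 0 < τ) :
    WeaklyModels (macroSystem τ δ) (ladderSystem τ) 2 macroRepr := by
  rintro a ha b hb ⟨c, hc, hbc⟩ a' ha' haa
  obtain ⟨α, rfl, hα, haα⟩ := exists_aligned hτ ha'
  have hne : (dom (repr α)).Nonempty := by
    by_contra h
    rw [(superRepr_eq_empty_iff haα).2 h] at haa
    subst haa
    obtain ⟨x, hx, -⟩ := hbc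
    exact hx
  rw [superRepr_of_nonempty haα hne] at haa
  subst haa
  obtain ⟨γ, hγ, -, hatt, rfl⟩ := TAS.exists_of_mem_combine hc hbc
  obtain ⟨β, γ', hg, hβ, haβ, hr, hsub, hγ', haγ', hrγ, hatt'⟩ :=
    exists_attaches hτ hα haα hne hγ hatt
  refine ⟨supertile β, hβ, ?_, ⟨fun i => if i = 0 then α else β, β, rfl, fun i => ?_, ?_, rfl⟩,
    supertile (β.union γ'), hβ.union hγ' hatt',
    ⟨supertile γ', hγ', β, mem_supertile_self _, γ', mem_supertile_self _, hatt', rfl⟩, ?_⟩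
  · rw [superRepr_of_nonempty haβ (hr ▸ hne), hr]
  · rcases Nat.eq_zero_or_pos i with rfl | hi
    · rcases hg with rfl | ⟨z, u, h1, h2⟩
      · exact Or.inl (by simp)
      · exact Or.inr ⟨singleAt z u, (TAS.finProd_singleAt z u).prod, h1, h2⟩
    · exact Or.inl (by simp [hi.ne'])
  · intro p t
    refine ⟨fun h => ⟨1, h⟩, ?_⟩
    rintro ⟨i, hi⟩
    simp only at hi
    split_ifs at hi
    exacts [hsub p t hi, hi]
  · have hu : repr (β.union γ') = (repr α).union γ := by
      rw [(repr_union haβ haγ' hatt'.1).2, hr, hrγ]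
    rw [superRepr_of_nonempty (haβ.union haγ'), hu]
    rw [hu, dom_union]
    exact hne.inl

/-- Terminal supertiles represent terminal supertiles. -/
theorem superRepr_terminal (hτ : 0 < τ) {a : Set (Assembly MacroTile)}
    (h : a ∈ (macroSystem τ δ).Terminal) :
    superRepr 2 macroRepr a ∈ (ladderSystem τ).Terminal := by
  obtain ⟨α, rfl, hα, haα⟩ := exists_aligned hτ h.1
  have hne := repr_nonempty_of_terminal hτ hα haα h
  rw [superRepr_of_nonempty haα hne]
  refine ⟨repr_prod hτ hα haα hne, fun b hb => Set.eq_empty_of_forall_notMem fun c hc => ?_⟩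
  obtain ⟨γ, hγ, -, hatt, -⟩ := TAS.exists_of_mem_combine hb hc
  obtain ⟨β, γ', rfl | ⟨z, u, hg, -⟩, -, -, -, -, hγ', -, -, hatt'⟩ :=
    exists_attaches hτ hα haα hne hγ hatt
  · exact TAS.not_terminal_of_attaches h hγ' hatt'
  · exact TAS.not_terminal_of_attaches h (TAS.finProd_singleAt z u).prod hg

/-- Every terminal supertile of the ladder system is represented by a terminal supertile: add links
and plugs to a lift until no more can be added. -/
theorem exists_terminal (hτ : 0 < τ) {a : Set (Assembly LadderTile)}
    (h : a ∈ (ladderSystem τ).Terminal) :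
    ∃ b ∈ (macroSystem τ δ).Terminal, superRepr 2 macroRepr b = a := by
  obtain ⟨α, hα, haα, hne, rfl⟩ := exists_prod_of_mem_ladder (δ := δ) hτ h.1
  have := (macroSystem τ δ).finite
  obtain ⟨ω, hω, hsub, hnew, hsat⟩ := hα.exists_saturated (fun u => ∀ t s, u ≠ main t s)
  have haω : Aligned ω := by
    obtain ⟨v, hv⟩ := exists_alignedAt hτ hω
    obtain ⟨z, hz⟩ := hα.nonempty
    obtain ⟨u, hu⟩ := mem_dom.1 hz
    obtain ⟨e1, r, e2⟩ := haα.eq hu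
    obtain ⟨f1, r', f2⟩ := hv _ _ (hsub _ _ hu)
    intro y w hy
    obtain ⟨g1, r'', g2⟩ := hv y w hy
    exact ⟨by simp only [Prod.fst_zero]; omega, r'' + r - r', by simp only [Prod.snd_zero]; omega⟩
  have hr : repr ω = repr α := by
    refine ext_some fun p t => ⟨fun hp => ?_, repr_mono haω hsub p t⟩
    obtain ⟨s, hs⟩ := exists_main_of_repr hp
    rcases hnew _ _ hs with h1 | h1
    · exact (repr_eq_some haα).2 ⟨s, h1⟩
    · exact absurd rfl (h1 t s)
  have hneω : (dom (repr ω)).Nonempty := hr ▸ hne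
  refine ⟨supertile ω, ⟨hω, fun b hb => Set.eq_empty_of_forall_notMem fun c hc => ?_⟩, ?_⟩
  · obtain ⟨β, hβ, -, hatt, -⟩ := TAS.exists_of_mem_combine hb hc
    obtain ⟨w, hw⟩ := exists_alignedAt hτ hβ
    have haβ : Aligned β := haω.of_bonded hτ hw (hatt.bonded hω.nonempty hβ.nonempty)
    by_cases hneβ : (dom (repr β)).Nonempty
    · have hpβ := repr_prod hτ hβ haβ hneβ
      have hpω := repr_prod hτ hω haω hneω
      rw [← hr] at h
      exact TAS.not_terminal_of_attaches h hpβ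
        (repr_attaches hτ haω haβ hω.stable hβ.stable hneω hneβ hpω.stable hpβ.stable hatt)
    · obtain ⟨z, u, rfl, hu⟩ := eq_singleAt_of_repr_empty hτ hβ haβ hneβ
      exact hsat z u hu hatt
  · rw [superRepr_of_nonempty haω hneω, hr]

theorem macro_equivalentProductions (hτ : 0 < τ) :
    EquivalentProductions (macroSystem τ δ) (ladderSystem τ) 2 macroRepr := by
  refine ⟨Set.Subset.antisymm ?_ ?_, Set.Subset.antisymm ?_ ?_, fun a ha => mapsCleanly hτ ha⟩
  · rintro _ ⟨⟨a, ha, rfl⟩, hne⟩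
    obtain ⟨α, rfl, hα, haα⟩ := exists_aligned hτ ha
    have hne' : (dom (repr α)).Nonempty := by
      by_contra h
      exact hne ((superRepr_eq_empty_iff haα).2 h)
    rw [superRepr_of_nonempty haα hne']
    exact repr_prod hτ hα haα hne'
  · intro a ha
    obtain ⟨α, hα, haα, hne, rfl⟩ := exists_prod_of_mem_ladder (δ := δ) hτ ha
    refine ⟨⟨supertile α, hα, superRepr_of_nonempty haα hne⟩, fun h => ?_⟩
    exact Set.notMem_empty _ (Set.mem_singleton_iff.1 h ▸ mem_supertile_self (repr α))
  · rintro _ ⟨a, ha, rfl⟩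
    exact superRepr_terminal hτ ha
  · intro a ha
    obtain ⟨b, hb, rfl⟩ := exists_terminal (δ := δ) hτ ha
    exact ⟨b, hb, rfl⟩

end Model

end TwoHAM

/-- For `1 < τ < τ'`, some 2HAM system at temperature `τ'` simulates the ladder system at
temperature `τ`, at scale factor `2`. -/
theorem mainTheorem3 (τ τ' : ℕ) (hτ : 1 < τ) (hττ' : τ < τ') :
    ∃ S : TwoHAM.TAS, S.temp = τ' ∧
      ∃ R : TwoHAM.Block 2 S.Tile → Option (TwoHAM.ladderSystem τ).Tile,
        TwoHAM.Simulates S (TwoHAM.ladderSystem τ) 2 R := by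
  have h0 : 0 < τ := by omega
  exact ⟨TwoHAM.macroSystem τ (τ' - τ), by change τ + (τ' - τ) = τ'; omega, TwoHAM.macroRepr,
    TwoHAM.macro_equivalentProductions h0, TwoHAM.macro_follows h0, TwoHAM.macro_weaklyModels h0⟩
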